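/- **Setting.** Fix exponents $2\le s_1<\dots<s_N$, put $s=\gcd(s_1,\dots,s_N)$, and for $\zeta\in\mathbb C^N$ let $F(y,x;\zeta)=y-1-\sum_{n=1}^N\zeta_n x^{s_n}y^{s_n}$. Let $U(\cdot;\zeta)$ be the unique analytic germ at $x=0$ with $U(0;\zeta)=1$ and $F(U(x;\zeta),x;\zeta)=0$ (the Taylor branch), let $\rho_*(\zeta)\in(0,\infty]$ be the supremum of all $\rho>0$ such that it is analytic on $|x|<\rho$, and let $R_p(m;\zeta)=[x^{ms}]\,U(x;\zeta)^p$. A point $x_*\ne0$ with $|x_*|=\rho_*(\zeta)$ is a *dominant point* of $\zeta$ if the singular points of the Taylor branch on $|x|=\rho_*(\zeta)$ are exactly the points $e^{2\pi ij/s}x_*$, $0\le j<s$. It is *simple*, with branch value $\lambda$, if moreover $U(x;\zeta)\to\lambda\in\mathbb C$ as $x\to x_*$ in the disk $|x|<\rho_*(\zeta)$, and $F=\partial_yF=0\neq\partial_y^2F$ at $(\lambda,x_*)$. A *simple critical point* is a $\zeta_c$ with $\rho_*(\zeta_c)=1$ that has a simple dominant point. **Hypotheses on the path.** Let $\varepsilon\mapsto\zeta(\varepsilon)$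 be a $C^1$ path on some interval $[0,\varepsilon_1]$, $\varepsilon_1>0$, with $\zeta(0)$ a simple critical point, such that for all small $\varepsilon>0$ one has $\rho_*(\zeta(\varepsilon))=1+\varepsilon$, and $x_*(\varepsilon)$ is a simple dominant point of $\zeta(\varepsilon)$ with branch value $\lambda(\varepsilon)$. Put $z_*(\varepsilon)=x_*(\varepsilon)^s$ and write $\delta_z=1-z/z_*(\varepsilon)$. Let $\kappa(\varepsilon)\in\mathbb C$, and assume that the following *uniform square-root continuation* holds: there are $\varepsilon_0,\eta_0,c_0,C_0>0$, $M\in\mathbb R$, $\phi\in(0,\pi/2)$ such that for every $0<\varepsilon<\varepsilon_0$, with $$\Omega_\varepsilon=\{z:\ |z|<|z_*(\varepsilon)|+\eta_0/2,\ z\ne z_*(\varepsilon),\ |\arg(z/z_*(\varepsilon)-1)|>\phi\},$$ the Taylor branch, written as a function $\widehat U(z;\varepsilon)$ of $z=x^s$, continues analytically to $\Omega_\varepsilon$ and continuously to $\overline{\Omega_\varepsilon}$, with $|\widehat U(z;\varepsilon)|\le M$ for $z\in\partial\Omega_\varepsilon$; and there are $c(\varepsilon),d(\varepsilon)\in\mathbb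 C$ such that for all $z\in\Omega_\varepsilon$ with $|\delta_z|<\eta_0$, $$\bigl|\widehat U(z;\varepsilon)-\lambda(\varepsilon)-s^{-1/2}\kappa(\varepsilon)\delta_z^{1/2}-c(\varepsilon)\delta_z-d(\varepsilon)\delta_z^{3/2}\bigr|\le C_0|\delta_z|^2$$ (principal powers), where $|\lambda(\varepsilon)|\ge c_0$, $|\kappa(\varepsilon)|\ge c_0$ and $|\lambda(\varepsilon)|+|\kappa(\varepsilon)|+|c(\varepsilon)|+|d(\varepsilon)|\le C_0$. **Weighted blocks.** Put $\rho_*(\varepsilon)=\rho_*(\zeta(\varepsilon))$ and $\rho(\varepsilon)=\tfrac12(1+\rho_*(\varepsilon))$. Fix $\beta>0$ and $\alpha>\max\{M_0,L_0\}$, where $M_0,L_0$ are constants with $\sup_{|x|=\rho(\varepsilon)}|U(x;\zeta(\varepsilon))|\le M_0$ and $|\lambda(\varepsilon)|\le L_0$ for all small $\varepsilon>0$. For $q\in\{1,\dots,s\}$ set $p_j=q+js$ and $w_j=p_j^{3/2+\beta}\alpha^{p_j}$ ($j\ge0$). Let $\widetilde V^{(q)}(\varepsilon)$ be the map with matrix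 entries $\frac1{w_k}\frac{p_j}{\sqrt{p_k}}R_{p_k}(j-k;\zeta(\varepsilon))$ for $j\ge k\ge0$ and $0$ for $j<k$, and let $\widetilde G^{(q)}(\varepsilon)=\widetilde V^{(q)}(\varepsilon)^*\widetilde V^{(q)}(\varepsilon)$. Let $$L(\varepsilon)=\sum_{m\ge0}\frac{\eta(\varepsilon)^m}{m+1},\quad \eta(\varepsilon)=(\rho(\varepsilon)\rho_*(\varepsilon))^{-2s},\qquad A_p(\varepsilon)=-\frac{s^{-1/2}}{2\sqrt\pi}\,p\,\kappa(\varepsilon)\lambda(\varepsilon)^{p-1},$$ $$\widetilde d^{(q)}(\varepsilon)(j)=e^{-ij\arg z_*(\varepsilon)}\,\frac{s}{\sqrt{p_j}}\,\frac{\overline{A_{p_j}(\varepsilon)}}{w_j}\qquad(j\ge0),$$ and write $(u\otimes u)\xi=\langle u,\xi\rangle u$, with $\langle\cdot,\cdot\rangle$ linear in the second slot. **Lemma.** Under these hypotheses, for each $q\in\{1,\dots,s\}$ and all sufficiently small $\varepsilon>0$, the map $\widetilde V^{(q)}(\varepsilon)$ extends to a bounded operator on $\ell^2(\mathbb N_0)$,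 $\widetilde d^{(q)}(\varepsilon)\in\ell^2(\mathbb N_0)$, and the remainder $$\widetilde C^{(q)}(\varepsilon)=\widetilde G^{(q)}(\varepsilon)-L(\varepsilon)\,\widetilde d^{(q)}(\varepsilon)\otimes\widetilde d^{(q)}(\varepsilon)$$ is Hilbert–Schmidt, hence compact. Moreover there is a Hilbert–Schmidt (hence compact) operator $\widetilde C^{(q)}_*$ such that, as $\varepsilon\downarrow0$, $\widetilde C^{(q)}(\varepsilon)\to\widetilde C^{(q)}_*$ in operator norm, and indeed in Hilbert–Schmidt norm. -/

import Mathlib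

open Filter Topology Set Metric
open scoped ENNReal

namespace TodaHessian

noncomputable section

/-! ## The inverse-map equation and its Taylor branch -/

/-- The symmetry index `s = gcd (s_1, …, s_N)` of the leaf with exponents `e`. -/
def symIndex {N : ℕ} (e : Fin N → ℕ) : ℕ := Finset.univ.gcd e

/-- The polynomial `F(y, x; ζ) = y - 1 - ∑ ζ_n x^{s_n} y^{s_n}`. -/
def leafPoly {N : ℕ} (e : Fin N → ℕ) (ζ : Fin N → ℂ) (y x : ℂ) : ℂ :=
  y - 1 - ∑ n, ζ n * x ^ e n * y ^ e n

/-- `U` represents the germ at `x = 0` selected by `U 0 = 1` and `F (U x, x; ζ) = 0`. -/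
structure IsTaylorGerm {N : ℕ} (e : Fin N → ℕ) (ζ : Fin N → ℂ) (U : ℂ → ℂ) : Prop where
  analyticAt : AnalyticAt ℂ U 0
  map_zero : U 0 = 1
  eqn : ∀ᶠ x in 𝓝 (0 : ℂ), leafPoly e ζ (U x) x = 0

/-- Existence of the germ, by inverting `t ↦ t / (1 + ∑ ζ_n t^{s_n})` near `0`. -/
theorem exists_isTaylorGerm {N : ℕ} (e : Fin N → ℕ) (ζ : Fin N → ℂ) (he : ∀ n, 2 ≤ e n) :
    ∃ U, IsTaylorGerm e ζ U := by
  set P : ℂ → ℂ := fun t => 1 + ∑ n, ζ n * t ^ e n with hP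
  have hP0 : P 0 = 1 := by
    have : ∀ n, (0 : ℂ) ^ e n = 0 := fun n => zero_pow (by have := he n; omega)
    simp [hP, this]
  have hPd : ∀ t, AnalyticAt ℂ P t := by
    intro t
    refine analyticAt_const.add ?_
    exact Finset.analyticAt_fun_sum _ fun n _ => analyticAt_const.mul (analyticAt_id.pow _)
  have hg : AnalyticAt ℂ (fun t => t / P t) 0 :=
    analyticAt_id.div (hPd 0) (by rw [hP0]; exact one_ne_zero)
  have hd : deriv (fun t => t / P t) 0 = 1 := by
    have h1 := (hasDerivAt_id (0 : ℂ)).div (hPd 0).differentiableAt.hasDerivAt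
      (by rw [hP0]; exact one_ne_zero)
    have h2 := h1.deriv
    simpa [hP0, Pi.div_def] using h2
  have hd0 : deriv (fun t => t / P t) 0 ≠ 0 := by rw [hd]; exact one_ne_zero
  set τ := hg.hasStrictDerivAt.localInverse _ _ _ hd0 with hτ
  have hτa : AnalyticAt ℂ τ 0 := by
    simpa using hg.analyticAt_localInverse hd0
  have hri : ∀ᶠ x in 𝓝 (0 : ℂ), τ x / P (τ x) = x := by
    simpa using hg.hasStrictDerivAt.eventually_right_inverse hd0
  have hli : ∀ᶠ x in 𝓝 (0 : ℂ), τ (x / P x) = x :=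
    hg.hasStrictDerivAt.eventually_left_inverse hd0
  have hτ0 : τ 0 = 0 := by simpa using hli.self_of_nhds
  have hPne : ∀ᶠ x in 𝓝 (0 : ℂ), P (τ x) ≠ 0 := by
    have hc : ContinuousAt (fun x => P (τ x)) 0 :=
      ContinuousAt.comp (g := P) (hPd _).continuousAt hτa.continuousAt
    refine hc.eventually_ne ?_
    simp only [hτ0, hP0]; exact one_ne_zero
  refine ⟨fun x => P (τ x), (hPd (τ 0)).comp hτa, by simp [hτ0, hP0], ?_⟩
  filter_upwards [hri, hPne] with x hx hne
  have hx' : x * P (τ x) = τ x := by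
    rw [div_eq_iff hne] at hx; exact hx.symm
  have : ∀ n, ζ n * x ^ e n * P (τ x) ^ e n = ζ n * τ x ^ e n := by
    intro n; rw [mul_assoc, ← mul_pow, hx']
  simp only [leafPoly, this]
  simp only [hP]; ring

/-- The germ is unique. -/
theorem IsTaylorGerm.unique {N : ℕ} {e : Fin N → ℕ} {ζ : Fin N → ℂ} (he : ∀ n, 2 ≤ e n)
    {U V : ℂ → ℂ} (hU : IsTaylorGerm e ζ U) (hV : IsTaylorGerm e ζ V) : U =ᶠ[𝓝 0] V := by
  set h : ℂ → ℂ := fun x =>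
    ∑ n, ζ n * x ^ e n * ∑ i ∈ Finset.range (e n), U x ^ i * V x ^ (e n - 1 - i) with hh
  have hc : ContinuousAt (fun x => 1 - h x) 0 := by
    have hUc := hU.analyticAt.continuousAt
    have hVc := hV.analyticAt.continuousAt
    simp only [hh]
    fun_prop
  have h0 : h 0 = 0 := by
    have : ∀ n, (0 : ℂ) ^ e n = 0 := fun n => zero_pow (by have := he n; omega)
    simp [hh, this]
  have hne : ∀ᶠ x in 𝓝 (0 : ℂ), 1 - h x ≠ 0 := hc.eventually_ne (by simp [h0])
  filter_upwards [hU.eqn, hV.eqn, hne] with x hx hy hn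
  have key : (U x - V x) * (1 - h x) = 0 := by
    have e1 : (U x - V x) * h x = ∑ n, ζ n * x ^ e n * (U x ^ e n - V x ^ e n) := by
      simp only [hh, Finset.mul_sum (s := Finset.univ)]
      refine Finset.sum_congr rfl fun n _ => ?_
      rw [← (Commute.all (U x) (V x)).mul_geom_sum₂ (e n)]
      ring
    rw [mul_sub, e1]
    simp only [leafPoly] at hx hy
    simp only [mul_sub, Finset.sum_sub_distrib]
    linear_combination hx - hy
  exact sub_eq_zero.mp ((mul_eq_zero.mp key).resolve_right hn)

open Classical in
/-- The Taylor branch `U(·; ζ)`.  Only its germ at `0` is used. -/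
def taylorBranch {N : ℕ} (e : Fin N → ℕ) (ζ : Fin N → ℂ) : ℂ → ℂ :=
  if h : ∃ U, IsTaylorGerm e ζ U then h.choose else fun _ => 1

theorem isTaylorGerm_taylorBranch {N : ℕ} (e : Fin N → ℕ) (ζ : Fin N → ℂ)
    (he : ∀ n, 2 ≤ e n) : IsTaylorGerm e ζ (taylorBranch e ζ) := by
  have h := exists_isTaylorGerm e ζ he
  rw [taylorBranch, dif_pos h]
  exact h.choose_spec

/-- `V` is the analytic continuation of the Taylor branch to the (connected) domain `D ∋ 0`. -/
def IsBranchOn {N : ℕ} (e : Fin N → ℕ) (ζ : Fin N → ℂ) (D : Set ℂ) (V : ℂ → ℂ) : Prop :=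
  DifferentiableOn ℂ V D ∧ V =ᶠ[𝓝 0] taylorBranch e ζ

/-- The radius of analyticity
`ρ_*(ζ) = sup {ρ > 0 : U(·; ζ) is analytic on |x| < ρ}`, possibly `∞`. -/
def radius {N : ℕ} (e : Fin N → ℕ) (ζ : Fin N → ℂ) : ℝ≥0∞ :=
  sSup (ENNReal.ofReal '' {ρ : ℝ | 0 < ρ ∧ ∃ V, IsBranchOn e ζ (ball 0 ρ) V})

/-- `R_p(m; ζ) = [x^{ms}] U(x; ζ)^p`. -/
def powCoeff {N : ℕ} (e : Fin N → ℕ) (ζ : Fin N → ℂ) (p m : ℕ) : ℂ :=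
  iteratedDeriv (m * symIndex e) (fun x => taylorBranch e ζ x ^ p) 0 /
    (Nat.factorial (m * symIndex e) : ℂ)

/-! ## Dominant orbit and simple critical points -/

/-- The boundary point `y` of the disk `|x| < |y|` is singular for the Taylor branch: the branch
on that disk does not extend analytically across `y`. -/
def IsSingularAt {N : ℕ} (e : Fin N → ℕ) (ζ : Fin N → ℂ) (y : ℂ) : Prop :=
  ¬ ∃ V W : ℂ → ℂ, IsBranchOn e ζ (ball 0 ‖y‖) V ∧ AnalyticAt ℂ W y ∧
    W =ᶠ[𝓝[ball 0 ‖y‖] y] V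

/-- The analytic boundary is dominant modulo the `s`-symmetry, with representative `x`: the
singular points on `|y| = ρ_*(ζ) = |x|` are exactly the `s` points `e^{2πij/s} x`. -/
structure IsDominantPoint {N : ℕ} (e : Fin N → ℕ) (ζ : Fin N → ℂ) (x : ℂ) : Prop where
  ne_zero : x ≠ 0
  radius_eq : radius e ζ = ENNReal.ofReal ‖x‖
  singular_iff : ∀ y : ℂ, ‖y‖ = ‖x‖ → (IsSingularAt e ζ y ↔
    ∃ j < symIndex e,
      y = Complex.exp (2 * Real.pi * Complex.I * (j : ℂ) / (symIndex e : ℂ)) * x)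

/-- `lam` is the finite value attained at `x` by the Taylor branch on the disk `|y| < |x|`. -/
def IsBranchValue {N : ℕ} (e : Fin N → ℕ) (ζ : Fin N → ℂ) (x lam : ℂ) : Prop :=
  ∃ V, IsBranchOn e ζ (ball 0 ‖x‖) V ∧ Tendsto V (𝓝[ball 0 ‖x‖] x) (𝓝 lam)

/-- `x` represents the unique dominant `s`-orbit and is a simple branch point with
value `lam`: `F = ∂_y F = 0 ≠ ∂_y² F` at `(lam, x)`. -/
structure IsSimpleDominantPoint {N : ℕ} (e : Fin N → ℕ) (ζ : Fin N → ℂ) (x lam : ℂ) : Prop where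
  dominant : IsDominantPoint e ζ x
  value : IsBranchValue e ζ x lam
  F_eq : leafPoly e ζ lam x = 0
  dF_eq : deriv (fun y => leafPoly e ζ y x) lam = 0
  ddF_ne : iteratedDeriv 2 (fun y => leafPoly e ζ y x) lam ≠ 0

/-- The analytic critical locus `𝒞`. -/
def criticalLocus {N : ℕ} (e : Fin N → ℕ) : Set (Fin N → ℂ) :=
  {ζ | radius e ζ = 1 ∧ ∃ x, IsDominantPoint e ζ x}

/-- Simple critical points. -/
def IsSimpleCritical {N : ℕ} (e : Fin N → ℕ) (ζ : Fin N → ℂ) : Prop :=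
  ζ ∈ criticalLocus e ∧ ∃ x lam, IsSimpleDominantPoint e ζ x lam

/-! ## The hypotheses along the critical approach -/

/-- The indented disk `{|z| < |ξ| + h} ∩ Δ(ξ, φ)`: the disk with the closed sector of half-angle
`φ` at `ξ`, pointing away from `0`, removed. -/
def indentedDisk (ξ : ℂ) (φ h : ℝ) : Set ℂ :=
  {z | ‖z‖ < ‖ξ‖ + h ∧ z ≠ ξ ∧ φ < |Complex.arg (z / ξ - 1)|}

/-- The uniform square-root continuation condition along the path.  `Uh ε` is the Taylor sheet in
the variable `z = x ^ s`, with its boundary values; `z_*(ε) = xs ε ^ s`. -/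
def UniformSqrtContinuation {N : ℕ} (e : Fin N → ℕ) (ζ : ℝ → Fin N → ℂ)
    (xs lam kap : ℝ → ℂ) : Prop :=
  ∃ ε₀ > (0 : ℝ), ∃ φ ∈ Ioo 0 (Real.pi / 2), ∃ η₀ > (0 : ℝ), ∃ C₀ > (0 : ℝ), ∃ c₀ > (0 : ℝ),
  ∃ M : ℝ, ∃ Uh : ℝ → ℂ → ℂ, ∃ c d : ℝ → ℂ, ∀ ε ∈ Ioo 0 ε₀,
    let zs : ℂ := xs ε ^ symIndex e
    let Ω : Set ℂ := indentedDisk zs φ (η₀ / 2)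
    -- the Taylor sheet continues to `Ω`, with uniformly bounded boundary values
    DiffContOnCl ℂ (Uh ε) Ω ∧
    (∀ᶠ x in 𝓝 (0 : ℂ), Uh ε (x ^ symIndex e) = taylorBranch e (ζ ε) x) ∧
    (∀ z ∈ frontier Ω, ‖Uh ε z‖ ≤ M) ∧
    -- the Puiseux expansion to order `3/2`, with uniform constants
    c₀ ≤ ‖lam ε‖ ∧ c₀ ≤ ‖kap ε‖ ∧ ‖lam ε‖ + ‖kap ε‖ + ‖c ε‖ + ‖d ε‖ ≤ C₀ ∧
    ∀ z ∈ Ω, ‖1 - z / zs‖ < η₀ →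
      ‖Uh ε z - (lam ε
          + ((Real.sqrt (symIndex e))⁻¹ : ℝ) * kap ε * (1 - z / zs) ^ (1 / 2 : ℂ)
          + c ε * (1 - z / zs) + d ε * (1 - z / zs) ^ (3 / 2 : ℂ))‖
        ≤ C₀ * ‖1 - z / zs‖ ^ 2

/-- The hypotheses on the path `ε ↦ ζ(ε)`, the representative `xs ε` of the dominant orbit, the
branch value `lam ε` there and the square-root coefficient `kap ε`.  Transversality is expressed by
the parametrization `ρ_*(ζ(ε)) = 1 + ε`. -/
structure StandingHypotheses {N : ℕ} (e : Fin N → ℕ) (ζ : ℝ → Fin N → ℂ)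
    (xs lam kap : ℝ → ℂ) : Prop where
  path : ∃ ε₁ > (0 : ℝ), ContDiffOn ℝ 1 ζ (Icc 0 ε₁)
  limit : IsSimpleCritical e (ζ 0)
  param : ∀ᶠ ε in 𝓝[>] (0 : ℝ), radius e (ζ ε) = ENNReal.ofReal (1 + ε)
  dominant : ∀ᶠ ε in 𝓝[>] (0 : ℝ), IsSimpleDominantPoint e (ζ ε) (xs ε) (lam ε)
  uniform : UniformSqrtContinuation e ζ xs lam kap

/-- The midpoint radius `ρ = (1 + ρ_*) / 2`. -/
def midRadius {N : ℕ} (e : Fin N → ℕ) (ζ : Fin N → ℂ) : ℝ := (1 + (radius e ζ).toReal) / 2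

/-- `α > max {M₀, L₀}` where `M₀` bounds `|U(·; ζ(ε))|` on the midpoint circle and `L₀` bounds
`|λ(ε)|`, uniformly for small `ε > 0`. -/
def AdmissibleWeight {N : ℕ} (e : Fin N → ℕ) (ζ : ℝ → Fin N → ℂ) (lam : ℝ → ℂ) (α : ℝ) : Prop :=
  ∃ M₀ L₀ : ℝ, max M₀ L₀ < α ∧ ∀ᶠ ε in 𝓝[>] (0 : ℝ),
    (∃ V, IsBranchOn e (ζ ε) (ball 0 (radius e (ζ ε)).toReal) V ∧
      ∀ x : ℂ, ‖x‖ = midRadius e (ζ ε) → ‖V x‖ ≤ M₀) ∧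
    ‖lam ε‖ ≤ L₀

/-! ## The renormalized Gram block and its rank-one part -/

/-- `p_j = q + j s`. -/
def pIdx {N : ℕ} (e : Fin N → ℕ) (q j : ℕ) : ℕ := q + j * symIndex e

/-- The weights `w_j = p_j^{3/2 + β} α^{p_j}`. -/
def weight {N : ℕ} (e : Fin N → ℕ) (q : ℕ) (α β : ℝ) (j : ℕ) : ℝ :=
  (pIdx e q j : ℝ) ^ (3 / 2 + β) * α ^ pIdx e q j

/-- The Gram vectors `v^{(p_k)}_j = (p_j / √p_k) R_{p_k}(j - k)` for `j ≥ k`, and `0` otherwise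
(note `(p_j - p_k) / s = j - k`). -/
def gramVec {N : ℕ} (e : Fin N → ℕ) (ζ : Fin N → ℂ) (q k j : ℕ) : ℂ :=
  if k ≤ j then
    (((pIdx e q j : ℝ) / Real.sqrt (pIdx e q k) : ℝ) : ℂ) * powCoeff e ζ (pIdx e q k) (j - k)
  else 0

/-- The matrix of the renormalized synthesis map `Ṽ = V 𝒲⁻¹`. -/
def synthesisMatrix {N : ℕ} (e : Fin N → ℕ) (ζ : Fin N → ℂ) (q : ℕ) (α β : ℝ) (j k : ℕ) : ℂ :=
  gramVec e ζ q k j / (weight e q α β k : ℂ)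

/-- `ℓ²(ℕ₀)`. -/
abbrev EllTwo : Type := lp (fun _ : ℕ => ℂ) 2

/-- The standard unit vectors of `ℓ²(ℕ₀)`. -/
def unitVec (k : ℕ) : EllTwo := lp.single 2 k (1 : ℂ)

/-- The bounded operator `T` extends the map with matrix `A` on finitely supported sequences. -/
def HasMatrix (T : EllTwo →L[ℂ] EllTwo) (A : ℕ → ℕ → ℂ) : Prop :=
  ∀ j k, (T (unitVec k) : ℕ → ℂ) j = A j k

/-- Hilbert–Schmidt operators on `ℓ²(ℕ₀)`. -/
def IsHilbertSchmidt (T : EllTwo →L[ℂ] EllTwo) : Prop :=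
  Summable fun k => ‖T (unitVec k)‖ ^ 2

/-- The Hilbert–Schmidt norm (of a Hilbert–Schmidt operator). -/
def hsNorm (T : EllTwo →L[ℂ] EllTwo) : ℝ := Real.sqrt (∑' k, ‖T (unitVec k)‖ ^ 2)

/-- `L = ∑ η^m / (m + 1)` with `η = (ρ ρ_*)^{-2s}` and `ρ` the midpoint radius. -/
def logScale {N : ℕ} (e : Fin N → ℕ) (ζ : Fin N → ℂ) : ℝ :=
  ∑' m : ℕ, (((midRadius e ζ * (radius e ζ).toReal) ^ (2 * symIndex e))⁻¹) ^ m / (m + 1)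

/-- The transfer amplitude `A_p = -(s^{-1/2} / (2 √π)) p κ λ^{p-1}`. -/
def amplitude {N : ℕ} (e : Fin N → ℕ) (lam kap : ℂ) (p : ℕ) : ℂ :=
  -(((Real.sqrt (symIndex e))⁻¹ / (2 * Real.sqrt Real.pi) : ℝ) : ℂ) * p * kap * lam ^ (p - 1)

/-- The spike `d(j) = e^{-ijϕ} (s / √p_j) conj (A_{p_j}) / w_j`, where `ϕ = arg (x_*^s)`. -/
def spike {N : ℕ} (e : Fin N → ℕ) (q : ℕ) (α β : ℝ) (x lam kap : ℂ) (j : ℕ) : ℂ :=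
  Complex.exp (-Complex.I * j * Complex.arg (x ^ symIndex e)) *
    (((symIndex e : ℝ) / Real.sqrt (pIdx e q j) : ℝ) : ℂ) *
    (starRingEnd ℂ) (amplitude e lam kap (pIdx e q j)) / (weight e q α β j : ℂ)

end

end TodaHessian

open TodaHessian

namespace TodaHessian

/-! ## Operators on `ℓ²(ℕ₀)` with absolutely summable columns -/

/-! Write `z` for `z_*(ε)`, so `‖z‖ > 1` and `‖z‖ → 1`. The whole argument rests on one estimate for
the matrix `v` of the synthesis map: `z ^ j * v j k = y k / √(j+1) + O(B k / (j+1))`, where `y k =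
‖z‖ ^ k * conj (d k)`, `d` is the spike, and `B` is summable and independent of `ε`. Multiplying two
columns, the Gram entry `(k, m)` is `∑ ‖z‖^(-2j)` times `conj (y k) * y m / (j+1) + O(B k * B m *
(j+1)^(-3/2))`. The first part is a logarithmic series times a rank-one matrix; the second is summed
by dominated convergence up to `‖z‖ = 1`. Replacing `‖z‖ ^ (k+m)` by `1` costs `(‖z‖ - 1)` times a
logarithm, which vanishes, and replacing the logarithmic series by `L` costs a convergent amount,
since both gaps `1 - ‖z‖⁻²` and `1 - η` are linear in `ε`. Every error is dominated by a multiple of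
`B k * B m`, so the remainder converges in `ℓ¹` of its entries, which controls both the operator and
the Hilbert–Schmidt norm.

The limits of `z` and of the amplitudes are not assumed. The entries `v j k` converge because Taylor
coefficients of the branch are continuous in `ζ`; the uniform asymptotics then force `z` and each `y
k` to converge (`exists_tendsto_multiplier`, `exists_tendsto_amplitude`).

The estimate itself is singularity analysis, uniform in the exponent `p`
(`exists_taylorCoeff_pow_asymptotic`). On a fan around the unit disk the rescaled sheet is bounded
by some `A < α`, so its `p`-th power is `λ^p + p λ^(p-1) κ' (1-w)^(1/2) + O(p² A^p |1-w|)`, with `κ'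
= s^(-1/2) κ`. The coefficients of the root come from the Wallis product, those of the error from a
third derivative and the Poisson kernel (`norm_taylorCoeff_le_of_fan`). The gap `A < α` makes the
weighted columns summable. -/

theorem exists_ellTwo_of_summable_sq {a : ℕ → ℂ} (h : Summable fun j => ‖a j‖ ^ 2) :
    ∃ x : EllTwo, (x : ℕ → ℂ) = a := by
  have : Memℓp a 2 := by
    refine memℓp_gen ?_
    simpa using h
  exact ⟨⟨a, this⟩, rfl⟩

theorem summable_sq_of_summable {a : ℕ → ℝ} (h0 : ∀ k, 0 ≤ a k) (h : Summable a) :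
    Summable fun k => a k ^ 2 := by
  refine Summable.of_nonneg_of_le (fun k => sq_nonneg _) (fun k => ?_) (h.mul_left (∑' k, a k))
  rw [sq]
  exact mul_le_mul_of_nonneg_right (h.le_tsum k fun j _ => h0 j) (h0 k)

theorem norm_unitVec (k : ℕ) : ‖unitVec k‖ = 1 := by
  simp [unitVec, lp.norm_single]

theorem hasSum_smul_unitVec (x : EllTwo) :
    HasSum (fun k => (x : ℕ → ℂ) k • unitVec k) x := by
  have h := lp.hasSum_single (p := 2) (by simp) x
  convert h using 2 with k
  rw [unitVec, ← lp.single_smul]; simp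

theorem norm_ellTwo_le_tsum {x : EllTwo} (h : Summable fun j => ‖(x : ℕ → ℂ) j‖) :
    ‖x‖ ≤ ∑' j, ‖(x : ℕ → ℂ) j‖ := by
  have h1 := hasSum_smul_unitVec x
  rw [← h1.tsum_eq]
  have h2 : ∀ j, ‖(x : ℕ → ℂ) j • unitVec j‖ = ‖(x : ℕ → ℂ) j‖ := fun j => by
    rw [norm_smul, norm_unitVec, mul_one]
  have := norm_tsum_le_tsum_norm (f := fun k => (x : ℕ → ℂ) k • unitVec k) (by simpa only [h2] using h)
  simpa only [h2, h1.tsum_eq] using this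

theorem inner_unitVec_left (k : ℕ) (x : EllTwo) : inner ℂ (unitVec k) x = (x : ℕ → ℂ) k := by
  rw [unitVec, lp.inner_single_left]; simp

theorem clm_ext_unitVec {T S : EllTwo →L[ℂ] EllTwo} (h : ∀ k, T (unitVec k) = S (unitVec k)) :
    T = S := by
  ext1 x
  have h1 := (hasSum_smul_unitVec x).mapL T
  have h2 := (hasSum_smul_unitVec x).mapL S
  simp only [map_smul, h] at h1 h2
  exact h1.unique h2

theorem summable_rankOne_unitVec {c : ℕ → EllTwo} (hc : Summable fun k => ‖c k‖) :
    Summable fun k => InnerProductSpace.rankOne ℂ (c k) (unitVec k) := by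
  refine Summable.of_norm ?_
  simpa [norm_unitVec] using hc

theorem tsum_rankOne_unitVec_apply {c : ℕ → EllTwo} (hc : Summable fun k => ‖c k‖) (k : ℕ) :
    (∑' i, InnerProductSpace.rankOne ℂ (c i) (unitVec i)) (unitVec k) = c k := by
  have h := (summable_rankOne_unitVec hc).hasSum.mapL
    (ContinuousLinearMap.apply ℂ EllTwo (unitVec k))
  refine h.unique ?_
  convert hasSum_single k ?_ using 1
  · simp [unitVec]
  · intro b hb
    have h0 : inner ℂ (unitVec b) (unitVec k) = 0 := by
      rw [inner_unitVec_left, unitVec, lp.single_apply_ne _ _ _ hb]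
    simp [h0]

theorem exists_clm_of_summable_cols {c : ℕ → EllTwo} (hc : Summable fun k => ‖c k‖) :
    ∃ T : EllTwo →L[ℂ] EllTwo, ∀ k, T (unitVec k) = c k :=
  ⟨_, tsum_rankOne_unitVec_apply hc⟩

/-- This expansion along the basis yields both the operator-norm bound and compactness, the latter
as a norm limit of finite-rank operators. -/
theorem eq_tsum_rankOne {T : EllTwo →L[ℂ] EllTwo} (h : Summable fun k => ‖T (unitVec k)‖) :
    T = ∑' k, InnerProductSpace.rankOne ℂ (T (unitVec k)) (unitVec k) :=
  clm_ext_unitVec fun k => (tsum_rankOne_unitVec_apply h k).symm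

theorem norm_le_tsum_cols {T : EllTwo →L[ℂ] EllTwo} (h : Summable fun k => ‖T (unitVec k)‖) :
    ‖T‖ ≤ ∑' k, ‖T (unitVec k)‖ := by
  conv_lhs => rw [eq_tsum_rankOne h]
  refine (norm_tsum_le_tsum_norm ?_).trans_eq ?_ <;> simp [norm_unitVec, h]

theorem isCompactOperator_of_summable_cols {T : EllTwo →L[ℂ] EllTwo}
    (h : Summable fun k => ‖T (unitVec k)‖) : IsCompactOperator T := by
  have hs := (summable_rankOne_unitVec h).hasSum
  rw [← eq_tsum_rankOne h] at hs
  refine isCompactOperator_of_tendsto hs (Eventually.of_forall fun s => ?_)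
  classical
  have hr : ∀ x y : EllTwo, IsCompactOperator (InnerProductSpace.rankOne ℂ x y) := by
    intro x y
    rw [InnerProductSpace.rankOne_def']
    exact (isCompactOperator_of_locallyCompactSpace_rng
      (ContinuousLinearMap.toSpanSingleton ℂ x)).comp_clm _
  induction s using Finset.induction_on with
  | empty => simpa using isCompactOperator_zero
  | insert a s ha ih =>
    rw [Finset.sum_insert ha]
    exact (hr _ _).add ih

theorem isHilbertSchmidt_of_summable_cols {T : EllTwo →L[ℂ] EllTwo}
    (h : Summable fun k => ‖T (unitVec k)‖) : IsHilbertSchmidt T :=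
  summable_sq_of_summable (fun _ => norm_nonneg _) h

/-- An `ℓ²` norm is at most the `ℓ¹` norm, so a single `ℓ¹` bound on columns serves both modes of
convergence. -/
theorem hsNorm_le_tsum_cols {T : EllTwo →L[ℂ] EllTwo} (h : Summable fun k => ‖T (unitVec k)‖) :
    hsNorm T ≤ ∑' k, ‖T (unitVec k)‖ := by
  have h0 : 0 ≤ ∑' k, ‖T (unitVec k)‖ := tsum_nonneg fun _ => norm_nonneg _
  refine Real.sqrt_le_iff.2 ⟨h0, ?_⟩
  rw [sq, ← tsum_mul_left]
  refine Summable.tsum_le_tsum (fun k => ?_) (isHilbertSchmidt_of_summable_cols h) (h.mul_left _)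
  rw [sq]
  exact mul_le_mul_of_nonneg_right (h.le_tsum k fun j _ => norm_nonneg _) (norm_nonneg _)

/-- Control of the columns of an operator by a bound on its matrix entries. -/
theorem summable_cols_of_entry_le {T : EllTwo →L[ℂ] EllTwo} {b : ℕ × ℕ → ℝ} (hb : Summable b)
    (h : ∀ p : ℕ × ℕ, ‖(T (unitVec p.2) : ℕ → ℂ) p.1‖ ≤ b p) :
    (Summable fun k => ‖T (unitVec k)‖) ∧
      ∑' k, ‖T (unitVec k)‖ ≤ ∑' p : ℕ × ℕ, ‖(T (unitVec p.2) : ℕ → ℂ) p.1‖ := by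
  have h1 : Summable fun p : ℕ × ℕ => ‖(T (unitVec p.2) : ℕ → ℂ) p.1‖ :=
    Summable.of_nonneg_of_le (fun _ => norm_nonneg _) h hb
  have h2 : Summable fun p : ℕ × ℕ => ‖(T (unitVec p.1) : ℕ → ℂ) p.2‖ :=
    (Equiv.prodComm ℕ ℕ).summable_iff.2 h1
  have h3 : ∀ k, ‖T (unitVec k)‖ ≤ ∑' j, ‖(T (unitVec k) : ℕ → ℂ) j‖ := fun k =>
    norm_ellTwo_le_tsum (h2.prod_factor k)
  have h4 : Summable fun k => ‖T (unitVec k)‖ :=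
    Summable.of_nonneg_of_le (fun _ => norm_nonneg _) h3 h2.prod
  refine ⟨h4, (h4.tsum_le_tsum h3 h2.prod).trans_eq ?_⟩
  rw [← h2.tsum_prod, ← (Equiv.prodComm ℕ ℕ).tsum_eq]
  rfl

/-! ## Limits of Gram matrices with a logarithmically divergent rank-one part -/

/-- The image filter is Cauchy. This produces limits for quantities with no candidate limit at hand,
from approximants that vary with the accuracy. -/
theorem exists_tendsto_of_approx {ι : Type*} {l : Filter ι} [NeBot l] {F : ι → ℂ}
    (h : ∀ δ > 0, ∃ g : ι → ℂ, ∃ y, Tendsto g l (𝓝 y) ∧ ∀ᶠ i in l, ‖F i - g i‖ ≤ δ) :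
    ∃ y, Tendsto F l (𝓝 y) := by
  refine cauchy_map_iff_exists_tendsto.1 (Metric.cauchy_iff.2 ⟨inferInstance, fun δ hδ => ?_⟩)
  obtain ⟨g, y, hg, hF⟩ := h (δ / 4) (by positivity)
  refine ⟨ball y (δ / 2), ?_, fun a ha b hb => ?_⟩
  · rw [mem_map]
    filter_upwards [hF, hg (ball_mem_nhds y (show 0 < δ / 4 by positivity))] with i h1 h2
    simp only [mem_preimage, mem_ball, dist_eq_norm] at h2 ⊢
    calc ‖F i - y‖ = ‖(F i - g i) + (g i - y)‖ := by congr 1; ring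
      _ ≤ _ := norm_add_le _ _
      _ < δ / 2 := by linarith
  · have := dist_triangle_right a b y
    simp only [mem_ball] at ha hb
    linarith

theorem tendsto_inv_sqrt_succ :
    Tendsto (fun j : ℕ => (Real.sqrt ((j : ℝ) + 1))⁻¹) atTop (𝓝 0) := by
  refine tendsto_inv_atTop_zero.comp (Real.tendsto_sqrt_atTop.comp ?_)
  exact tendsto_atTop_add_const_right _ _ tendsto_natCast_atTop_atTop

theorem inv_sqrt_succ_sq (j : ℕ) :
    (Real.sqrt ((j : ℝ) + 1))⁻¹ * (Real.sqrt ((j : ℝ) + 1))⁻¹ = 1 / ((j : ℝ) + 1) := by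
  rw [← mul_inv, Real.mul_self_sqrt (by positivity), one_div]

theorem inv_sqrt_succ_le_one (j : ℕ) : (Real.sqrt ((j : ℝ) + 1))⁻¹ ≤ 1 := by
  refine inv_le_one_of_one_le₀ (Real.one_le_sqrt.2 ?_)
  have : (0 : ℝ) ≤ j := Nat.cast_nonneg j
  linarith

/-- Rescaling by `√(j+1)` lets the amplitude be read off from one large index, with error
`O((j+1)^(-1/2))`. -/
theorem norm_scaled_sub_le {P y : ℂ} {b : ℝ} {j : ℕ}
    (h : ‖P - y * ((Real.sqrt ((j : ℝ) + 1))⁻¹ : ℝ)‖ ≤ b / ((j : ℝ) + 1)) :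
    ‖P * (Real.sqrt ((j : ℝ) + 1) : ℝ) - y‖ ≤ b * (Real.sqrt ((j : ℝ) + 1))⁻¹ := by
  have hs : 0 < Real.sqrt ((j : ℝ) + 1) := Real.sqrt_pos.2 (by positivity)
  have hs' : ((Real.sqrt ((j : ℝ) + 1) : ℝ) : ℂ) ≠ 0 := by exact_mod_cast hs.ne'
  have e : P * (Real.sqrt ((j : ℝ) + 1) : ℝ) - y
      = (P - y * ((Real.sqrt ((j : ℝ) + 1))⁻¹ : ℝ)) * (Real.sqrt ((j : ℝ) + 1) : ℝ) := by
    push_cast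
    field_simp
  rw [e, norm_mul, Complex.norm_real, Real.norm_of_nonneg hs.le]
  refine (mul_le_mul_of_nonneg_right h hs.le).trans_eq ?_
  have h2 : ((j : ℝ) + 1) = Real.sqrt ((j : ℝ) + 1) * Real.sqrt ((j : ℝ) + 1) :=
    (Real.mul_self_sqrt (by positivity)).symm
  rw [h2]
  field_simp
  rw [Real.sqrt_sq hs.le]

/-- The multiplier of a sequence with square-root asymptotics converges when each term does. -/
theorem exists_tendsto_multiplier {l : Filter ℝ} [NeBot l] {v : ℝ → ℕ → ℂ} {v0 : ℕ → ℂ}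
    {z y : ℝ → ℂ} {b c : ℝ} (hc : 0 < c)
    (hv : ∀ j, Tendsto (fun ε => v ε j) l (𝓝 (v0 j)))
    (hz : ∀ᶠ ε in l, ‖z ε‖ ≤ 2) (hy : ∀ᶠ ε in l, c ≤ ‖y ε‖)
    (hx : ∀ᶠ ε in l, ∀ j : ℕ,
      ‖z ε ^ j * v ε j - y ε * ((Real.sqrt ((j : ℝ) + 1))⁻¹ : ℝ)‖ ≤ b / ((j : ℝ) + 1)) :
    ∃ z0, Tendsto z l (𝓝 z0) := by
  refine exists_tendsto_of_approx fun δ hδ => ?_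
  set u : ℕ → ℝ := fun j => (Real.sqrt ((j : ℝ) + 1))⁻¹ with hu
  set w : ℝ → ℕ → ℂ := fun ε j => v ε j * (Real.sqrt ((j : ℝ) + 1) : ℝ) with hw
  have hP : ∀ᶠ ε in l, ∀ j, ‖z ε ^ j * w ε j - y ε‖ ≤ b * u j := by
    filter_upwards [hx] with ε h j
    have := norm_scaled_sub_le (h j)
    rwa [mul_assoc] at this
  -- The index is fixed independently of `ε`. The factor 4 is spent below on `‖z ε‖ ≤ 2` and on the
  -- lower bound `c / 2` of the denominator.
  obtain ⟨j, hj1, hj2, hj3⟩ : ∃ j : ℕ, b * u j ≤ c / 2 ∧ b * u (j + 1) ≤ c / 2 ∧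
      (b * u (j + 1) + b * u j) * 4 ≤ δ * c := by
    have h0 : Tendsto (fun j => b * u j) atTop (𝓝 0) := by
      simpa using tendsto_inv_sqrt_succ.const_mul b
    have h1 := h0.comp (tendsto_add_atTop_nat 1)
    have h2 : Tendsto (fun j => (b * u (j + 1) + b * u j) * 4) atTop (𝓝 0) := by
      simpa using (h1.add h0).mul_const 4
    exact ((h0.eventually_le_const (by positivity)).and
      ((h1.eventually_le_const (by positivity)).and
        (h2.eventually_le_const (by positivity)))).exists
  have hwt : ∀ j, Tendsto (fun ε => w ε j) l (𝓝 (v0 j * (Real.sqrt ((j : ℝ) + 1) : ℝ))) :=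
    fun j => (hv j).mul_const _
  -- The bound `‖z ε‖ ≤ 2` keeps `w ε (j + 1)` away from zero uniformly in `ε`, so its limit is
  -- nonzero.
  have hlow : ∀ᶠ ε in l, c / 2 / 2 ^ (j + 1) ≤ ‖w ε (j + 1)‖ ∧ c / 2 ≤ ‖z ε ^ (j + 1) * w ε (j + 1)‖ := by
    filter_upwards [hP, hz, hy] with ε h1 h2 h3
    have h4 := (h1 (j + 1)).trans hj2
    have h5 : c / 2 ≤ ‖z ε ^ (j + 1) * w ε (j + 1)‖ := by
      have := norm_sub_norm_le (y ε) (z ε ^ (j + 1) * w ε (j + 1))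
      rw [norm_sub_rev] at this
      linarith
    refine ⟨?_, h5⟩
    rw [div_le_iff₀ (by positivity), mul_comm]
    refine h5.trans ?_
    rw [norm_mul, norm_pow]
    gcongr
  have hne : v0 (j + 1) * (Real.sqrt (((j + 1 : ℕ) : ℝ) + 1) : ℝ) ≠ 0 := by
    have := ge_of_tendsto (hwt (j + 1)).norm (hlow.mono fun _ h => h.1)
    exact norm_pos_iff.1 (lt_of_lt_of_le (by positivity) this)
  -- In the ratio of consecutive rescaled terms the unknown amplitude cancels and the multiplier
  -- remains.
  refine ⟨fun ε => w ε j / w ε (j + 1), _, (hwt j).div (hwt (j + 1)) hne, ?_⟩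
  filter_upwards [hP, hz, hlow] with ε h1 h2 h3
  have hw1 : w ε (j + 1) ≠ 0 := norm_pos_iff.1 (lt_of_lt_of_le (by positivity) h3.1)
  have hQ : z ε ^ (j + 1) * w ε (j + 1) ≠ 0 :=
    norm_pos_iff.1 (lt_of_lt_of_le (by positivity) h3.2)
  have hz0 : z ε ≠ 0 := fun h => hQ (by simp [h])
  have e : z ε - w ε j / w ε (j + 1) =
      z ε * ((z ε ^ (j + 1) * w ε (j + 1) - z ε ^ j * w ε j) / (z ε ^ (j + 1) * w ε (j + 1))) := by
    field_simp
    ring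
  have h4 : ‖z ε ^ (j + 1) * w ε (j + 1) - z ε ^ j * w ε j‖ ≤ b * u (j + 1) + b * u j := by
    have := norm_sub_le (z ε ^ (j + 1) * w ε (j + 1) - y ε) (z ε ^ j * w ε j - y ε)
    rw [sub_sub_sub_cancel_right] at this
    linarith [h1 j, h1 (j + 1)]
  rw [e, norm_mul, norm_div]
  have h5 : ‖z ε ^ (j + 1) * w ε (j + 1) - z ε ^ j * w ε j‖ / ‖z ε ^ (j + 1) * w ε (j + 1)‖
      ≤ δ / 2 := by
    rw [div_le_iff₀ (norm_pos_iff.2 hQ)]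
    nlinarith [h3.2]
  calc _ ≤ 2 * (δ / 2) := mul_le_mul h2 h5 (by positivity) (by norm_num)
    _ = δ := by ring

/-- Amplitudes converge when the terms and the multiplier do. -/
theorem exists_tendsto_amplitude {l : Filter ℝ} [NeBot l] {v : ℝ → ℕ → ℂ} {v0 : ℕ → ℂ}
    {z y : ℝ → ℂ} {z0 : ℂ} {b : ℝ}
    (hv : ∀ j, Tendsto (fun ε => v ε j) l (𝓝 (v0 j))) (hz : Tendsto z l (𝓝 z0))
    (hx : ∀ᶠ ε in l, ∀ j : ℕ,
      ‖z ε ^ j * v ε j - y ε * ((Real.sqrt ((j : ℝ) + 1))⁻¹ : ℝ)‖ ≤ b / ((j : ℝ) + 1)) :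
    ∃ y0, Tendsto y l (𝓝 y0) := by
  refine exists_tendsto_of_approx fun δ hδ => ?_
  have h0 : Tendsto (fun j : ℕ => b * (Real.sqrt ((j : ℝ) + 1))⁻¹) atTop (𝓝 0) := by
    simpa using tendsto_inv_sqrt_succ.const_mul b
  obtain ⟨j, hj⟩ := (h0.eventually_le_const hδ).exists
  refine ⟨fun ε => z ε ^ j * v ε j * (Real.sqrt ((j : ℝ) + 1) : ℝ), _,
    ((hz.pow j).mul (hv j)).mul_const _, ?_⟩
  filter_upwards [hx] with ε h
  rw [norm_sub_rev]
  exact (norm_scaled_sub_le (h j)).trans hj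

/-- The product of two quantities with square-root asymptotics. -/
theorem norm_conj_mul_sub_le {x x' y y' : ℂ} {b b' : ℝ} {j : ℕ}
    (hy : ‖y‖ ≤ b) (hy' : ‖y'‖ ≤ b')
    (hx : ‖x - y * ((Real.sqrt ((j : ℝ) + 1))⁻¹ : ℝ)‖ ≤ b / ((j : ℝ) + 1))
    (hx' : ‖x' - y' * ((Real.sqrt ((j : ℝ) + 1))⁻¹ : ℝ)‖ ≤ b' / ((j : ℝ) + 1)) :
    ‖(starRingEnd ℂ) x * x' - (starRingEnd ℂ) y * y' * (1 / ((j : ℝ) + 1) : ℝ)‖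
      ≤ 3 * (b * b') * ((Real.sqrt ((j : ℝ) + 1))⁻¹ * (1 / ((j : ℝ) + 1))) := by
  set u := (Real.sqrt ((j : ℝ) + 1))⁻¹ with hu
  have hu0 : 0 ≤ u := by positivity
  have hu1 : u ≤ 1 := inv_sqrt_succ_le_one j
  have huu : u * u = 1 / ((j : ℝ) + 1) := inv_sqrt_succ_sq j
  have hb : 0 ≤ b := (norm_nonneg _).trans hy
  have hb' : 0 ≤ b' := (norm_nonneg _).trans hy'
  set r := x - y * (u : ℝ)
  set r' := x' - y' * (u : ℝ)
  -- Each remainder is `O(u²)` and each leading term `O(u)`, so each of the three error products is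
  -- `O(u³)`, that is `O((j+1)^(-3/2))`.
  have e : (starRingEnd ℂ) x * x' - (starRingEnd ℂ) y * y' * (1 / ((j : ℝ) + 1) : ℝ)
      = (starRingEnd ℂ) y * (u : ℝ) * r' + (starRingEnd ℂ) r * (y' * (u : ℝ)) +
        (starRingEnd ℂ) r * r' := by
    have e1 : x = y * (u : ℝ) + r := by ring
    have e2 : x' = y' * (u : ℝ) + r' := by ring
    rw [← huu, e1, e2]
    simp only [map_add, map_mul, Complex.conj_ofReal]
    push_cast
    ring
  rw [div_eq_mul_one_div, ← huu] at hx hx'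
  rw [e, ← huu]
  have hn : ‖((u : ℝ) : ℂ)‖ = u := by rw [Complex.norm_real, Real.norm_of_nonneg hu0]
  have h1 : ‖(starRingEnd ℂ) y * (u : ℝ) * r'‖ ≤ b * u * (b' * (u * u)) := by
    rw [norm_mul, norm_mul, RCLike.norm_conj, hn]
    gcongr
  have h2 : ‖(starRingEnd ℂ) r * (y' * (u : ℝ))‖ ≤ b * (u * u) * (b' * u) := by
    rw [norm_mul, norm_mul, RCLike.norm_conj, hn]
    gcongr
  have h3 : ‖(starRingEnd ℂ) r * r'‖ ≤ b * (u * u) * (b' * u) := by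
    rw [norm_mul, RCLike.norm_conj]
    refine mul_le_mul hx (hx'.trans ?_) (norm_nonneg _) (by positivity)
    have : u * u ≤ u := mul_le_of_le_one_right hu0 hu1
    gcongr
  refine (norm_add₃_le).trans ?_
  nlinarith [h1, h2, h3]

theorem summable_inv_sqrt_mul :
    Summable fun j : ℕ => (Real.sqrt ((j : ℝ) + 1))⁻¹ * (1 / ((j : ℝ) + 1)) := by
  have h := (Real.summable_one_div_nat_rpow (p := 3 / 2)).2 (by norm_num)
  have h1 := (summable_nat_add_iff 1).2 h
  refine h1.congr fun j => ?_
  have hj : (0 : ℝ) < (j : ℝ) + 1 := by positivity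
  have h2 : 1 / ((j : ℝ) + 1) = ((j : ℝ) + 1) ^ (-1 : ℝ) := by rw [Real.rpow_neg_one, one_div]
  push_cast
  rw [h2, Real.sqrt_eq_rpow, ← Real.rpow_neg hj.le, ← Real.rpow_add hj, one_div,
    ← Real.rpow_neg hj.le]
  norm_num

/-- Applied at a single `ε`, with `r = ‖z‖⁻¹`. The resulting bound on the operator blows up as `r →
1`; only the formula for the remainder entries survives in the limit. -/
theorem exists_gram_operator {v : ℕ → ℕ → ℂ} {a : ℕ → ℂ} {B : ℕ → ℝ} {r : ℝ} (hB : Summable B)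
    (hr0 : 0 ≤ r) (hr1 : r < 1) (hv : ∀ j k, ‖v j k‖ ≤ B k * r ^ j) (ha : ∀ k, ‖a k‖ ≤ B k) :
    ∃ Vd : (EllTwo →L[ℂ] EllTwo) × EllTwo, HasMatrix Vd.1 v ∧ (Vd.2 : ℕ → ℂ) = a ∧
      ∀ (L : ℂ) (k l : ℕ),
        ((Vd.1.adjoint ∘L Vd.1 - L • InnerProductSpace.rankOne ℂ Vd.2 Vd.2) (unitVec l) : ℕ → ℂ) k
          = ∑' j, (starRingEnd ℂ) (v j k) * v j l - L * (a k * (starRingEnd ℂ) (a l)) := by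
  have hg := summable_geometric_of_lt_one hr0 hr1
  have hs : ∀ k, Summable fun j => ‖v j k‖ := fun k =>
    Summable.of_nonneg_of_le (fun _ => norm_nonneg _) (fun j => hv j k) (hg.mul_left _)
  choose c hc using fun k => exists_ellTwo_of_summable_sq
    (summable_sq_of_summable (fun _ => norm_nonneg _) (hs k))
  have hcn : ∀ k, ‖c k‖ ≤ B k * ∑' j, r ^ j := by
    intro k
    have h1 : Summable fun j => ‖(c k : ℕ → ℂ) j‖ := by simpa only [hc] using hs k
    refine (norm_ellTwo_le_tsum h1).trans ?_
    rw [← tsum_mul_left]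
    exact h1.tsum_le_tsum (fun j => by rw [hc]; exact hv j k) (hg.mul_left _)
  have hcs : Summable fun k => ‖c k‖ :=
    Summable.of_nonneg_of_le (fun _ => norm_nonneg _) hcn (hB.mul_right _)
  obtain ⟨V, hV⟩ := exists_clm_of_summable_cols hcs
  obtain ⟨d, hd⟩ := exists_ellTwo_of_summable_sq (summable_sq_of_summable (fun _ => norm_nonneg _)
    (Summable.of_nonneg_of_le (fun _ => norm_nonneg _) ha hB))
  refine ⟨⟨V, d⟩, fun j k => by rw [hV, hc], hd, fun L k l => ?_⟩
  rw [← inner_unitVec_left, sub_apply, inner_sub_right,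
    ContinuousLinearMap.comp_apply, ContinuousLinearMap.adjoint_inner_right, hV, hV,
    lp.inner_eq_tsum, smul_apply, inner_smul_right,
    InnerProductSpace.rankOne_apply, inner_smul_right, inner_unitVec_left,
    ← inner_conj_symm, inner_unitVec_left, hc, hc, hd]
  congr 1
  · refine tsum_congr fun j => ?_
    rw [RCLike.inner_apply, mul_comm]
  · ring

/-- The logarithmic series at `‖z‖⁻²`. -/
noncomputable def logSeries (z : ℂ) : ℝ := ∑' j : ℕ, ((‖z‖ ^ 2)⁻¹) ^ j * (1 / ((j : ℝ) + 1))

theorem summable_logSeries {z : ℂ} (hz : 1 < ‖z‖) :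
    Summable fun j : ℕ => ((‖z‖ ^ 2)⁻¹) ^ j * (1 / ((j : ℝ) + 1)) := by
  have h1 : (‖z‖ ^ 2)⁻¹ < 1 := inv_lt_one_of_one_lt₀ (one_lt_pow₀ hz two_ne_zero)
  refine Summable.of_nonneg_of_le (fun j => by positivity) (fun j => ?_)
    (summable_geometric_of_lt_one (by positivity) h1)
  refine mul_le_of_le_one_right (by positivity) ?_
  rw [div_le_one (by positivity)]
  have : (0 : ℝ) ≤ j := Nat.cast_nonneg j
  linarith

/-- The right side is split as a factor in `k` times a factor in `l`, so that the error is dominated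
by a product `B k * B l`. -/
theorem pow_add_sub_one_le {x : ℝ} (hx : 1 ≤ x) (k l : ℕ) :
    x ^ (k + l) - 1 ≤ (x - 1) * (((k : ℝ) + 1) * x ^ k) * (((l : ℝ) + 1) * x ^ l) := by
  have h1 : ∀ n : ℕ, x ^ n - 1 ≤ n * (x - 1) * x ^ n := by
    intro n
    rw [← mul_geom_sum, mul_comm (x - 1), mul_right_comm]
    refine mul_le_mul_of_nonneg_right ?_ (by linarith)
    calc ∑ i ∈ Finset.range n, x ^ i ≤ ∑ i ∈ Finset.range n, x ^ n :=
          Finset.sum_le_sum fun i hi =>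
            pow_le_pow_right₀ hx (Finset.mem_range.1 hi).le
      _ = n * x ^ n := by simp
  refine (h1 _).trans ?_
  have h2 : (((k + l : ℕ) : ℝ)) ≤ ((k : ℝ) + 1) * ((l : ℝ) + 1) := by
    push_cast
    nlinarith [mul_nonneg (Nat.cast_nonneg (α := ℝ) k) (Nat.cast_nonneg (α := ℝ) l)]
  have h3 : 0 ≤ (x - 1) * x ^ (k + l) := mul_nonneg (by linarith) (by positivity)
  calc ((k + l : ℕ) : ℝ) * (x - 1) * x ^ (k + l)
      ≤ (((k : ℝ) + 1) * ((l : ℝ) + 1)) * ((x - 1) * x ^ (k + l)) := by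
        rw [mul_assoc]; exact mul_le_mul_of_nonneg_right h2 h3
    _ = _ := by rw [pow_add]; ring

/-- Entrywise convergence and domination of the renormalized Gram matrix. -/
theorem exists_tendsto_gram_entries {l : Filter ℝ} [NeBot l] {v : ℝ → ℕ → ℕ → ℂ}
    {v0 : ℕ → ℕ → ℂ} {z : ℝ → ℂ} {a : ℝ → ℕ → ℂ} {L : ℝ → ℝ} {B : ℕ → ℝ} {c ℓ : ℝ} (hc : 0 < c)
    (hz : ∀ᶠ ε in l, 1 < ‖z ε‖) (hz1 : Tendsto (fun ε => ‖z ε‖) l (𝓝 1))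
    (hv : ∀ j k, Tendsto (fun ε => v ε j k) l (𝓝 (v0 j k)))
    (hx : ∀ᶠ ε in l, ∀ j k : ℕ, ‖z ε ^ j * v ε j k - ((‖z ε‖ ^ k : ℝ) * (starRingEnd ℂ) (a ε k)) *
      ((Real.sqrt ((j : ℝ) + 1))⁻¹ : ℝ)‖ ≤ B k / ((j : ℝ) + 1))
    (ha : ∀ᶠ ε in l, ∀ k : ℕ, ((k : ℝ) + 1) * ‖z ε‖ ^ k * ‖a ε k‖ ≤ B k)
    (hlow : ∀ᶠ ε in l, c ≤ ‖a ε 0‖)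
    (hL : Tendsto (fun ε => L ε - logSeries (z ε)) l (𝓝 ℓ))
    (hL' : Tendsto (fun ε => (‖z ε‖ - 1) * logSeries (z ε)) l (𝓝 0)) :
    ∃ (E0 : ℕ → ℕ → ℂ) (K : ℝ),
      (∀ k m, Tendsto (fun ε => ∑' j, (starRingEnd ℂ) (v ε j k) * v ε j m -
        L ε * (a ε k * (starRingEnd ℂ) (a ε m))) l (𝓝 (E0 k m))) ∧
      ∀ᶠ ε in l, ∀ k m, ‖∑' j, (starRingEnd ℂ) (v ε j k) * v ε j m -
        L ε * (a ε k * (starRingEnd ℂ) (a ε m))‖ ≤ K * (B k * B m) := by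
  set y : ℝ → ℕ → ℂ := fun ε k => (‖z ε‖ ^ k : ℝ) * (starRingEnd ℂ) (a ε k) with hy
  set u : ℕ → ℝ := fun j => (Real.sqrt ((j : ℝ) + 1))⁻¹ with hu
  have hyn : ∀ ε k, ‖y ε k‖ = ‖z ε‖ ^ k * ‖a ε k‖ := fun ε k => by
    simp only [hy, norm_mul, RCLike.norm_conj, Complex.norm_real]
    rw [Real.norm_of_nonneg (by positivity)]
  -- convergence of the multiplier and of the amplitudes
  obtain ⟨z0, hz0⟩ : ∃ z0, Tendsto z l (𝓝 z0) := by
    refine exists_tendsto_multiplier (y := fun ε => y ε 0) (b := B 0) hc (fun j => hv j 0)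
      (hz1.eventually_le_const (by norm_num)) ?_ (hx.mono fun ε h j => h j 0)
    filter_upwards [hlow] with ε h
    rw [hyn]; simpa using h
  choose y0 hy0 using fun k => exists_tendsto_amplitude (y := fun ε => y ε k) (b := B k)
    (fun j => hv j k) hz0 (hx.mono fun ε h j => h j k)
  have ha0 : ∀ k, Tendsto (fun ε => a ε k) l (𝓝 ((starRingEnd ℂ) (y0 k))) := by
    intro k
    have h1 : Tendsto (fun ε => ((‖z ε‖ ^ k : ℝ) : ℂ)) l (𝓝 1) := by
      have := (Complex.continuous_ofReal.tendsto _).comp (hz1.pow k)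
      simpa [Function.comp_def] using this
    have h2 := ((Complex.continuous_conj.tendsto _).comp ((hy0 k).div h1 one_ne_zero))
    rw [div_one] at h2
    refine h2.congr' ?_
    filter_upwards [hz] with ε h
    have : ((‖z ε‖ ^ k : ℝ) : ℂ) ≠ 0 := by
      exact_mod_cast (pow_pos (zero_lt_one.trans h) k).ne'
    simp only [Function.comp_apply, hy, Pi.div_apply]
    rw [mul_div_cancel_left₀ _ this, Complex.conj_conj]
  -- the three pieces
  set θ : ℝ → ℝ := fun ε => (‖z ε‖ ^ 2)⁻¹ with hθ
  -- The summand of the Gram entry minus its logarithmic part; it is `O((j+1)^(-3/2))` uniformly in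
  -- `ε`.
  set X : ℝ → ℕ → ℕ → ℕ → ℂ := fun ε k m j => (starRingEnd ℂ) (v ε j k) * v ε j m -
    ((θ ε ^ j * (1 / ((j : ℝ) + 1)) : ℝ) : ℂ) * ((starRingEnd ℂ) (y ε k) * y ε m) with hX
  set S : ℝ := ∑' j : ℕ, u j * (1 / ((j : ℝ) + 1)) with hS
  have hB0 : ∀ k, 0 ≤ B k := by
    obtain ⟨ε, h1, -⟩ := (ha.and hz).exists
    exact fun k => le_trans (by positivity) (h1 k)
  have hyB : ∀ᶠ ε in l, ∀ k, ‖y ε k‖ ≤ B k ∧ ‖a ε k‖ ≤ B k := by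
    filter_upwards [ha, hz] with ε h h1 k
    have h2 : ‖y ε k‖ ≤ B k := by
      rw [hyn]
      refine le_trans ?_ (h k)
      rw [mul_assoc]
      exact le_mul_of_one_le_left (by positivity) (by
        have : (0 : ℝ) ≤ k := Nat.cast_nonneg k
        linarith)
    refine ⟨h2, le_trans ?_ h2⟩
    rw [hyn]
    exact le_mul_of_one_le_left (norm_nonneg _) (one_le_pow₀ h1.le)
  have hXb : ∀ᶠ ε in l, ∀ k m j, ‖X ε k m j‖ ≤ 3 * (B k * B m) * (u j * (1 / ((j : ℝ) + 1))) := by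
    filter_upwards [hx, hyB, hz] with ε h1 h2 h3 k m j
    have h4 := norm_conj_mul_sub_le (h2 k).1 (h2 m).1 (h1 j k) (h1 j m)
    have hz' : (‖z ε‖ : ℂ) ≠ 0 := by exact_mod_cast (zero_lt_one.trans h3).ne'
    have hcz : (starRingEnd ℂ) (z ε) * z ε = (‖z ε‖ : ℂ) ^ 2 := by
      rw [mul_comm, Complex.mul_conj, Complex.normSq_eq_norm_sq]; push_cast; rfl
    -- Since `conj z * z = θ⁻¹`, inserting `z ^ j` in both factors is paid for by `θ ^ j ≤ 1`.
    have e : X ε k m j = ((θ ε ^ j : ℝ) : ℂ) * ((starRingEnd ℂ) (z ε ^ j * v ε j k) *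
        (z ε ^ j * v ε j m) - (starRingEnd ℂ) (y ε k) * y ε m * (1 / ((j : ℝ) + 1) : ℝ)) := by
      have e1 : (starRingEnd ℂ) (z ε ^ j * v ε j k) * (z ε ^ j * v ε j m) =
          ((‖z ε‖ : ℂ) ^ 2) ^ j * ((starRingEnd ℂ) (v ε j k) * v ε j m) := by
        rw [← hcz]; simp only [map_mul, map_pow]; ring
      have e2 : ((θ ε ^ j : ℝ) : ℂ) * ((‖z ε‖ : ℂ) ^ 2) ^ j = 1 := by
        simp only [hθ]; push_cast
        rw [← mul_pow, inv_mul_cancel₀ (pow_ne_zero _ hz'), one_pow]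
      rw [e1, mul_sub, ← mul_assoc, e2, one_mul]
      simp only [hX]
      push_cast
      ring
    rw [e, norm_mul, Complex.norm_real]
    have h5 : ‖θ ε ^ j‖ ≤ 1 := by
      rw [Real.norm_of_nonneg (by positivity)]
      exact pow_le_one₀ (by positivity) (inv_le_one_of_one_le₀ (one_le_pow₀ h3.le))
    calc _ ≤ 1 * _ := mul_le_mul h5 h4 (norm_nonneg _) zero_le_one
      _ = _ := one_mul _
  have hXs : ∀ k m, Summable fun j : ℕ => 3 * (B k * B m) * (u j * (1 / ((j : ℝ) + 1))) :=
    fun k m => summable_inv_sqrt_mul.mul_left _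
  have hXt : ∀ k m, ∃ x0, Tendsto (fun ε => ∑' j, X ε k m j) l (𝓝 x0) := by
    intro k m
    refine ⟨_, tendsto_tsum_of_dominated_convergence
      (g := fun j => (starRingEnd ℂ) (v0 j k) * v0 j m -
        ((((1 ^ 2)⁻¹) ^ j * (1 / ((j : ℝ) + 1)) : ℝ) : ℂ) * ((starRingEnd ℂ) (y0 k) * y0 m))
      (hXs k m) (fun j => ?_) (hXb.mono fun ε h j => h k m j)⟩
    · have hθt : Tendsto θ l (𝓝 ((1 ^ 2)⁻¹)) := (hz1.pow 2).inv₀ (by norm_num)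
      refine Tendsto.sub ?_ (Tendsto.mul ?_ ?_)
      · exact ((Complex.continuous_conj.tendsto _).comp (hv j k)).mul (hv j m)
      · exact (Complex.continuous_ofReal.tendsto _).comp ((hθt.pow j).mul_const _)
      · exact ((Complex.continuous_conj.tendsto _).comp (hy0 k)).mul (hy0 m)
  choose X0 hX0 using hXt
  -- Here `conj (y k) * y m = ‖z‖^(k+m) * a k * conj (a m)`. Passing from this to `a k * conj (a
  -- m)`, and from `logSeries` to `L`, leaves the two correction terms.
  have hsplit : ∀ᶠ ε in l, ∀ k m, ∑' j, (starRingEnd ℂ) (v ε j k) * v ε j m -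
        L ε * (a ε k * (starRingEnd ℂ) (a ε m)) = ∑' j, X ε k m j +
      ((logSeries (z ε) : ℂ) * (((‖z ε‖ ^ (k + m) - 1 : ℝ) : ℂ) *
        (a ε k * (starRingEnd ℂ) (a ε m))) -
        ((L ε - logSeries (z ε) : ℝ) : ℂ) * (a ε k * (starRingEnd ℂ) (a ε m))) := by
    filter_upwards [hXb, hz] with ε h1 h2 k m
    have hsX : Summable (X ε k m) := Summable.of_norm_bounded (hXs k m) (h1 k m)
    have hsl : Summable fun j : ℕ => ((θ ε ^ j * (1 / ((j : ℝ) + 1)) : ℝ) : ℂ) *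
        ((starRingEnd ℂ) (y ε k) * y ε m) :=
      (Complex.ofRealCLM.summable (summable_logSeries h2)).mul_right _
    have e1 : ∑' j, (starRingEnd ℂ) (v ε j k) * v ε j m = ∑' j, X ε k m j +
        (logSeries (z ε) : ℂ) * ((starRingEnd ℂ) (y ε k) * y ε m) := by
      rw [logSeries, Complex.ofReal_tsum, ← tsum_mul_right, ← hsX.tsum_add hsl]
      refine tsum_congr fun j => ?_
      simp only [hX]; ring
    rw [e1]
    simp only [hy, map_mul, Complex.conj_ofReal, Complex.conj_conj]
    push_cast
    ring
  have hsmall : ∀ᶠ ε in l, ∀ k m, ‖(logSeries (z ε) : ℂ) * (((‖z ε‖ ^ (k + m) - 1 : ℝ) : ℂ) *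
        (a ε k * (starRingEnd ℂ) (a ε m)))‖ ≤ (‖z ε‖ - 1) * logSeries (z ε) * (B k * B m) := by
    filter_upwards [ha, hz] with ε h1 h2 k m
    have hl0 : 0 ≤ logSeries (z ε) := tsum_nonneg fun j => by positivity
    have hp : 0 ≤ ‖z ε‖ ^ (k + m) - 1 := sub_nonneg.2 (one_le_pow₀ h2.le)
    rw [norm_mul, norm_mul, norm_mul, Complex.norm_real, Complex.norm_real, RCLike.norm_conj,
      Real.norm_of_nonneg hl0, Real.norm_of_nonneg hp, mul_comm (‖z ε‖ - 1), mul_assoc]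
    refine mul_le_mul_of_nonneg_left ?_ hl0
    calc (‖z ε‖ ^ (k + m) - 1) * (‖a ε k‖ * ‖a ε m‖)
        ≤ (‖z ε‖ - 1) * (((k : ℝ) + 1) * ‖z ε‖ ^ k) * (((m : ℝ) + 1) * ‖z ε‖ ^ m) *
          (‖a ε k‖ * ‖a ε m‖) :=
          mul_le_mul_of_nonneg_right (pow_add_sub_one_le h2.le k m) (by positivity)
      _ = (‖z ε‖ - 1) * ((((k : ℝ) + 1) * ‖z ε‖ ^ k * ‖a ε k‖) *
          (((m : ℝ) + 1) * ‖z ε‖ ^ m * ‖a ε m‖)) := by ring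
      _ ≤ (‖z ε‖ - 1) * (B k * B m) := by
          refine mul_le_mul_of_nonneg_left ?_ (by linarith)
          exact mul_le_mul (h1 k) (h1 m) (by positivity) (hB0 k)
  refine ⟨fun k m => X0 k m + (0 - (ℓ : ℂ) * ((starRingEnd ℂ) (y0 k) *
    (starRingEnd ℂ) ((starRingEnd ℂ) (y0 m)))), 3 * S + 1 + (|ℓ| + 1), fun k m => ?_, ?_⟩
  · refine Tendsto.congr' (hsplit.mono fun ε h => (h k m).symm) ?_
    refine (hX0 k m).add (Tendsto.sub ?_ (Tendsto.mul ?_ ?_))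
    · refine squeeze_zero_norm' (hsmall.mono fun ε h => h k m) ?_
      simpa using hL'.mul_const (B k * B m)
    · exact (Complex.continuous_ofReal.tendsto _).comp hL
    · exact (ha0 k).mul ((Complex.continuous_conj.tendsto _).comp (ha0 m))
  · have hLb : ∀ᶠ ε in l, |L ε - logSeries (z ε)| ≤ |ℓ| + 1 :=
      hL.abs.eventually_le_const (by linarith)
    filter_upwards [hsplit, hsmall, hXb, hyB, hLb, hL'.eventually_le_const zero_lt_one]
      with ε h1 h2 h3 h4 h5 h6 k m
    have hBB : 0 ≤ B k * B m := mul_nonneg (hB0 k) (hB0 m)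
    rw [h1 k m]
    have t1 : ‖∑' j, X ε k m j‖ ≤ 3 * S * (B k * B m) := by
      refine (tsum_of_norm_bounded (hXs k m).hasSum (h3 k m)).trans_eq ?_
      rw [tsum_mul_left]; ring
    have t2 : ‖((L ε - logSeries (z ε) : ℝ) : ℂ) * (a ε k * (starRingEnd ℂ) (a ε m))‖ ≤
        (|ℓ| + 1) * (B k * B m) := by
      rw [norm_mul, norm_mul, RCLike.norm_conj, Complex.norm_real, Real.norm_eq_abs]
      have := (h4 k).2
      have := (h4 m).2
      have := hB0 k
      gcongr
    have t3 := (h2 k m).trans (mul_le_mul_of_nonneg_right h6 hBB)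
    refine (norm_add_le _ _).trans ?_
    have := norm_sub_le ((logSeries (z ε) : ℂ) * (((‖z ε‖ ^ (k + m) - 1 : ℝ) : ℂ) *
        (a ε k * (starRingEnd ℂ) (a ε m)))) (((L ε - logSeries (z ε) : ℝ) : ℂ) *
        (a ε k * (starRingEnd ℂ) (a ε m)))
    linarith

/-- The remainder of the Gram operator after removal of its rank-one part converges. -/
theorem exists_gram_remainder_limit {l : Filter ℝ} [NeBot l] {v : ℝ → ℕ → ℕ → ℂ}
    {v0 : ℕ → ℕ → ℂ} {z : ℝ → ℂ} {a : ℝ → ℕ → ℂ} {L : ℝ → ℝ} {B : ℕ → ℝ} {c ℓ : ℝ} (hc : 0 < c)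
    (hB : Summable B)
    (hz : ∀ᶠ ε in l, 1 < ‖z ε‖) (hz1 : Tendsto (fun ε => ‖z ε‖) l (𝓝 1))
    (hv : ∀ j k, Tendsto (fun ε => v ε j k) l (𝓝 (v0 j k)))
    (hx : ∀ᶠ ε in l, ∀ j k : ℕ, ‖z ε ^ j * v ε j k - ((‖z ε‖ ^ k : ℝ) * (starRingEnd ℂ) (a ε k)) *
      ((Real.sqrt ((j : ℝ) + 1))⁻¹ : ℝ)‖ ≤ B k / ((j : ℝ) + 1))
    (ha : ∀ᶠ ε in l, ∀ k : ℕ, ((k : ℝ) + 1) * ‖z ε‖ ^ k * ‖a ε k‖ ≤ B k)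
    (hlow : ∀ᶠ ε in l, c ≤ ‖a ε 0‖)
    (hL : Tendsto (fun ε => L ε - logSeries (z ε)) l (𝓝 ℓ))
    (hL' : Tendsto (fun ε => (‖z ε‖ - 1) * logSeries (z ε)) l (𝓝 0)) :
    ∃ (V C : ℝ → EllTwo →L[ℂ] EllTwo) (d : ℝ → EllTwo) (Cs : EllTwo →L[ℂ] EllTwo),
      (∀ᶠ ε in l, HasMatrix (V ε) (v ε) ∧ (∀ j, (d ε : ℕ → ℂ) j = a ε j) ∧
        (V ε).adjoint ∘L V ε = (L ε : ℂ) • InnerProductSpace.rankOne ℂ (d ε) (d ε) + C ε ∧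
        IsHilbertSchmidt (C ε) ∧ IsCompactOperator (C ε)) ∧
      IsHilbertSchmidt Cs ∧ IsCompactOperator Cs ∧
      Tendsto (fun ε => ‖C ε - Cs‖) l (𝓝 0) ∧
      Tendsto (fun ε => hsNorm (C ε - Cs)) l (𝓝 0) := by
  obtain ⟨E0, K, hE, hEb⟩ := exists_tendsto_gram_entries hc hz hz1 hv hx ha hlow hL hL'
  have hB0 : ∀ k, 0 ≤ B k := by
    obtain ⟨ε, h1, -⟩ := (ha.and hz).exists
    exact fun k => le_trans (by positivity) (h1 k)
  have hVd : ∀ᶠ ε in l, ∃ Vd : (EllTwo →L[ℂ] EllTwo) × EllTwo,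
      HasMatrix Vd.1 (v ε) ∧ (Vd.2 : ℕ → ℂ) = a ε ∧ ∀ (L : ℂ) (k m : ℕ),
        ((Vd.1.adjoint ∘L Vd.1 - L • InnerProductSpace.rankOne ℂ Vd.2 Vd.2) (unitVec m) : ℕ → ℂ) k
          = ∑' j, (starRingEnd ℂ) (v ε j k) * v ε j m -
            L * (a ε k * (starRingEnd ℂ) (a ε m)) := by
    filter_upwards [hz, hx, ha] with ε h1 h2 h3
    have hz0 : 0 < ‖z ε‖ := zero_lt_one.trans h1
    have hy : ∀ k, ‖z ε‖ ^ k * ‖a ε k‖ ≤ B k := fun k => by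
      refine le_trans ?_ (h3 k)
      rw [mul_assoc]
      exact le_mul_of_one_le_left (by positivity) (by
        have : (0 : ℝ) ≤ k := Nat.cast_nonneg k
        linarith)
    -- One `B k` bounds the leading term and one the error; the geometric factor comes from dividing
    -- by `‖z‖ ^ j`.
    refine exists_gram_operator (B := fun k => 2 * B k) (r := ‖z ε‖⁻¹) (hB.mul_left 2)
      (by positivity) (inv_lt_one_of_one_lt₀ h1) (fun j k => ?_) (fun k => ?_)
    · rw [inv_pow, ← div_eq_mul_inv, le_div_iff₀ (by positivity), mul_comm, ← norm_pow, ← norm_mul]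
      have h4 := norm_sub_norm_le (z ε ^ j * v ε j k) (((‖z ε‖ ^ k : ℝ) * (starRingEnd ℂ) (a ε k)) *
        ((Real.sqrt ((j : ℝ) + 1))⁻¹ : ℝ))
      have h5 : ‖((‖z ε‖ ^ k : ℝ) * (starRingEnd ℂ) (a ε k)) *
          ((Real.sqrt ((j : ℝ) + 1))⁻¹ : ℝ)‖ ≤ B k := by
        rw [norm_mul, norm_mul, RCLike.norm_conj, Complex.norm_real, Complex.norm_real,
          Real.norm_of_nonneg (by positivity), Real.norm_of_nonneg (by positivity)]
        exact (mul_le_of_le_one_right (by positivity) (inv_sqrt_succ_le_one j)).trans (hy k)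
      have h6 : B k / ((j : ℝ) + 1) ≤ B k :=
        div_le_self (hB0 k) (by
          have : (0 : ℝ) ≤ j := Nat.cast_nonneg j
          linarith)
      linarith [h2 j k]
    · have h4 : ‖a ε k‖ ≤ ‖z ε‖ ^ k * ‖a ε k‖ :=
        le_mul_of_one_le_left (norm_nonneg _) (one_le_pow₀ h1.le)
      linarith [hy k, hB0 k]
  obtain ⟨Vd, hVd⟩ := hVd.choice
  set C : ℝ → EllTwo →L[ℂ] EllTwo := fun ε => (Vd ε).1.adjoint ∘L (Vd ε).1 -
    (L ε : ℂ) • InnerProductSpace.rankOne ℂ (Vd ε).2 (Vd ε).2 with hC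
  have hbs : Summable fun p : ℕ × ℕ => K * (B p.1 * B p.2) :=
    (hB.mul_of_nonneg hB hB0 hB0).mul_left K
  -- The limiting entries inherit the uniform majorant, hence define an operator with summable
  -- columns.
  have hE0b : ∀ k m, ‖E0 k m‖ ≤ K * (B k * B m) := fun k m =>
    le_of_tendsto (hE k m).norm (hEb.mono fun ε h => h k m)
  have hcol : ∀ m, Summable fun k => ‖E0 k m‖ := fun m =>
    Summable.of_nonneg_of_le (fun _ => norm_nonneg _) (fun k => hE0b k m)
      ((hB.mul_right (B m)).mul_left K)
  choose c0 hc0 using fun m => exists_ellTwo_of_summable_sq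
    (summable_sq_of_summable (fun _ => norm_nonneg _) (hcol m))
  have hc0s : Summable fun m => ‖c0 m‖ := by
    refine Summable.of_nonneg_of_le (fun _ => norm_nonneg _) (fun m => ?_)
      (hB.mul_left (K * ∑' k, B k))
    have h1 : Summable fun j => ‖(c0 m : ℕ → ℂ) j‖ := by simpa only [hc0] using hcol m
    refine (norm_ellTwo_le_tsum h1).trans ?_
    rw [mul_assoc, ← tsum_mul_right, ← tsum_mul_left]
    exact h1.tsum_le_tsum (fun k => by rw [hc0]; exact hE0b k m) ((hB.mul_right (B m)).mul_left K)
  obtain ⟨Cs, hCs⟩ := exists_clm_of_summable_cols hc0s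
  have hCss : Summable fun m => ‖Cs (unitVec m)‖ := by simpa only [hCs] using hc0s
  have hCs' : ∀ k m, (Cs (unitVec m) : ℕ → ℂ) k = E0 k m := fun k m => by rw [hCs, hc0]
  have hCε : ∀ᶠ ε in l, ∀ k m, (C ε (unitVec m) : ℕ → ℂ) k =
      ∑' j, (starRingEnd ℂ) (v ε j k) * v ε j m - L ε * (a ε k * (starRingEnd ℂ) (a ε m)) :=
    hVd.mono fun ε h k m => h.2.2 (L ε) k m
  have hdiff : ∀ ε k m, ((C ε - Cs) (unitVec m) : ℕ → ℂ) k =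
      (C ε (unitVec m) : ℕ → ℂ) k - E0 k m := fun ε k m => by
    rw [sub_apply, lp.coeFn_sub, Pi.sub_apply, hCs']
  -- Dominated convergence over pairs of indices; this double sum bounds both norms of the
  -- difference.
  have hsum : Tendsto (fun ε => ∑' p : ℕ × ℕ, ‖((C ε - Cs) (unitVec p.2) : ℕ → ℂ) p.1‖) l (𝓝 0) := by
    have := tendsto_tsum_of_dominated_convergence (𝓕 := l)
      (f := fun ε (p : ℕ × ℕ) => ‖((C ε - Cs) (unitVec p.2) : ℕ → ℂ) p.1‖) (g := fun _ => (0 : ℝ))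
      (hbs.mul_left 2) (fun p => ?_) ?_
    · simpa using this
    · have h1 : Tendsto (fun ε => (C ε (unitVec p.2) : ℕ → ℂ) p.1) l (𝓝 (E0 p.1 p.2)) :=
        (hE p.1 p.2).congr' (hCε.mono fun ε h => (h p.1 p.2).symm)
      simp only [hdiff]
      exact tendsto_zero_iff_norm_tendsto_zero.1 (tendsto_sub_nhds_zero_iff.2 h1)
    · filter_upwards [hCε, hEb] with ε h1 h2 p
      rw [norm_norm, hdiff, h1]
      have := norm_sub_le (∑' j, (starRingEnd ℂ) (v ε j p.1) * v ε j p.2 -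
        L ε * (a ε p.1 * (starRingEnd ℂ) (a ε p.2))) (E0 p.1 p.2)
      linarith [h2 p.1 p.2, hE0b p.1 p.2]
  have hcols : ∀ᶠ ε in l, (Summable fun m => ‖(C ε - Cs) (unitVec m)‖) ∧
      ∑' m, ‖(C ε - Cs) (unitVec m)‖ ≤
        ∑' p : ℕ × ℕ, ‖((C ε - Cs) (unitVec p.2) : ℕ → ℂ) p.1‖ := by
    filter_upwards [hCε, hEb] with ε h1 h2
    refine summable_cols_of_entry_le (hbs.mul_left 2) fun p => ?_
    rw [hdiff, h1]
    have := norm_sub_le (∑' j, (starRingEnd ℂ) (v ε j p.1) * v ε j p.2 -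
      L ε * (a ε p.1 * (starRingEnd ℂ) (a ε p.2))) (E0 p.1 p.2)
    linarith [h2 p.1 p.2, hE0b p.1 p.2]
  refine ⟨fun ε => (Vd ε).1, C, fun ε => (Vd ε).2, Cs, ?_, isHilbertSchmidt_of_summable_cols hCss,
    isCompactOperator_of_summable_cols hCss, ?_, ?_⟩
  · filter_upwards [hVd, hCε, hEb] with ε h1 h2 h3
    have h4 : Summable fun m => ‖C ε (unitVec m)‖ :=
      (summable_cols_of_entry_le hbs fun p => by rw [h2]; exact h3 p.1 p.2).1
    exact ⟨h1.1, fun j => by rw [h1.2.1], (add_sub_cancel _ _).symm,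
      isHilbertSchmidt_of_summable_cols h4, isCompactOperator_of_summable_cols h4⟩
  · refine squeeze_zero' (Eventually.of_forall fun _ => norm_nonneg _) ?_ hsum
    filter_upwards [hcols] with ε h
    exact (norm_le_tsum_cols h.1).trans h.2
  · refine squeeze_zero' (Eventually.of_forall fun _ => Real.sqrt_nonneg _) ?_ hsum
    filter_upwards [hcols] with ε h
    exact (hsNorm_le_tsum_cols h.1).trans h.2

/-! ## Taylor coefficients at the origin -/

/-- The `n`-th Taylor coefficient of `f` at `0`. -/
noncomputable def taylorCoeff (f : ℂ → ℂ) (n : ℕ) : ℂ := iteratedDeriv n f 0 / (Nat.factorial n : ℂ)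

theorem taylorCoeff_congr {f g : ℂ → ℂ} (h : f =ᶠ[𝓝 0] g) (n : ℕ) :
    taylorCoeff f n = taylorCoeff g n := by
  rw [taylorCoeff, taylorCoeff, h.iteratedDeriv_eq n]

theorem taylorCoeff_eq_coeff {f : ℂ → ℂ} {p : FormalMultilinearSeries ℂ ℂ ℂ}
    (h : HasFPowerSeriesAt f p 0) (n : ℕ) : taylorCoeff f n = p.coeff n := by
  rw [h.eq_formalMultilinearSeries h.analyticAt.hasFPowerSeriesAt]
  simp [taylorCoeff, FormalMultilinearSeries.coeff_ofScalars]

theorem eventually_hasSum_taylorCoeff {f : ℂ → ℂ} (h : AnalyticAt ℂ f 0) :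
    ∀ᶠ x in 𝓝 (0 : ℂ), HasSum (fun n => taylorCoeff f n * x ^ n) (f x) := by
  have h1 := hasFPowerSeriesAt_iff.1 h.hasFPowerSeriesAt
  filter_upwards [h1] with x hx
  simpa [taylorCoeff, FormalMultilinearSeries.coeff_ofScalars, mul_comm] using hx

theorem taylorCoeff_eq_of_hasSum {f : ℂ → ℂ} {c : ℕ → ℂ}
    (h : ∀ᶠ x in 𝓝 (0 : ℂ), HasSum (fun n => c n * x ^ n) (f x)) (n : ℕ) :
    taylorCoeff f n = c n := by
  have h1 : HasFPowerSeriesAt f (FormalMultilinearSeries.ofScalars ℂ c) 0 := by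
    rw [hasFPowerSeriesAt_iff]
    filter_upwards [h] with x hx
    simpa [FormalMultilinearSeries.coeff_ofScalars, mul_comm] using hx
  rw [taylorCoeff_eq_coeff h1, FormalMultilinearSeries.coeff_ofScalars]

theorem taylorCoeff_add {f g : ℂ → ℂ} (hf : AnalyticAt ℂ f 0) (hg : AnalyticAt ℂ g 0) (n : ℕ) :
    taylorCoeff (fun x => f x + g x) n = taylorCoeff f n + taylorCoeff g n := by
  refine taylorCoeff_eq_of_hasSum (c := fun n => taylorCoeff f n + taylorCoeff g n) ?_ n
  filter_upwards [eventually_hasSum_taylorCoeff hf, eventually_hasSum_taylorCoeff hg] with x h1 h2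
  simpa only [add_mul] using h1.add h2

theorem taylorCoeff_const_mul {f : ℂ → ℂ} (hf : AnalyticAt ℂ f 0) (a : ℂ) (n : ℕ) :
    taylorCoeff (fun x => a * f x) n = a * taylorCoeff f n := by
  refine taylorCoeff_eq_of_hasSum (c := fun n => a * taylorCoeff f n) ?_ n
  filter_upwards [eventually_hasSum_taylorCoeff hf] with x h1
  simpa only [mul_assoc] using h1.mul_left a

theorem taylorCoeff_const (a : ℂ) (n : ℕ) :
    taylorCoeff (fun _ => a) n = if n = 0 then a else 0 := by
  refine taylorCoeff_eq_of_hasSum (c := fun n => if n = 0 then a else 0) ?_ n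
  refine Eventually.of_forall fun x => ?_
  convert hasSum_single 0 ?_ using 1
  · simp
  · intro b hb; simp [hb]

theorem taylorCoeff_pow_id (r n : ℕ) :
    taylorCoeff (fun x => x ^ r) n = if n = r then 1 else 0 := by
  refine taylorCoeff_eq_of_hasSum (c := fun n => if n = r then 1 else 0) ?_ n
  refine Eventually.of_forall fun x => ?_
  convert hasSum_single r ?_ using 1
  · simp
  · intro b hb; simp [hb]

theorem taylorCoeff_sum {ι : Type*} (s : Finset ι) {f : ι → ℂ → ℂ}
    (hf : ∀ i, AnalyticAt ℂ (f i) 0) (n : ℕ) :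
    taylorCoeff (fun x => ∑ i ∈ s, f i x) n = ∑ i ∈ s, taylorCoeff (f i) n := by
  classical
  induction s using Finset.induction_on with
  | empty => simpa using taylorCoeff_const 0 n
  | insert a s ha ih =>
    simp only [Finset.sum_insert ha]
    rw [taylorCoeff_add (hf a) (Finset.analyticAt_fun_sum _ fun i _ => hf i), ih]

theorem taylorCoeff_mul {f g : ℂ → ℂ} (hf : AnalyticAt ℂ f 0) (hg : AnalyticAt ℂ g 0) (n : ℕ) :
    taylorCoeff (fun x => f x * g x) n =
      ∑ i ∈ Finset.range (n + 1), taylorCoeff f i * taylorCoeff g (n - i) := by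
  have h := iteratedDeriv_fun_mul (n := n) (x := (0 : ℂ)) hf.contDiffAt hg.contDiffAt
  rw [taylorCoeff, h, Finset.sum_div]
  refine Finset.sum_congr rfl fun i hi => ?_
  have hi' : i ≤ n := Nat.lt_succ_iff.1 (Finset.mem_range.1 hi)
  have h1 : (n.choose i : ℂ) * (Nat.factorial i) * (Nat.factorial (n - i)) = Nat.factorial n := by
    exact_mod_cast Nat.choose_mul_factorial_mul_factorial hi'
  have h2 : (Nat.factorial i : ℂ) ≠ 0 := by exact_mod_cast Nat.factorial_ne_zero i
  have h3 : (Nat.factorial (n - i) : ℂ) ≠ 0 := by exact_mod_cast Nat.factorial_ne_zero (n - i)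
  have h4 : (n.choose i : ℂ) ≠ 0 := by exact_mod_cast (Nat.choose_pos hi').ne'
  rw [taylorCoeff, taylorCoeff, ← h1]
  field_simp

theorem taylorCoeff_pow_mul {g : ℂ → ℂ} (hg : AnalyticAt ℂ g 0) (r n : ℕ) :
    taylorCoeff (fun x => x ^ r * g x) n = if r ≤ n then taylorCoeff g (n - r) else 0 := by
  have hp : AnalyticAt ℂ (fun x : ℂ => x ^ r) 0 := analyticAt_id.pow r
  rw [taylorCoeff_mul hp hg]
  simp [taylorCoeff_pow_id]

/-- The series of `f (x ^ s)` is that of `f` spread over the multiples of `s` and extended by zero.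
-/
theorem taylorCoeff_comp_pow {f : ℂ → ℂ} (hf : AnalyticAt ℂ f 0) {s : ℕ} (hs : 0 < s) (m : ℕ) :
    taylorCoeff (fun x => f (x ^ s)) (m * s) = taylorCoeff f m := by
  have hinj : Function.Injective fun m : ℕ => m * s := fun a b h =>
    Nat.eq_of_mul_eq_mul_right hs h
  set c : ℕ → ℂ := Function.extend (fun m : ℕ => m * s) (taylorCoeff f) 0 with hc
  have h1 : taylorCoeff (fun x => f (x ^ s)) (m * s) = c (m * s) := by
    refine taylorCoeff_eq_of_hasSum ?_ _
    have ht : Tendsto (fun x : ℂ => x ^ s) (𝓝 0) (𝓝 0) := by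
      have := (continuous_pow s).tendsto (0 : ℂ)
      rwa [zero_pow hs.ne'] at this
    filter_upwards [ht.eventually (eventually_hasSum_taylorCoeff hf)] with x hx
    rw [← hinj.hasSum_iff]
    · convert hx using 2 with k
      simp only [Function.comp_apply, hc]
      rw [hinj.extend_apply, mul_comm k s, pow_mul]
    · intro k hk
      rw [hc, Function.extend_apply' _ _ _ (by simpa using hk)]
      simp
  rw [h1, hc, hinj.extend_apply]

theorem taylorCoeff_comp_mul {f : ℂ → ℂ} (hf : AnalyticAt ℂ f 0) (a : ℂ) (n : ℕ) :
    taylorCoeff (fun x => f (a * x)) n = taylorCoeff f n * a ^ n := by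
  refine taylorCoeff_eq_of_hasSum (c := fun n => taylorCoeff f n * a ^ n) ?_ n
  have ht : Tendsto (fun x : ℂ => a * x) (𝓝 0) (𝓝 0) := by
    simpa using (continuous_const_mul a).tendsto (0 : ℂ)
  filter_upwards [ht.eventually (eventually_hasSum_taylorCoeff hf)] with x hx
  simpa only [mul_pow, mul_assoc] using hx

theorem taylorCoeff_iteratedDeriv (f : ℂ → ℂ) (k n : ℕ) :
    taylorCoeff (iteratedDeriv k f) n = taylorCoeff f (n + k) * ((n + 1).ascFactorial k : ℂ) := by
  have h1 : (Nat.factorial n : ℂ) * ((n + 1).ascFactorial k : ℂ) = Nat.factorial (n + k) := by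
    exact_mod_cast Nat.factorial_mul_ascFactorial n k
  have h2 : (Nat.factorial n : ℂ) ≠ 0 := by exact_mod_cast Nat.factorial_ne_zero n
  have h3 : ((n + 1).ascFactorial k : ℂ) ≠ 0 := by
    exact_mod_cast (Nat.ascFactorial_pos n k).ne'
  rw [taylorCoeff, taylorCoeff, ← h1, iteratedDeriv_eq_iterate, iteratedDeriv_eq_iterate,
    iteratedDeriv_eq_iterate, ← Function.iterate_add_apply]
  field_simp

/-! ## The Taylor coefficients of the branch depend continuously on the parameter -/

theorem continuous_taylorCoeff_pow {X : Type*} [TopologicalSpace X] {U : X → ℂ → ℂ}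
    (hU : ∀ ζ, AnalyticAt ℂ (U ζ) 0) {n : ℕ}
    (hc : ∀ i ≤ n, Continuous fun ζ => taylorCoeff (U ζ) i) (p : ℕ) :
    ∀ i ≤ n, Continuous fun ζ => taylorCoeff (fun x => U ζ x ^ p) i := by
  induction p with
  | zero =>
    intro i _
    simp only [pow_zero]
    exact continuous_const
  | succ p ih =>
    intro i hi
    have : ∀ ζ, taylorCoeff (fun x => U ζ x ^ (p + 1)) i = ∑ j ∈ Finset.range (i + 1),
        taylorCoeff (fun x => U ζ x ^ p) j * taylorCoeff (U ζ) (i - j) := fun ζ => by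
      simp only [pow_succ]
      exact taylorCoeff_mul ((hU ζ).fun_pow p) (hU ζ) i
    simp only [this]
    refine continuous_finsetSum _ fun j hj => (ih j ?_).mul (hc _ ?_)
    · exact (Nat.lt_succ_iff.1 (Finset.mem_range.1 hj)).trans hi
    · exact (Nat.sub_le _ _).trans hi

/-- The equation `U = 1 + ∑ ζ_k x^{e_k} U^{e_k}` expresses the coefficient of order `n` through
coefficients of order at most `n - e_k < n`; strong induction applies. -/
theorem continuous_taylorCoeff_branch {N : ℕ} (e : Fin N → ℕ) (he : ∀ n, 2 ≤ e n) (n : ℕ) :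
    Continuous fun ζ : Fin N → ℂ => taylorCoeff (taylorBranch e ζ) n := by
  have hG := fun ζ => isTaylorGerm_taylorBranch e ζ he
  have hA : ∀ ζ, AnalyticAt ℂ (taylorBranch e ζ) 0 := fun ζ => (hG ζ).analyticAt
  induction n using Nat.strong_induction_on with
  | _ n ih =>
    have hrec : ∀ ζ : Fin N → ℂ, taylorCoeff (taylorBranch e ζ) n =
        (if n = 0 then 1 else 0) + ∑ k, ζ k * (if e k ≤ n then
          taylorCoeff (fun x => taylorBranch e ζ x ^ e k) (n - e k) else 0) := by
      intro ζ
      have h1 : taylorBranch e ζ =ᶠ[𝓝 0]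
          fun x => 1 + ∑ k, ζ k * (x ^ e k * taylorBranch e ζ x ^ e k) := by
        filter_upwards [(hG ζ).eqn] with x hx
        rw [leafPoly, sub_sub, sub_eq_zero] at hx
        simpa only [mul_assoc] using hx
      have hm : ∀ k, AnalyticAt ℂ (fun x => x ^ e k * taylorBranch e ζ x ^ e k) 0 := fun k =>
        (analyticAt_id.fun_pow (e k)).mul ((hA ζ).fun_pow (e k))
      have hm' : ∀ k, AnalyticAt ℂ (fun x => ζ k * (x ^ e k * taylorBranch e ζ x ^ e k)) 0 :=
        fun k => analyticAt_const.mul (hm k)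
      rw [taylorCoeff_congr h1, taylorCoeff_add analyticAt_const
        (Finset.analyticAt_fun_sum _ fun k _ => hm' k), taylorCoeff_const, taylorCoeff_sum _ hm']
      congr 1
      refine Finset.sum_congr rfl fun k _ => ?_
      rw [taylorCoeff_const_mul (hm k), taylorCoeff_pow_mul ((hA ζ).fun_pow (e k))]
    simp only [hrec]
    refine continuous_const.add (continuous_finsetSum _ fun k _ => (continuous_apply k).mul ?_)
    split_ifs with hk
    · refine continuous_taylorCoeff_pow hA (n := n - e k) (fun i hi => ih i ?_) _ _ le_rfl
      have := he k
      omega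
    · exact continuous_const

theorem continuous_powCoeff {N : ℕ} (e : Fin N → ℕ) (he : ∀ n, 2 ≤ e n) (p m : ℕ) :
    Continuous fun ζ : Fin N → ℂ => powCoeff e ζ p m :=
  continuous_taylorCoeff_pow (fun ζ => (isTaylorGerm_taylorBranch e ζ he).analyticAt)
    (fun i _ => continuous_taylorCoeff_branch e he i) p _ le_rfl

/-! ## Transfer of a singular bound to Taylor coefficients -/

theorem norm_circleMap_one_sub (r θ : ℝ) :
    ‖circleMap 0 1 θ - r‖ = ‖1 - circleMap 0 r θ‖ := by
  have h1 : ‖1 - circleMap 0 r θ‖ = ‖(starRingEnd ℂ) (1 - circleMap 0 r θ)‖ :=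
    (RCLike.norm_conj _).symm
  have h2 : (starRingEnd ℂ) (1 - circleMap 0 r θ) =
      Complex.exp (-(θ * Complex.I)) * (circleMap 0 1 θ - r) := by
    simp only [circleMap, zero_add, map_sub, map_one, map_mul, Complex.conj_ofReal,
      ← Complex.exp_conj, Complex.conj_I, Complex.ofReal_one, one_mul, mul_sub,
      ← Complex.exp_add]
    rw [neg_add_cancel, Complex.exp_zero, mul_neg, mul_comm (r : ℂ)]
  have h3 : ‖Complex.exp (-(θ * Complex.I))‖ = 1 := by
    have := Complex.norm_exp_ofReal_mul_I (-θ)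
    push_cast at this
    rwa [neg_mul] at this
  rw [h1, h2, norm_mul, h3, one_mul]

/-- The Poisson kernel at `r` has mean 1, and `|e^{iθ} - r| = |1 - r e^{iθ}|`. -/
theorem integral_inv_norm_one_sub_sq {r : ℝ} (hr0 : 0 ≤ r) (hr1 : r < 1) :
    (2 * Real.pi)⁻¹ * ∫ θ in (0 : ℝ)..2 * Real.pi, (‖1 - circleMap 0 r θ‖ ^ 2)⁻¹ =
      (1 - r ^ 2)⁻¹ := by
  have hw : (r : ℂ) ∈ ball (0 : ℂ) 1 := by
    simpa [abs_of_nonneg hr0] using hr1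
  have h := DiffContOnCl.circleAverage_poissonKernel_smul' (f := fun _ => (1 : ℂ)) (R := 1)
    (c := 0) diffContOnCl_const hw
  have e : ∀ θ : ℝ, ((‖circleMap 0 1 θ - 0‖ ^ 2 - ‖(r : ℂ) - 0‖ ^ 2) /
      ‖(circleMap 0 1 θ - 0) - ((r : ℂ) - 0)‖ ^ 2) =
      (1 - r ^ 2) * (‖1 - circleMap 0 r θ‖ ^ 2)⁻¹ := by
    intro θ
    rw [sub_zero, sub_zero, norm_circleMap_one_sub, norm_circleMap_zero, Complex.norm_real,
      Real.norm_of_nonneg hr0, abs_one, one_pow, div_eq_mul_inv]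
  rw [Real.circleAverage_def] at h
  simp only [e] at h
  rw [intervalIntegral.integral_smul_const, intervalIntegral.integral_const_mul,
    ← smul_assoc, smul_eq_mul, Complex.real_smul, mul_one] at h
  have h' : (2 * Real.pi)⁻¹ * ((1 - r ^ 2) *
      ∫ θ in (0 : ℝ)..2 * Real.pi, (‖1 - circleMap 0 r θ‖ ^ 2)⁻¹) = 1 := by exact_mod_cast h
  have h1 : (1 - r ^ 2) ≠ 0 := by nlinarith
  field_simp at h' ⊢
  linarith

theorem one_sub_ne_zero_of_mem_ball {w : ℂ} (hw : w ∈ ball (0 : ℂ) 1) : 0 < ‖1 - w‖ := by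
  rw [norm_pos_iff, sub_ne_zero]
  rintro rfl
  simp at hw

/-- Cauchy's formula on a circle at distance `1 / (m + 2)` from the unit circle, where the mean of
`|1 - w|⁻²` is at most `m + 2`. -/
theorem norm_taylorCoeff_le_of_inv_sq {g : ℂ → ℂ} {K : ℝ} (hg : DifferentiableOn ℂ g (ball 0 1))
    (hK : ∀ w ∈ ball (0 : ℂ) 1, ‖g w‖ ≤ K * (‖1 - w‖ ^ 2)⁻¹) (m : ℕ) :
    ‖taylorCoeff g m‖ ≤ 3 * K * ((m : ℝ) + 2) := by
  have hK0 : 0 ≤ K := by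
    have := (norm_nonneg _).trans (hK 0 (mem_ball_self one_pos))
    simpa using this
  set r : NNReal := ((m : NNReal) + 1) / ((m : NNReal) + 2) with hr
  have hrc : (r : ℝ) = ((m : ℝ) + 1) / ((m : ℝ) + 2) := by simp [hr]
  have hr0 : 0 < (r : ℝ) := by rw [hrc]; positivity
  have hr1 : (r : ℝ) < 1 := by rw [hrc, div_lt_one (by positivity)]; linarith
  have hsub : closedBall (0 : ℂ) r ⊆ ball 0 1 := closedBall_subset_ball hr1
  have hp := (hg.mono hsub).hasFPowerSeriesOnBall (by exact_mod_cast hr0)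
  rw [taylorCoeff_eq_coeff hp.hasFPowerSeriesAt, ← FormalMultilinearSeries.norm_apply_eq_norm_coef]
  refine (norm_cauchyPowerSeries_le _ _ _ _).trans ?_
  have hmem : ∀ θ, circleMap 0 r θ ∈ ball (0 : ℂ) 1 := fun θ =>
    hsub (circleMap_mem_closedBall _ hr0.le _)
  have hcont : Continuous fun θ : ℝ => (‖1 - circleMap 0 r θ‖ ^ 2)⁻¹ := by
    refine Continuous.inv₀ (by fun_prop) fun θ => ?_
    exact pow_ne_zero _ (one_sub_ne_zero_of_mem_ball (hmem θ)).ne'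
  have hgc : Continuous fun θ : ℝ => ‖g (circleMap 0 r θ)‖ :=
    (hg.continuousOn.comp_continuous (continuous_circleMap 0 r) hmem).norm
  have h1 : ∫ θ in (0 : ℝ)..2 * Real.pi, ‖g (circleMap 0 r θ)‖ ≤
      ∫ θ in (0 : ℝ)..2 * Real.pi, K * (‖1 - circleMap 0 r θ‖ ^ 2)⁻¹ := by
    refine intervalIntegral.integral_mono (by positivity) (hgc.intervalIntegrable _ _)
      ((hcont.const_mul K).intervalIntegrable _ _) fun θ => hK _ (hmem θ)
  rw [intervalIntegral.integral_const_mul] at h1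
  have h2 : (2 * Real.pi)⁻¹ * ∫ θ in (0 : ℝ)..2 * Real.pi, ‖g (circleMap 0 r θ)‖ ≤
      K * ((m : ℝ) + 2) := by
    calc _ ≤ (2 * Real.pi)⁻¹ * (K * ∫ θ in (0 : ℝ)..2 * Real.pi,
          (‖1 - circleMap 0 r θ‖ ^ 2)⁻¹) := mul_le_mul_of_nonneg_left h1 (by positivity)
      _ = K * (1 - (r : ℝ) ^ 2)⁻¹ := by rw [← integral_inv_norm_one_sub_sq hr0.le hr1]; ring
      _ ≤ K * ((m : ℝ) + 2) := by
        refine mul_le_mul_of_nonneg_left ?_ hK0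
        refine inv_le_of_inv_le₀ (by positivity) ?_
        have : ((m : ℝ) + 2)⁻¹ = 1 - r := by rw [hrc]; field_simp; ring
        rw [this]
        nlinarith
  -- `r⁻¹ = 1 + 1/(m+1)`, whose `m`-th power is below `e`.
  have h3 : |(r : ℝ)|⁻¹ ^ m ≤ 3 := by
    rw [abs_of_pos hr0, hrc, inv_div]
    have e1 : ((m : ℝ) + 2) / ((m : ℝ) + 1) ≤ Real.exp (1 / ((m : ℝ) + 1)) := by
      refine le_trans (le_of_eq ?_) (Real.add_one_le_exp _)
      field_simp; ring
    calc (((m : ℝ) + 2) / ((m : ℝ) + 1)) ^ m ≤ Real.exp (1 / ((m : ℝ) + 1)) ^ m :=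
          pow_le_pow_left₀ (by positivity) e1 m
      _ = Real.exp (m * (1 / ((m : ℝ) + 1))) := by rw [← Real.exp_nat_mul]
      _ ≤ Real.exp 1 := by
        refine Real.exp_le_exp.2 ?_
        rw [mul_one_div, div_le_one (by positivity)]
        linarith
      _ ≤ 3 := Real.exp_one_lt_three.le
  calc _ ≤ (K * ((m : ℝ) + 2)) * 3 := by gcongr
    _ = _ := by ring

/-- The union of the disks of radius `c |1 - w|` about the points `w` of the unit disk. -/
def fan (c : ℝ) : Set ℂ := {v | ∃ w ∈ ball (0 : ℂ) 1, ‖v - w‖ < c * ‖1 - w‖}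

theorem ball_subset_fan {c : ℝ} (hc : 0 < c) : ball (0 : ℂ) 1 ⊆ fan c := fun w hw =>
  ⟨w, hw, by simpa using mul_pos hc (one_sub_ne_zero_of_mem_ball hw)⟩

theorem ball_subset_fan_of_mem {c : ℝ} {w : ℂ} (hw : w ∈ ball (0 : ℂ) 1) :
    ball w (c * ‖1 - w‖) ⊆ fan c := fun v hv => ⟨w, hw, by simpa [dist_eq_norm] using hv⟩

theorem fan_mono {c c' : ℝ} (h : c ≤ c') : fan c ⊆ fan c' := by
  rintro v ⟨w, hw, hv⟩
  exact ⟨w, hw, hv.trans_le (by gcongr)⟩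

/-- The disks of the fan allow Cauchy's estimate at scale `|1 - w|`, so three derivatives turn `O(|1
- w|)` into `O(|1 - w|⁻²)`. The coefficients of the third derivative are then `O(m)`, and dividing
by three factors of order `m` gives `O(n⁻²)`, with no contour around the singularity. -/
theorem norm_taylorCoeff_le_of_fan {f : ℂ → ℂ} {c K : ℝ} (hc : 0 < c) (hc1 : c ≤ 1)
    (hf : DifferentiableOn ℂ f (fan c)) (hK : ∀ v ∈ fan c, ‖f v‖ ≤ K * ‖1 - v‖) (n : ℕ) :
    ‖taylorCoeff f n‖ ≤ 2000 / c ^ 3 * K / ((n : ℝ) + 1) ^ 2 := by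
  have hball := ball_subset_fan hc
  have hfb : DifferentiableOn ℂ f (ball 0 1) := hf.mono hball
  have hK0 : 0 ≤ K := by
    have := (norm_nonneg _).trans (hK 0 (hball (mem_ball_self one_pos)))
    simpa using this
  have hc3 : 0 < c ^ 3 := by positivity
  have hc3' : c ^ 3 ≤ 1 := pow_le_one₀ hc.le hc1
  obtain hn | ⟨m, rfl⟩ : n ≤ 2 ∨ ∃ m, n = m + 3 := by
    rcases le_or_gt n 2 with h | h
    · exact Or.inl h
    · exact Or.inr ⟨n - 3, by omega⟩
  · have hsub : closedBall (0 : ℂ) (1 / 2) ⊆ ball 0 1 := closedBall_subset_ball (by norm_num)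
    have h1 := Complex.norm_iteratedDeriv_le_of_forall_mem_sphere_norm_le (c := (0 : ℂ))
      (R := 1 / 2) (C := 2 * K) (f := f) n (by norm_num)
      ((hfb.mono (closure_ball_subset_closedBall.trans hsub)).diffContOnCl) (fun z hz => by
        have hz1 : z ∈ ball (0 : ℂ) 1 := hsub (sphere_subset_closedBall hz)
        refine (hK z (hball hz1)).trans ?_
        have : ‖1 - z‖ ≤ 2 := by
          refine (norm_sub_le _ _).trans ?_
          simp only [mem_ball, dist_zero_right] at hz1
          simp only [norm_one]; linarith
        nlinarith)
    have hfac : (0 : ℝ) < Nat.factorial n := by exact_mod_cast Nat.factorial_pos n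
    have h2 : ‖taylorCoeff f n‖ ≤ 2 * K / (1 / 2) ^ n := by
      rw [taylorCoeff, norm_div, Complex.norm_natCast, div_le_iff₀ hfac]
      refine h1.trans_eq ?_
      ring
    refine h2.trans ?_
    have h3 : 2000 * K ≤ 2000 / c ^ 3 * K :=
      mul_le_mul_of_nonneg_right ((le_div_iff₀ hc3).2 (by linarith)) hK0
    rw [le_div_iff₀ (by positivity)]
    interval_cases n <;> norm_num <;> nlinarith
  · have hd : DifferentiableOn ℂ (iteratedDeriv 3 f) (ball 0 1) := by
      intro w hw
      have := (hfb.analyticAt (isOpen_ball.mem_nhds hw)).iterated_deriv 3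
      rw [iteratedDeriv_eq_iterate]
      exact this.differentiableAt.differentiableWithinAt
    -- Radius `c/2 * ‖1 - w‖` and sup bound `2K‖1 - w‖` give `3! * 2 * 2³ = 96`.
    have hb : ∀ w ∈ ball (0 : ℂ) 1, ‖iteratedDeriv 3 f w‖ ≤ 96 / c ^ 3 * K * (‖1 - w‖ ^ 2)⁻¹ := by
      intro w hw
      have hp := one_sub_ne_zero_of_mem_ball hw
      have hsub : closedBall w (c / 2 * ‖1 - w‖) ⊆ fan c :=
        (closedBall_subset_ball (by nlinarith)).trans (ball_subset_fan_of_mem hw)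
      have h1 := Complex.norm_iteratedDeriv_le_of_forall_mem_sphere_norm_le (c := w)
        (R := c / 2 * ‖1 - w‖) (C := 2 * K * ‖1 - w‖) (f := f) 3 (by positivity)
        ((hf.mono (closure_ball_subset_closedBall.trans hsub)).diffContOnCl) (fun z hz => by
          refine (hK z (hsub (sphere_subset_closedBall hz))).trans ?_
          have e : ‖1 - z‖ ≤ 2 * ‖1 - w‖ := by
            have e1 : ‖1 - z‖ ≤ ‖1 - w‖ + ‖z - w‖ := by
              have := norm_sub_le (1 - w) (z - w)
              rwa [sub_sub_sub_cancel_right] at this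
            rw [mem_sphere_iff_norm] at hz
            nlinarith
          nlinarith)
      refine h1.trans_eq ?_
      have : ‖1 - w‖ ≠ 0 := hp.ne'
      norm_num [Nat.factorial]
      field_simp
      ring
    have h1 := norm_taylorCoeff_le_of_inv_sq hd hb m
    rw [taylorCoeff_iteratedDeriv, norm_mul, Complex.norm_natCast] at h1
    have h2 : (((m + 1).ascFactorial 3 : ℕ) : ℝ) = ((m : ℝ) + 1) * ((m : ℝ) + 2) * ((m : ℝ) + 3) := by
      simp only [Nat.ascFactorial]
      push_cast
      ring
    rw [h2] at h1
    push_cast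
    rw [le_div_iff₀ (by positivity)]
    have hm : (0 : ℝ) ≤ m := Nat.cast_nonneg m
    have h3 : ‖taylorCoeff f (m + 3)‖ * (((m : ℝ) + 1) * ((m : ℝ) + 3)) ≤ 288 / c ^ 3 * K := by
      refine le_of_mul_le_mul_right ?_ (show (0 : ℝ) < m + 2 by positivity)
      calc _ = ‖taylorCoeff f (m + 3)‖ * (((m : ℝ) + 1) * ((m : ℝ) + 2) * ((m : ℝ) + 3)) := by ring
        _ ≤ _ := h1
        _ = _ := by ring
    have h4 : 0 ≤ ‖taylorCoeff f (m + 3)‖ := norm_nonneg _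
    -- At `m = 0` this reads `16 ≤ 18`; the final constant is `6 * 288 = 1728`.
    have h5 : ((m : ℝ) + 3 + 1) ^ 2 ≤ 6 * (((m : ℝ) + 1) * ((m : ℝ) + 3)) := by nlinarith
    calc _ ≤ ‖taylorCoeff f (m + 3)‖ * (6 * (((m : ℝ) + 1) * ((m : ℝ) + 3))) :=
          mul_le_mul_of_nonneg_left h5 h4
      _ ≤ 6 * (288 / c ^ 3 * K) := by linarith
      _ = 1728 / c ^ 3 * K := by ring
      _ ≤ 2000 / c ^ 3 * K := by gcongr; norm_num

/-! ## Taylor coefficients of `(1 - w)^{1/2}` -/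

theorem hasDerivAt_sqrt_one_sub {w : ℂ} (hw : 1 - w ∈ Complex.slitPlane) :
    HasDerivAt (fun w : ℂ => (1 - w) ^ (1 / 2 : ℂ)) (-(1 / 2) * (1 - w) ^ (1 / 2 - 1 : ℂ)) w := by
  have h := ((hasDerivAt_id w).const_sub 1).cpow_const (c := (1 / 2 : ℂ)) hw
  refine (h.congr_deriv ?_)
  change 1 / 2 * (1 - w) ^ (1 / 2 - 1 : ℂ) * -1 = _
  ring

theorem analyticAt_sqrt_one_sub : AnalyticAt ℂ (fun w : ℂ => (1 - w) ^ (1 / 2 : ℂ)) 0 :=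
  (analyticAt_const.sub analyticAt_id).cpow analyticAt_const (by simp)

/-- Coefficients of the differential equation `(1 - w) g' = -g / 2`. -/
theorem taylorCoeff_sqrt_succ (n : ℕ) :
    ((n : ℂ) + 1) * taylorCoeff (fun w : ℂ => (1 - w) ^ (1 / 2 : ℂ)) (n + 1) =
      ((n : ℂ) - 1 / 2) * taylorCoeff (fun w : ℂ => (1 - w) ^ (1 / 2 : ℂ)) n := by
  set g : ℂ → ℂ := fun w : ℂ => (1 - w) ^ (1 / 2 : ℂ) with hg
  have hga : AnalyticAt ℂ g 0 := analyticAt_sqrt_one_sub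
  have hda : AnalyticAt ℂ (deriv g) 0 := hga.deriv
  have hd : ∀ n, taylorCoeff (deriv g) n = taylorCoeff g (n + 1) * ((n : ℂ) + 1) := fun n => by
    have := taylorCoeff_iteratedDeriv g 1 n
    rw [iteratedDeriv_one] at this
    rw [this]
    simp [Nat.ascFactorial]
  have hev : deriv g =ᶠ[𝓝 0] fun w => w ^ 1 * deriv g w + -(1 / 2) * g w := by
    have hs : ∀ᶠ w : ℂ in 𝓝 0, 1 - w ∈ Complex.slitPlane := by
      refine (continuous_const.sub continuous_id).continuousAt.eventually_mem
        (Complex.isOpen_slitPlane.mem_nhds ?_)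
      simp
    filter_upwards [hs] with w hw
    have h0 : 1 - w ≠ 0 := Complex.slitPlane_ne_zero hw
    have h1 : (1 - w) * (1 - w) ^ (1 / 2 - 1 : ℂ) = g w := by
      rw [Complex.cpow_sub _ _ h0, Complex.cpow_one, mul_div_cancel₀ _ h0]
    rw [(hasDerivAt_sqrt_one_sub hw).deriv, ← h1]
    ring
  have h1 := taylorCoeff_congr hev n
  have hp : AnalyticAt ℂ (fun w : ℂ => w ^ 1 * deriv g w) 0 := (analyticAt_id.pow 1).mul hda
  have hc : AnalyticAt ℂ (fun w : ℂ => -(1 / 2) * g w) 0 := analyticAt_const.mul hga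
  rw [taylorCoeff_add hp hc, taylorCoeff_pow_mul hda, taylorCoeff_const_mul hga, hd] at h1
  rcases n with _ | n
  · simp at h1 ⊢
    linear_combination h1
  · rw [if_pos (by omega), Nat.add_sub_cancel, hd] at h1
    push_cast at h1 ⊢
    linear_combination h1

/-- The recursion telescopes, after squaring, into the Wallis product; the sign is recorded so that
the square root can be taken back. -/
theorem exists_taylorCoeff_sqrt (n : ℕ) : ∃ x : ℝ,
    taylorCoeff (fun w : ℂ => (1 - w) ^ (1 / 2 : ℂ)) n = x ∧ (n = 0 → x = 1) ∧ (1 ≤ n → x < 0) ∧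
      x ^ 2 * ((2 * n - 1) ^ 2 * (2 * n + 1) * Real.Wallis.W n) = 1 := by
  induction n with
  | zero =>
    refine ⟨1, ?_, fun _ => rfl, by simp, by simp [Real.Wallis.W]⟩
    simp [taylorCoeff]
  | succ n ih =>
    obtain ⟨x, h1, h2, h3, h4⟩ := ih
    have hn : (0 : ℝ) ≤ n := Nat.cast_nonneg n
    refine ⟨(n - 1 / 2) / (n + 1) * x, ?_, by simp, fun _ => ?_, ?_⟩
    · have h := taylorCoeff_sqrt_succ n
      have h0 : (n : ℂ) + 1 ≠ 0 := by exact_mod_cast Nat.succ_ne_zero n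
      rw [h1] at h
      push_cast
      rw [div_mul_eq_mul_div, eq_div_iff h0, mul_comm, h]
    · rcases Nat.eq_zero_or_pos n with rfl | hp
      · rw [h2 rfl]; norm_num
      · have h5 : (1 : ℝ) ≤ n := by exact_mod_cast hp
        refine mul_neg_of_pos_of_neg (div_pos (by linarith) (by linarith)) (h3 hp)
    · refine Eq.trans ?_ h4
      rw [Real.Wallis.W_succ]
      push_cast
      field_simp
      ring

/-- The leading amplitude of the Taylor coefficients of `-(1 - w)^{1/2}`. -/
noncomputable def sqrtAmp (m : ℕ) : ℝ :=
  1 / (2 * Real.sqrt Real.pi) * ((Real.sqrt ((m : ℝ) + 1))⁻¹ / ((m : ℝ) + 1))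

theorem sqrtAmp_pos (m : ℕ) : 0 < sqrtAmp m := by
  have := Real.pi_pos
  unfold sqrtAmp
  positivity

theorem sqrtAmp_sq (m : ℕ) : sqrtAmp m ^ 2 = 1 / (4 * Real.pi * ((m : ℝ) + 1) ^ 3) := by
  have h1 : Real.sqrt Real.pi ^ 2 = Real.pi := Real.sq_sqrt Real.pi_pos.le
  have h2 : Real.sqrt ((m : ℝ) + 1) ^ 2 = (m : ℝ) + 1 := Real.sq_sqrt (by positivity)
  rw [sqrtAmp, mul_pow, div_pow, div_pow, mul_pow, inv_pow, h1, h2]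
  have := Real.pi_pos
  field_simp
  norm_num

theorem sqrtAmp_le (m : ℕ) : sqrtAmp m ≤ 1 / ((m : ℝ) + 1) := by
  have h1 : (1 : ℝ) ≤ Real.sqrt Real.pi := Real.one_le_sqrt.2 (by linarith [Real.pi_gt_three])
  have h2 : 1 / (2 * Real.sqrt Real.pi) ≤ 1 := by
    rw [div_le_one (by positivity)]; linarith
  unfold sqrtAmp
  calc _ ≤ 1 * (1 / ((m : ℝ) + 1)) := by
        gcongr
        exact inv_sqrt_succ_le_one m
    _ = _ := one_mul _

/-- The two-sided Wallis bounds place the squared coefficient between `t²` and `t² (1 + 60 / N)`,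
with `t = sqrtAmp m` and `N = m + 1`. -/
theorem norm_taylorCoeff_sqrt_add_le (m : ℕ) :
    ‖taylorCoeff (fun w : ℂ => (1 - w) ^ (1 / 2 : ℂ)) m + sqrtAmp m‖ ≤ 60 / ((m : ℝ) + 1) ^ 2 := by
  obtain ⟨x, h1, h2, h3, h4⟩ := exists_taylorCoeff_sqrt m
  rw [h1, ← Complex.ofReal_add, Complex.norm_real, Real.norm_eq_abs]
  have ht0 := sqrtAmp_pos m
  have ht1 := sqrtAmp_le m
  have ht2 := sqrtAmp_sq m
  set t := sqrtAmp m
  rcases m with _ | k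
  · rw [h2 rfl, abs_of_pos (by linarith)]
    norm_num at ht1 ⊢
    linarith
  · have hx := h3 (by omega)
    have hpi := Real.pi_pos
    have hW0 := Real.Wallis.W_pos (k + 1)
    have hW1 := Real.Wallis.W_le (k + 1)
    have hW2 := Real.Wallis.le_W (k + 1)
    set W := Real.Wallis.W (k + 1)
    push_cast at h4 ht1 ht2 hW2 ⊢
    have hk : (0 : ℝ) ≤ k := Nat.cast_nonneg k
    set N : ℝ := (k : ℝ) + 1 + 1 with hN
    have hNpos : 0 < N := by positivity
    have hx2 : x ^ 2 = 1 / ((2 * k + 1) ^ 2 * (2 * k + 3) * W) := by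
      rw [eq_div_iff (by positivity)]
      refine Eq.trans ?_ h4
      ring
    have hlow : t ^ 2 ≤ x ^ 2 := by
      rw [ht2, hx2]
      refine one_div_le_one_div_of_le (by positivity) ?_
      calc (2 * k + 1) ^ 2 * (2 * k + 3) * W
          ≤ (2 * k + 1) ^ 2 * (2 * k + 3) * (Real.pi / 2) := by gcongr
        _ ≤ 4 * Real.pi * N ^ 3 := by
          have : (2 * (k : ℝ) + 1) ^ 2 * (2 * k + 3) ≤ 8 * N ^ 3 := by
            rw [hN]; ring_nf; nlinarith [pow_nonneg hk 2, pow_nonneg hk 3]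
          nlinarith
    have hup : x ^ 2 ≤ t ^ 2 * (1 + 60 / N) := by
      have hWl : (2 * (k : ℝ) + 3) / (2 * N) * (Real.pi / 2) ≤ W := by
        refine le_of_eq_of_le ?_ hW2
        rw [hN]; ring
      have e1 : x ^ 2 ≤ 1 / ((2 * k + 1) ^ 2 * (2 * k + 3) *
          ((2 * (k : ℝ) + 3) / (2 * N) * (Real.pi / 2))) := by
        rw [hx2]
        refine one_div_le_one_div_of_le (by positivity) ?_
        gcongr
      refine e1.trans ?_
      have e2 : 1 / ((2 * k + 1) ^ 2 * (2 * k + 3) *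
          ((2 * (k : ℝ) + 3) / (2 * N) * (Real.pi / 2))) =
          4 * N / (Real.pi * ((2 * k + 1) ^ 2 * (2 * k + 3) ^ 2)) := by
        field_simp; norm_num
      have e3 : t ^ 2 * (1 + 60 / N) = (N + 60) / (4 * Real.pi * N ^ 4) := by
        rw [ht2]; field_simp
      rw [e2, e3, div_le_div_iff₀ (by positivity) (by positivity)]
      -- The constant 60 is dictated by small `k`: at `k = 0` the inequality is `512 ≤ 558`.
      have e4 : 16 * N ^ 5 ≤ (N + 60) * ((2 * (k : ℝ) + 1) ^ 2 * (2 * k + 3) ^ 2) := by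
        rw [hN]
        nlinarith [pow_nonneg hk 2, pow_nonneg hk 3, pow_nonneg hk 4, pow_nonneg hk 5]
      calc 4 * N * (4 * Real.pi * N ^ 4) = Real.pi * (16 * N ^ 5) := by ring
        _ ≤ Real.pi * ((N + 60) * ((2 * (k : ℝ) + 1) ^ 2 * (2 * k + 3) ^ 2)) := by gcongr
        _ = _ := by ring
    have hxt : t ≤ -x := by
      refine (sq_le_sq₀ ht0.le (by linarith)).1 ?_
      rwa [neg_sq]
    -- From `x² - t² = (-x - t)(-x + t)` and `-x ≥ 0`.
    have hd : (-x - t) * t ≤ t ^ 2 * (60 / N) := by nlinarith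
    have hd' : -x - t ≤ t * (60 / N) := by
      refine le_of_mul_le_mul_right ?_ ht0
      nlinarith
    rw [abs_of_nonpos (by linarith)]
    calc -(x + t) = -x - t := by ring
      _ ≤ t * (60 / N) := hd'
      _ ≤ 1 / N * (60 / N) := by gcongr
      _ = 60 / N ^ 2 := by field_simp

/-! ## Uniform asymptotics of the coefficients of powers -/

theorem norm_cpow_half (x : ℂ) : ‖x ^ (1 / 2 : ℂ)‖ = Real.sqrt ‖x‖ := by
  have h := Complex.norm_cpow_real x (1 / 2)
  rw [Real.sqrt_eq_rpow, ← h]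
  push_cast
  rfl

/-- With `c ≤ 1/4`, distances to 1 from `v` and from the centre `w` are comparable. The real-part
bound keeps the fan out of a sector at 1 pointing away from the origin, hence off the cut of the
principal root of `1 - v`. -/
theorem fan_bounds {c : ℝ} (hc : 0 < c) (hc1 : c ≤ 1 / 4) {v : ℂ} (hv : v ∈ fan c) :
    0 < ‖1 - v‖ ∧ (v - 1).re < 2 * c * ‖1 - v‖ ∧ ‖v‖ < 1 + 2 * c := by
  obtain ⟨w, hw, hvw⟩ := hv
  have hp := one_sub_ne_zero_of_mem_ball hw
  rw [mem_ball_zero_iff] at hw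
  have h1 : ‖1 - w‖ ≤ ‖1 - v‖ + ‖v - w‖ := by
    have := norm_add_le (1 - v) (v - w)
    rwa [sub_add_sub_cancel] at this
  have h2 : ‖1 - w‖ < 2 := by
    have := norm_sub_le (1 : ℂ) w
    rw [norm_one] at this
    linarith
  have h3 : (3 / 4) * ‖1 - w‖ < ‖1 - v‖ := by nlinarith
  refine ⟨by nlinarith, ?_, ?_⟩
  · have h4 : (v - w).re ≤ ‖v - w‖ := Complex.re_le_norm _
    have h5 : w.re ≤ ‖w‖ := Complex.re_le_norm _
    have h6 : (v - 1).re = (v - w).re + (w.re - 1) := by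
      simp only [Complex.sub_re, Complex.one_re]; ring
    rw [h6]
    nlinarith
  · have : ‖v‖ ≤ ‖v - w‖ + ‖w‖ := by simpa using norm_add_le (v - w) w
    nlinarith

theorem one_sub_mem_slitPlane {c : ℝ} (hc : 0 < c) (hc1 : c ≤ 1 / 4) {v : ℂ} (hv : v ∈ fan c) :
    1 - v ∈ Complex.slitPlane := by
  obtain ⟨h1, h2, -⟩ := fan_bounds hc hc1 hv
  rw [Complex.mem_slitPlane_iff]
  by_contra! h
  have h3 : ‖1 - v‖ = |(1 - v).re| := by
    rw [← Real.norm_eq_abs, ← Complex.norm_real]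
    congr 1
    exact Complex.ext rfl (by simpa using h.2)
  rw [h3, abs_of_nonpos h.1] at h1 h2
  have h4 : (v - 1).re = -(1 - v).re := by simp
  rw [h4] at h2
  nlinarith

/-- Schwarz's lemma on the disk of the fan about `w`, where `f - f w` is at most `2M`. -/
theorem norm_sub_le_of_fan {f : ℂ → ℂ} {c M : ℝ} (hc : 0 < c)
    (hf : DifferentiableOn ℂ f (fan c)) (hM : ∀ v ∈ fan c, ‖f v‖ ≤ M) {w v : ℂ}
    (hw : w ∈ ball (0 : ℂ) 1) (hv : ‖v - w‖ < c * ‖1 - w‖) :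
    ‖f v - f w‖ ≤ 2 * M / (c * ‖1 - w‖) * ‖v - w‖ := by
  have hsub := ball_subset_fan_of_mem (c := c) hw
  have h := Complex.dist_le_div_mul_dist_of_mapsTo_ball (f := f) (c := w) (z := v)
    (R₁ := c * ‖1 - w‖) (R₂ := 2 * M) (hf.mono hsub) (fun z hz => ?_)
    (by simpa [dist_eq_norm] using hv)
  · simpa [dist_eq_norm] using h
  · rw [mem_closedBall, dist_eq_norm]
    refine (norm_sub_le _ _).trans ?_
    linarith [hM z (hsub hz), hM w (ball_subset_fan hc hw)]

theorem exists_norm_le_near {C L A : ℝ} (hC : 0 ≤ C) (hA : L < A) :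
    ∃ σ > 0, ∀ y lam kap w : ℂ, ‖y - lam - kap * (1 - w) ^ (1 / 2 : ℂ)‖ ≤ C * ‖1 - w‖ →
      ‖kap‖ ≤ C → ‖lam‖ ≤ L → ‖1 - w‖ ≤ σ → ‖y‖ ≤ A := by
  set b := min 1 ((A - L) / (2 * C + 1)) with hb
  have hb0 : 0 < b := lt_min one_pos (div_pos (by linarith) (by linarith))
  have hb1 : b ≤ 1 := min_le_left _ _
  have hb2 : b * (2 * C + 1) ≤ A - L := (le_div_iff₀ (by linarith)).1 (min_le_right _ _)
  refine ⟨b ^ 2, by positivity, fun y lam kap w h1 hk hl h => ?_⟩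
  have h2 : Real.sqrt ‖1 - w‖ ≤ b := by
    rw [← Real.sqrt_sq hb0.le]; exact Real.sqrt_le_sqrt h
  have h3 : ‖kap * (1 - w) ^ (1 / 2 : ℂ)‖ ≤ C * b := by
    rw [norm_mul, norm_cpow_half]
    exact mul_le_mul hk h2 (Real.sqrt_nonneg _) hC
  have h4 : ‖y‖ ≤ ‖y - lam - kap * (1 - w) ^ (1 / 2 : ℂ)‖ + ‖lam‖ +
      ‖kap * (1 - w) ^ (1 / 2 : ℂ)‖ := by
    have := norm_add₃_le (a := y - lam - kap * (1 - w) ^ (1 / 2 : ℂ)) (b := lam)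
      (c := kap * (1 - w) ^ (1 / 2 : ℂ))
    rwa [show y - lam - kap * (1 - w) ^ (1 / 2 : ℂ) + lam + kap * (1 - w) ^ (1 / 2 : ℂ) = y
      by ring] at this
  have h5 : C * ‖1 - w‖ ≤ C * b :=
    mul_le_mul_of_nonneg_left (h.trans (by nlinarith)) hC
  linarith

/-- Away from 1 the fan has room `c * σ`, so `f w` differs little from `f (t w)`, and `t w` lies in
the disk where the sharper bound `M₀` holds. -/
theorem exists_norm_le_away {c M M₀ A σ : ℝ} (hc : 0 < c) (hM : 0 ≤ M) (hA : M₀ < A)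
    (hσ : 0 < σ) :
    ∃ τ > 0, ∀ (f : ℂ → ℂ) (t : ℝ),
      DifferentiableOn ℂ f (fan c) → (∀ v ∈ fan c, ‖f v‖ ≤ M) → 1 - τ ≤ t → t < 1 →
      (∀ w : ℂ, ‖w‖ ≤ t → ‖f w‖ ≤ M₀) → ∀ w ∈ ball (0 : ℂ) 1, σ < ‖1 - w‖ → ‖f w‖ ≤ A := by
  have hcσ : 0 < c * σ := mul_pos hc hσ
  obtain ⟨τ, hτ0, hτ⟩ : ∃ τ > 0, τ ≤ 1 ∧ τ ≤ c * σ / 2 ∧ 2 * M * τ ≤ (A - M₀) * (c * σ) := by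
    have h1 : 0 < (A - M₀) * (c * σ) / (2 * M + 1) :=
      div_pos (mul_pos (by linarith) hcσ) (by linarith)
    refine ⟨min 1 (min (c * σ / 2) ((A - M₀) * (c * σ) / (2 * M + 1))),
      lt_min one_pos (lt_min (by linarith) h1), min_le_left _ _,
      (min_le_right _ _).trans (min_le_left _ _), ?_⟩
    have h2 := (le_div_iff₀ (by linarith)).1
      ((min_le_right 1 (min (c * σ / 2) ((A - M₀) * (c * σ) / (2 * M + 1)))).trans
        (min_le_right _ _))
    have h3 : 0 < min 1 (min (c * σ / 2) ((A - M₀) * (c * σ) / (2 * M + 1))) :=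
      lt_min one_pos (lt_min (by linarith) h1)
    linarith
  obtain ⟨hτ1, hτ2, hτ3⟩ := hτ
  refine ⟨τ, hτ0, fun f t hf hfM ht ht1 hft w hw h => ?_⟩
  have hw' := mem_ball_zero_iff.1 hw
  have ht0 : 0 ≤ t := by linarith
  have hd : ‖(t : ℂ) * w - w‖ ≤ τ := by
    have : (t : ℂ) * w - w = -((1 - t : ℝ) : ℂ) * w := by push_cast; ring
    rw [this, norm_mul, norm_neg, Complex.norm_real, Real.norm_of_nonneg (by linarith)]
    calc (1 - t) * ‖w‖ ≤ (1 - t) * 1 := mul_le_mul_of_nonneg_left hw'.le (by linarith)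
      _ ≤ τ := by linarith
  have hcs : c * σ < c * ‖1 - w‖ := mul_lt_mul_of_pos_left h hc
  have h1 := norm_sub_le_of_fan hc hf hfM hw (v := (t : ℂ) * w) (by linarith)
  have h2 : ‖f ((t : ℂ) * w)‖ ≤ M₀ := by
    refine hft _ ?_
    rw [norm_mul, Complex.norm_real, Real.norm_of_nonneg ht0]
    exact mul_le_of_le_one_right ht0 hw'.le
  have h3 : 2 * M / (c * ‖1 - w‖) * ‖(t : ℂ) * w - w‖ ≤ A - M₀ := by
    calc _ ≤ 2 * M / (c * σ) * τ := by gcongr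
      _ ≤ A - M₀ := by rwa [div_mul_eq_mul_div, div_le_iff₀ hcσ]
  have h4 : ‖f w‖ ≤ ‖f ((t : ℂ) * w)‖ + ‖f ((t : ℂ) * w) - f w‖ := by
    have := norm_sub_le (f ((t : ℂ) * w)) (f ((t : ℂ) * w) - f w)
    rwa [sub_sub_cancel] at this
  linarith

/-- A bound on a slightly smaller disk and at the singularity spreads to a fan. -/
theorem exists_fan_norm_le {c M C L₀ M₀ A : ℝ} (hc : 0 < c) (hM : 0 ≤ M) (hC : 0 ≤ C)
    (hA : max M₀ L₀ < A) :
    ∃ τ > 0, ∃ c' > 0, c' ≤ c ∧ ∀ (f : ℂ → ℂ) (lam kap : ℂ) (t : ℝ),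
      DifferentiableOn ℂ f (fan c) → (∀ v ∈ fan c, ‖f v‖ ≤ M) →
      (∀ v ∈ fan c, ‖f v - lam - kap * (1 - v) ^ (1 / 2 : ℂ)‖ ≤ C * ‖1 - v‖) →
      ‖kap‖ ≤ C → ‖lam‖ ≤ L₀ → 1 - τ ≤ t → t < 1 → (∀ w : ℂ, ‖w‖ ≤ t → ‖f w‖ ≤ M₀) →
      ∀ v ∈ fan c', ‖f v‖ ≤ A := by
  obtain ⟨A₀, hA₀1, hA₀⟩ := exists_between hA
  obtain ⟨hM₀', hL₀'⟩ := max_lt_iff.1 hA₀1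
  obtain ⟨σ, hσ0, hnear⟩ := exists_norm_le_near hC hL₀'
  obtain ⟨τ, hτ0, haway⟩ := exists_norm_le_away hc hM hM₀' hσ0
  obtain ⟨c', hc'0, hcc', hc'2⟩ : ∃ c' > 0, c' ≤ c ∧ 2 * M * c' ≤ (A - A₀) * c := by
    have h1 : 0 < (A - A₀) * c / (2 * M + 1) := div_pos (mul_pos (by linarith) hc) (by linarith)
    refine ⟨min c ((A - A₀) * c / (2 * M + 1)), lt_min hc h1, min_le_left _ _, ?_⟩
    have h2 := (le_div_iff₀ (by linarith)).1 (min_le_right c ((A - A₀) * c / (2 * M + 1)))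
    have h3 : 0 < min c ((A - A₀) * c / (2 * M + 1)) := lt_min hc h1
    linarith
  refine ⟨τ, hτ0, c', hc'0, hcc', ?_⟩
  intro f lam kap t hf hfM hexp hk hl ht ht1 hft
  rintro v ⟨w, hw, hvw⟩
  -- Near 1 the value is close to `lam`; elsewhere the bound on the smaller disk is transported
  -- outward. The margin from `A₀` to `A` is kept for leaving the disk.
  have hdisk : ‖f w‖ ≤ A₀ := by
    rcases le_or_gt ‖1 - w‖ σ with h | h
    · exact hnear _ lam kap w (hexp w (ball_subset_fan hc hw)) hk hl h
    · exact haway f t hf hfM ht ht1 hft w hw h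
  have hp := one_sub_ne_zero_of_mem_ball hw
  have h1 := norm_sub_le_of_fan hc hf hfM hw
    (hvw.trans_le (mul_le_mul_of_nonneg_right hcc' hp.le))
  have h2 : 2 * M / (c * ‖1 - w‖) * ‖v - w‖ ≤ A - A₀ := by
    calc _ ≤ 2 * M / (c * ‖1 - w‖) * (c' * ‖1 - w‖) := by gcongr
      _ = 2 * M * c' / c := by field_simp
      _ ≤ A - A₀ := by rwa [div_le_iff₀ hc]
  have h4 : ‖f v‖ ≤ ‖f v - f w‖ + ‖f w‖ := by simpa using norm_add_le (f v - f w) (f w)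
  linarith

/-- Second-order Taylor bound for the power. The factor `A ^ 2` on the left stands for `A ^ (p - 2)`
on the right, avoiding truncated subtraction. -/
theorem norm_pow_sub_linear_le {A : ℝ} {a b : ℂ} (ha : ‖a‖ ≤ A) (hb : ‖b‖ ≤ A) (p : ℕ) :
    ‖a ^ p - b ^ p - p * b ^ (p - 1) * (a - b)‖ * A ^ 2 ≤ (p : ℝ) ^ 2 * A ^ p * ‖a - b‖ ^ 2 := by
  have hA : 0 ≤ A := (norm_nonneg _).trans ha
  induction p with
  | zero => simp
  | succ p ih =>
    have e : a ^ (p + 1) - b ^ (p + 1) - ((p + 1 : ℕ) : ℂ) * b ^ (p + 1 - 1) * (a - b) =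
        a * (a ^ p - b ^ p - p * b ^ (p - 1) * (a - b)) + p * b ^ (p - 1) * (a - b) ^ 2 := by
      rcases p with _ | p
      · simp
      · simp only [Nat.add_sub_cancel]
        push_cast
        ring
    have h2 : ‖(p : ℂ) * b ^ (p - 1) * (a - b) ^ 2‖ * A ^ 2 ≤ p * A ^ (p + 1) * ‖a - b‖ ^ 2 := by
      rcases p with _ | p
      · simp
      · rw [norm_mul, norm_mul, norm_pow, norm_pow, Complex.norm_natCast, Nat.add_sub_cancel]
        calc ((p + 1 : ℕ) : ℝ) * ‖b‖ ^ p * ‖a - b‖ ^ 2 * A ^ 2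
            ≤ ((p + 1 : ℕ) : ℝ) * A ^ p * ‖a - b‖ ^ 2 * A ^ 2 := by gcongr
          _ = _ := by ring
    have h1 : ‖a * (a ^ p - b ^ p - p * b ^ (p - 1) * (a - b))‖ * A ^ 2 ≤
        A * ((p : ℝ) ^ 2 * A ^ p * ‖a - b‖ ^ 2) := by
      rw [norm_mul, mul_assoc]
      exact mul_le_mul ha ih (by positivity) hA
    rw [e]
    have h3 : 0 ≤ ((p : ℝ) + 1) * A ^ (p + 1) * ‖a - b‖ ^ 2 := by positivity
    calc _ ≤ (‖a * (a ^ p - b ^ p - p * b ^ (p - 1) * (a - b))‖ +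
          ‖(p : ℂ) * b ^ (p - 1) * (a - b) ^ 2‖) * A ^ 2 := by
          gcongr; exact norm_add_le _ _
      _ ≤ A * ((p : ℝ) ^ 2 * A ^ p * ‖a - b‖ ^ 2) + p * A ^ (p + 1) * ‖a - b‖ ^ 2 := by
          rw [add_mul]; exact add_le_add h1 h2
      _ ≤ _ := by
          push_cast
          have : ((p : ℝ) + 1) ^ 2 * A ^ (p + 1) * ‖a - b‖ ^ 2 =
            A * ((p : ℝ) ^ 2 * A ^ p * ‖a - b‖ ^ 2) + p * A ^ (p + 1) * ‖a - b‖ ^ 2 +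
              ((p : ℝ) + 1) * A ^ (p + 1) * ‖a - b‖ ^ 2 := by ring
          linarith

/-- Since `f - lam` is `O(|1 - v|^(1/2))`, the quadratic error is already `O(|1 - v|)`. The 9 is the
square of 3, from `√x ≤ 2` giving `C√x + Cx ≤ 3C√x`. -/
theorem norm_pow_expansion_le {f : ℂ → ℂ} {c C A : ℝ} {lam kap : ℂ} (hc : 0 < c) (hc1 : c ≤ 1 / 4)
    (hA : 0 < A) (hfA : ∀ v ∈ fan c, ‖f v‖ ≤ A)
    (hexp : ∀ v ∈ fan c, ‖f v - lam - kap * (1 - v) ^ (1 / 2 : ℂ)‖ ≤ C * ‖1 - v‖)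
    (hk : ‖kap‖ ≤ C) (hl : ‖lam‖ ≤ A) {p : ℕ} (hp : 1 ≤ p) {v : ℂ} (hv : v ∈ fan c) :
    ‖f v ^ p - lam ^ p - p * lam ^ (p - 1) * kap * (1 - v) ^ (1 / 2 : ℂ)‖ ≤
      (p : ℝ) ^ 2 * A ^ p * (9 * C ^ 2 / A ^ 2 + C / A) * ‖1 - v‖ := by
  obtain ⟨h1, -, h2⟩ := fan_bounds hc hc1 hv
  have hC : 0 ≤ C := (norm_nonneg _).trans hk
  set x := ‖1 - v‖ with hx
  have hx4 : x ≤ 4 := by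
    have := norm_sub_le (1 : ℂ) v
    rw [norm_one] at this
    linarith
  have hs : Real.sqrt x ≤ 2 := by
    rw [show (2 : ℝ) = Real.sqrt (2 ^ 2) by rw [Real.sqrt_sq (by norm_num)]]
    exact Real.sqrt_le_sqrt (by linarith)
  have hss : Real.sqrt x ^ 2 = x := Real.sq_sqrt h1.le
  have hs0 := Real.sqrt_nonneg x
  have hd : ‖f v - lam‖ ≤ 3 * C * Real.sqrt x := by
    have h3 := norm_add_le (f v - lam - kap * (1 - v) ^ (1 / 2 : ℂ)) (kap * (1 - v) ^ (1 / 2 : ℂ))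
    rw [sub_add_cancel] at h3
    have h4 : ‖kap * (1 - v) ^ (1 / 2 : ℂ)‖ ≤ C * Real.sqrt x := by
      rw [norm_mul, norm_cpow_half]
      gcongr
    have h5 : C * x ≤ C * (2 * Real.sqrt x) := by
      refine mul_le_mul_of_nonneg_left ?_ hC
      nlinarith
    linarith [hexp v hv]
  have hd2 : ‖f v - lam‖ ^ 2 ≤ 9 * C ^ 2 * x := by
    calc _ ≤ (3 * C * Real.sqrt x) ^ 2 := by gcongr
      _ = 9 * C ^ 2 * x := by rw [mul_pow, hss]; ring
  have hlin := norm_pow_sub_linear_le (hfA v hv) hl p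
  have e1 : ‖f v ^ p - lam ^ p - p * lam ^ (p - 1) * (f v - lam)‖ ≤
      (p : ℝ) ^ 2 * A ^ p * (9 * C ^ 2 / A ^ 2) * x := by
    have : (p : ℝ) ^ 2 * A ^ p * (9 * C ^ 2 / A ^ 2) * x =
        (p : ℝ) ^ 2 * A ^ p * (9 * C ^ 2 * x) / A ^ 2 := by ring
    rw [this, le_div_iff₀ (by positivity)]
    refine hlin.trans ?_
    gcongr
  have e2 : ‖(p : ℂ) * lam ^ (p - 1) * (f v - lam - kap * (1 - v) ^ (1 / 2 : ℂ))‖ ≤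
      (p : ℝ) ^ 2 * A ^ p * (C / A) * x := by
    rw [norm_mul, norm_mul, norm_pow, Complex.norm_natCast]
    have hp' : (1 : ℝ) ≤ p := by exact_mod_cast hp
    have hAp : A ^ (p - 1) = A ^ p / A := by
      rw [eq_div_iff hA.ne', ← pow_succ, Nat.sub_add_cancel hp]
    calc _ ≤ (p : ℝ) * A ^ (p - 1) * (C * x) := by
          gcongr
          exact hexp v hv
      _ ≤ (p : ℝ) ^ 2 * A ^ (p - 1) * (C * x) := by
          gcongr
          nlinarith
      _ = _ := by rw [hAp]; ring
  have e : f v ^ p - lam ^ p - p * lam ^ (p - 1) * kap * (1 - v) ^ (1 / 2 : ℂ) =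
      (f v ^ p - lam ^ p - p * lam ^ (p - 1) * (f v - lam)) +
      (p : ℂ) * lam ^ (p - 1) * (f v - lam - kap * (1 - v) ^ (1 / 2 : ℂ)) := by ring
  rw [e]
  refine (norm_add_le _ _).trans ?_
  rw [mul_add, add_mul]
  exact add_le_add e1 e2

/-- Coefficients of powers of a function with a square-root singularity at `1`, uniformly in the
function, the exponent and the index. -/
theorem exists_taylorCoeff_pow_asymptotic {c M C L₀ M₀ α : ℝ} (hc : 0 < c) (hc1 : c ≤ 1 / 4)
    (hM : 0 ≤ M) (hC : 0 ≤ C) (hL₀ : 0 ≤ L₀) (hα : max M₀ L₀ < α) :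
    ∃ τ > 0, ∃ A > 0, A < α ∧ ∃ K ≥ 0, ∀ (f : ℂ → ℂ) (lam kap : ℂ) (t : ℝ),
      DifferentiableOn ℂ f (fan c) → (∀ v ∈ fan c, ‖f v‖ ≤ M) →
      (∀ v ∈ fan c, ‖f v - lam - kap * (1 - v) ^ (1 / 2 : ℂ)‖ ≤ C * ‖1 - v‖) →
      ‖kap‖ ≤ C → ‖lam‖ ≤ L₀ → 1 - τ ≤ t → t < 1 → (∀ w : ℂ, ‖w‖ ≤ t → ‖f w‖ ≤ M₀) →
      ‖lam‖ ≤ A ∧ ∀ p m : ℕ, 1 ≤ p →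
        ‖taylorCoeff (fun w => f w ^ p) m + p * lam ^ (p - 1) * kap * sqrtAmp m‖ ≤
          K * ((p : ℝ) ^ 2 * A ^ p) / ((m : ℝ) + 1) ^ 2 := by
  -- The base `A` of the exponential growth in `p` must stay below `α`; the bound `M` on the whole
  -- fan need not.
  obtain ⟨A, hA1, hAα⟩ := exists_between hα
  obtain ⟨τ, hτ, c', hc', hcc', h⟩ := exists_fan_norm_le hc hM hC hA1
  obtain ⟨-, hLA⟩ := max_lt_iff.1 hA1
  have hA : 0 < A := hL₀.trans_lt hLA
  have hc'1 : c' ≤ 1 / 4 := hcc'.trans hc1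
  set K₁ := 9 * C ^ 2 / A ^ 2 + C / A with hK₁
  have hK₁0 : 0 ≤ K₁ := by positivity
  refine ⟨τ, hτ, A, hA, hAα, 2000 / c' ^ 3 * K₁ + 1 + 60 * C / A, by positivity, ?_⟩
  intro f lam kap t hf hfM hexp hk hl ht ht1 hft
  have hlA : ‖lam‖ ≤ A := hl.trans hLA.le
  refine ⟨hlA, fun p m hp => ?_⟩
  have hfA := h f lam kap t hf hfM hexp hk hl ht ht1 hft
  have hsub : fan c' ⊆ fan c := fan_mono hcc'
  set a : ℂ := p * lam ^ (p - 1) * kap with ha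
  set g : ℂ → ℂ := fun w => (1 - w) ^ (1 / 2 : ℂ) with hg
  set E : ℂ → ℂ := fun v => f v ^ p - lam ^ p - a * g v with hE
  have hEd : DifferentiableOn ℂ E (fan c') := by
    refine (((hf.mono hsub).fun_pow p).sub_const _).sub (DifferentiableOn.const_mul ?_ _)
    intro v hv
    exact (hasDerivAt_sqrt_one_sub
      (one_sub_mem_slitPlane hc' hc'1 hv)).differentiableAt.differentiableWithinAt
  have hEb : ∀ v ∈ fan c', ‖E v‖ ≤ (p : ℝ) ^ 2 * A ^ p * K₁ * ‖1 - v‖ := fun v hv =>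
    norm_pow_expansion_le hc' hc'1 hA hfA (fun v hv => hexp v (hsub hv)) hk hlA hp hv
  have h1 := norm_taylorCoeff_le_of_fan hc' (by linarith) hEd hEb m
  have h0 : ball (0 : ℂ) 1 ∈ 𝓝 (0 : ℂ) := ball_mem_nhds _ one_pos
  have hEa : AnalyticAt ℂ E 0 := (hEd.mono (ball_subset_fan hc')).analyticAt h0
  have hga : AnalyticAt ℂ g 0 := analyticAt_sqrt_one_sub
  have hag : AnalyticAt ℂ (fun v => a * g v) 0 := analyticAt_const.mul hga
  have h2 : taylorCoeff (fun w => f w ^ p) m =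
      taylorCoeff E m + ((if m = 0 then lam ^ p else 0) + a * taylorCoeff g m) := by
    have e : (fun w => f w ^ p) = fun w => E w + (lam ^ p + a * g w) := by
      funext w; simp only [hE]; ring
    have hla : AnalyticAt ℂ (fun v => lam ^ p + a * g v) 0 := analyticAt_const.add hag
    rw [e, taylorCoeff_add hEa hla, taylorCoeff_add analyticAt_const hag,
      taylorCoeff_const, taylorCoeff_const_mul hga]
  have hp' : (1 : ℝ) ≤ p := by exact_mod_cast hp
  have hpA : 0 ≤ (p : ℝ) ^ 2 * A ^ p := by positivity
  have hm : (0 : ℝ) < ((m : ℝ) + 1) ^ 2 := by positivity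
  -- The constant `lam ^ p` is seen only at `m = 0`; it accounts for the summand 1 in the constant.
  have h3 : ‖(if m = 0 then lam ^ p else 0 : ℂ)‖ ≤ 1 * ((p : ℝ) ^ 2 * A ^ p) / ((m : ℝ) + 1) ^ 2 := by
    split_ifs with h0
    · subst h0
      rw [norm_pow]
      have : ‖lam‖ ^ p ≤ A ^ p := by gcongr
      have h5 : A ^ p ≤ (p : ℝ) ^ 2 * A ^ p := le_mul_of_one_le_left (by positivity) (by nlinarith)
      simp
      linarith
    · rw [norm_zero]; positivity
  have ha' : ‖a‖ ≤ (p : ℝ) ^ 2 * A ^ p * (C / A) := by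
    have hAp : A ^ (p - 1) = A ^ p / A := by
      rw [eq_div_iff hA.ne', ← pow_succ, Nat.sub_add_cancel hp]
    rw [ha, norm_mul, norm_mul, norm_pow, Complex.norm_natCast]
    calc _ ≤ (p : ℝ) * A ^ (p - 1) * C := by gcongr
      _ ≤ (p : ℝ) ^ 2 * A ^ (p - 1) * C := by gcongr; nlinarith
      _ = _ := by rw [hAp]; ring
  have h4 : ‖a * (taylorCoeff g m + sqrtAmp m)‖ ≤
      (60 * C / A) * ((p : ℝ) ^ 2 * A ^ p) / ((m : ℝ) + 1) ^ 2 := by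
    rw [norm_mul]
    calc _ ≤ (p : ℝ) ^ 2 * A ^ p * (C / A) * (60 / ((m : ℝ) + 1) ^ 2) :=
          mul_le_mul ha' (norm_taylorCoeff_sqrt_add_le m) (norm_nonneg _) (by positivity)
      _ = _ := by ring
  have e : taylorCoeff (fun w => f w ^ p) m + a * sqrtAmp m = taylorCoeff E m +
      (if m = 0 then lam ^ p else 0) + a * (taylorCoeff g m + sqrtAmp m) := by rw [h2]; ring
  rw [e]
  refine (norm_add₃_le).trans ?_
  have h5 : 2000 / c' ^ 3 * ((p : ℝ) ^ 2 * A ^ p * K₁) / ((m : ℝ) + 1) ^ 2 =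
      2000 / c' ^ 3 * K₁ * ((p : ℝ) ^ 2 * A ^ p) / ((m : ℝ) + 1) ^ 2 := by ring
  rw [h5] at h1
  rw [add_mul, add_mul, add_div, add_div]
  exact add_le_add (add_le_add h1 h3) h4

/-! ## The logarithmic scale -/

theorem tsum_pow_div_succ {x : ℝ} (h0 : 0 < x) (h1 : x < 1) :
    ∑' n : ℕ, x ^ n / ((n : ℝ) + 1) = -Real.log (1 - x) / x := by
  have h := Real.hasSum_pow_div_log_of_abs_lt_one (x := x) (by rwa [abs_of_pos h0])
  have h2 := h.div_const x
  have h3 : ∀ n : ℕ, x ^ (n + 1) / ((n : ℝ) + 1) / x = x ^ n / ((n : ℝ) + 1) := fun n => by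
    rw [pow_succ]
    field_simp
  simp only [h3] at h2
  exact h2.tsum_eq

theorem logSeries_eq {z : ℂ} (hz : 1 < ‖z‖) :
    logSeries z = -Real.log (1 - (‖z‖ ^ 2)⁻¹) / (‖z‖ ^ 2)⁻¹ := by
  have h1 : (‖z‖ ^ 2)⁻¹ < 1 := inv_lt_one_of_one_lt₀ (one_lt_pow₀ hz two_ne_zero)
  rw [← tsum_pow_div_succ (by positivity) h1, logSeries]
  simp only [mul_one_div]

theorem tendsto_mul_log_zero {ι : Type*} {l : Filter ι} {x : ι → ℝ} (h : Tendsto x l (𝓝 0)) :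
    Tendsto (fun i => x i * Real.log (x i)) l (𝓝 0) := by
  simpa [Function.comp_def] using (Real.continuous_mul_log.tendsto 0).comp h

/-- Two logarithmic series with comparable gaps differ by a convergent quantity. -/
theorem tendsto_log_div_sub {ι : Type*} {l : Filter ι} {x y : ι → ℝ} {c : ℝ} (hc : 0 < c)
    (hx : ∀ᶠ i in l, 0 < x i ∧ x i < 1) (hy : ∀ᶠ i in l, 0 < y i ∧ y i < 1)
    (hx1 : Tendsto x l (𝓝 1)) (hy1 : Tendsto y l (𝓝 1))
    (hxy : Tendsto (fun i => (1 - x i) / (1 - y i)) l (𝓝 c)) :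
    Tendsto (fun i => -Real.log (1 - x i) / x i - -Real.log (1 - y i) / y i) l
      (𝓝 (-Real.log c)) := by
  -- `-log (1-u) / u` equals `-log (1-u)` minus this vanishing term, so only the logarithm of the
  -- ratio of gaps remains.
  have aux : ∀ {u : ι → ℝ}, Tendsto u l (𝓝 1) →
      Tendsto (fun i => (1 - u i) * Real.log (1 - u i) / u i) l (𝓝 0) := by
    intro u hu
    have h1 : Tendsto (fun i => 1 - u i) l (𝓝 0) := by simpa using hu.const_sub 1
    have h2 := (tendsto_mul_log_zero h1).div hu one_ne_zero
    rwa [zero_div] at h2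
  have hlog := (Real.continuousAt_log hc.ne').tendsto.comp hxy
  have h := (hlog.neg.sub (aux hx1)).add (aux hy1)
  rw [sub_zero, add_zero] at h
  refine h.congr' ?_
  filter_upwards [hx, hy] with i h1 h2
  have h3 : (1 - x i) ≠ 0 := by linarith [h1.2]
  have h4 : (1 - y i) ≠ 0 := by linarith [h2.2]
  have h5 := h1.1.ne'
  have h6 := h2.1.ne'
  simp only [Function.comp_apply]
  rw [Real.log_div h3 h4]
  field_simp
  ring

/-- The gap `‖z‖ - 1` is at most `‖z‖² - 1`, and `x log x → 0`. -/
theorem tendsto_norm_sub_one_mul_logSeries {l : Filter ℝ} {z : ℝ → ℂ}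
    (hz : ∀ᶠ ε in l, 1 < ‖z ε‖) (hz1 : Tendsto (fun ε => ‖z ε‖) l (𝓝 1)) :
    Tendsto (fun ε => (‖z ε‖ - 1) * logSeries (z ε)) l (𝓝 0) := by
  have hθ : Tendsto (fun ε => (‖z ε‖ ^ 2)⁻¹) l (𝓝 1) := by
    simpa using (hz1.pow 2).inv₀ (by norm_num)
  have h0 : Tendsto (fun ε => 1 - (‖z ε‖ ^ 2)⁻¹) l (𝓝 0) := by simpa using hθ.const_sub 1
  have h1 : Tendsto (fun ε => -((1 - (‖z ε‖ ^ 2)⁻¹) * Real.log (1 - (‖z ε‖ ^ 2)⁻¹)) /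
      ((‖z ε‖ ^ 2)⁻¹) ^ 2) l (𝓝 0) := by
    have h2 := (tendsto_mul_log_zero h0).neg.div (hθ.pow 2) (by norm_num)
    rwa [neg_zero, zero_div] at h2
  refine squeeze_zero' ?_ ?_ h1
  · filter_upwards [hz] with ε h
    exact mul_nonneg (by linarith) (tsum_nonneg fun j => by positivity)
  · filter_upwards [hz] with ε h
    have hl0 : 0 ≤ logSeries (z ε) := tsum_nonneg fun j => by positivity
    have hp : 0 < ‖z ε‖ := zero_lt_one.trans h
    have h2 : ‖z ε‖ - 1 ≤ (1 - (‖z ε‖ ^ 2)⁻¹) / (‖z ε‖ ^ 2)⁻¹ := by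
      have : (1 - (‖z ε‖ ^ 2)⁻¹) / (‖z ε‖ ^ 2)⁻¹ = ‖z ε‖ ^ 2 - 1 := by field_simp
      rw [this]
      nlinarith
    refine (mul_le_mul_of_nonneg_right h2 hl0).trans_eq ?_
    rw [logSeries_eq h]
    field_simp

/-- First-order expansion at `ε = 0`: the gaps are `3sε` and `2sε`, the midpoint radius contributing
the extra half. -/
theorem tendsto_gap_ratio {s : ℕ} (hs : 1 ≤ s) :
    Tendsto (fun ε : ℝ => (1 - (((1 + ε / 2) * (1 + ε)) ^ (2 * s))⁻¹) / (1 - ((1 + ε) ^ (2 * s))⁻¹))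
      (𝓝[>] 0) (𝓝 (3 / 2)) := by
  have hs' : (s : ℝ) ≠ 0 := by exact_mod_cast (by omega : s ≠ 0)
  have hP : HasDerivAt (fun ε : ℝ => ((1 + ε / 2) * (1 + ε)) ^ (2 * s)) (3 * s) 0 := by
    have h1 : HasDerivAt (fun ε : ℝ => (1 + ε / 2) * (1 + ε)) (3 / 2) 0 := by
      have := (((hasDerivAt_id (0 : ℝ)).div_const 2).const_add 1).mul
        ((hasDerivAt_id (0 : ℝ)).const_add 1)
      refine (this.congr_deriv ?_)
      norm_num
    refine (h1.fun_pow (2 * s)).congr_deriv ?_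
    push_cast
    norm_num
    ring
  have hQ : HasDerivAt (fun ε : ℝ => (1 + ε) ^ (2 * s)) (2 * s) 0 := by
    refine (((hasDerivAt_id (0 : ℝ)).const_add 1).fun_pow (2 * s)).congr_deriv ?_
    push_cast
    norm_num
  have h1 := hP.tendsto_slope_zero_right
  have h2 := hQ.tendsto_slope_zero_right
  have h3 := (hQ.continuousAt.tendsto.mono_left nhdsWithin_le_nhds).div
    (hP.continuousAt.tendsto.mono_left (nhdsWithin_le_nhds (s := Ioi 0))) (by norm_num)
  have h4 := (h1.div h2 (by simpa using hs')).mul h3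
  have e : 3 * (s : ℝ) / (2 * s) * ((1 + 0) ^ (2 * s) / ((1 + 0 / 2) * (1 + 0)) ^ (2 * s)) = 3 / 2 := by
    norm_num
    field_simp
  rw [e] at h4
  refine h4.congr' ?_
  filter_upwards [self_mem_nhdsWithin] with ε hε
  have hε : 0 < ε := hε
  have h5 : 1 < (1 + ε) ^ (2 * s) := one_lt_pow₀ (by linarith) (by omega)
  have h6 : 0 < ((1 + ε / 2) * (1 + ε)) ^ (2 * s) := by positivity
  simp only [Pi.div_apply, zero_add, smul_eq_mul]
  generalize ((1 + ε / 2) * (1 + ε)) ^ (2 * s) = P at *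
  generalize (1 + ε) ^ (2 * s) = Q at *
  have h7 : Q - 1 ≠ 0 := by linarith
  have h8 : 1 - Q⁻¹ ≠ 0 := by
    have := inv_lt_one_of_one_lt₀ h5
    linarith
  have h9 : Q ≠ 0 := by linarith
  norm_num
  field_simp

theorem logScale_eq {N : ℕ} {e : Fin N → ℕ} {ζ : Fin N → ℂ} {ε : ℝ} (hs : 1 ≤ symIndex e)
    (hε : 0 < ε) (hr : (radius e ζ).toReal = 1 + ε) :
    logScale e ζ = -Real.log (1 - (((1 + ε / 2) * (1 + ε)) ^ (2 * symIndex e))⁻¹) /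
      (((1 + ε / 2) * (1 + ε)) ^ (2 * symIndex e))⁻¹ := by
  have h1 : 1 < ((1 + ε / 2) * (1 + ε)) ^ (2 * symIndex e) :=
    one_lt_pow₀ (by nlinarith) (by omega)
  rw [← tsum_pow_div_succ (by positivity) (inv_lt_one_of_one_lt₀ h1), logScale, midRadius, hr]
  have : (1 + (1 + ε)) / 2 * (1 + ε) = (1 + ε / 2) * (1 + ε) := by ring
  rw [this]

theorem tendsto_logScale_sub_logSeries {N : ℕ} {e : Fin N → ℕ} {ζ : ℝ → Fin N → ℂ} {z : ℝ → ℂ}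
    (hs : 1 ≤ symIndex e) (hr : ∀ᶠ ε in 𝓝[>] (0 : ℝ), (radius e (ζ ε)).toReal = 1 + ε)
    (hz : ∀ᶠ ε in 𝓝[>] (0 : ℝ), ‖z ε‖ = (1 + ε) ^ symIndex e) :
    Tendsto (fun ε => logScale e (ζ ε) - logSeries (z ε)) (𝓝[>] 0) (𝓝 (-Real.log (3 / 2))) := by
  have hid : Tendsto (fun ε : ℝ => ε) (𝓝[>] 0) (𝓝 0) := nhdsWithin_le_nhds
  have h1 : Tendsto (fun ε : ℝ => (((1 + ε / 2) * (1 + ε)) ^ (2 * symIndex e))⁻¹) (𝓝[>] 0) (𝓝 1) := by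
    have := ((((hid.div_const 2).const_add 1).mul (hid.const_add 1)).pow (2 * symIndex e)).inv₀
      (by norm_num)
    simpa using this
  have h2 : Tendsto (fun ε : ℝ => ((1 + ε) ^ (2 * symIndex e))⁻¹) (𝓝[>] 0) (𝓝 1) := by
    have := ((hid.const_add 1).pow (2 * symIndex e)).inv₀ (by norm_num)
    simpa using this
  have h := tendsto_log_div_sub (by norm_num : (0 : ℝ) < 3 / 2) ?_ ?_ h1 h2 (tendsto_gap_ratio hs)
  · refine h.congr' ?_
    filter_upwards [hr, hz, self_mem_nhdsWithin] with ε h3 h4 h5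
    have h5 : 0 < ε := h5
    have h6 : 1 < ‖z ε‖ := by rw [h4]; exact one_lt_pow₀ (by linarith) (by omega)
    rw [logScale_eq hs h5 h3, logSeries_eq h6, h4, ← pow_mul, mul_comm (symIndex e) 2]
  · filter_upwards [self_mem_nhdsWithin] with ε h5
    have h5 : 0 < ε := h5
    exact ⟨by positivity, inv_lt_one_of_one_lt₀ (one_lt_pow₀ (by nlinarith) (by omega))⟩
  · filter_upwards [self_mem_nhdsWithin] with ε h5
    have h5 : 0 < ε := h5
    exact ⟨by positivity, inv_lt_one_of_one_lt₀ (one_lt_pow₀ (by linarith) (by omega))⟩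

/-! ## Coefficients of powers of the Taylor branch along the path -/

/-- For `v` in the fan, `cos (arg (v - 1)) < 2c ≤ cos φ` gives the angle condition, and `2c * ‖ξ‖ ≤
4c ≤ h` the radius condition; one `c` serves all `ξ` in the annulus. -/
theorem exists_fan_mapsTo_indentedDisk {φ h : ℝ} (hφ : φ ∈ Ioo 0 (Real.pi / 2)) (hh : 0 < h) :
    ∃ c > 0, c ≤ 1 / 4 ∧ ∀ ξ : ℂ, 1 ≤ ‖ξ‖ → ‖ξ‖ ≤ 2 → ∀ v ∈ fan c, ξ * v ∈ indentedDisk ξ φ h := by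
  have hcos : 0 < Real.cos φ := Real.cos_pos_of_mem_Ioo ⟨by linarith [hφ.1, hφ.2], hφ.2⟩
  refine ⟨min (1 / 4) (min (h / 4) (Real.cos φ / 2)),
    lt_min (by norm_num) (lt_min (by positivity) (by positivity)), min_le_left _ _, ?_⟩
  set c := min (1 / 4) (min (h / 4) (Real.cos φ / 2)) with hc
  have hc0 : 0 < c := lt_min (by norm_num) (lt_min (by positivity) (by positivity))
  have hc2 : c ≤ h / 4 := (min_le_right _ _).trans (min_le_left _ _)
  have hc3 : c ≤ Real.cos φ / 2 := (min_le_right _ _).trans (min_le_right _ _)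
  intro ξ h1 h2 v hv
  obtain ⟨hv1, hv2, hv3⟩ := fan_bounds hc0 (min_le_left _ _) hv
  have hξ : ξ ≠ 0 := norm_pos_iff.1 (by linarith)
  have hv0 : v - 1 ≠ 0 := by
    rw [← norm_pos_iff, norm_sub_rev]; exact hv1
  refine ⟨?_, ?_, ?_⟩
  · rw [norm_mul]
    nlinarith
  · intro h
    exact hv0 (sub_eq_zero.2 (mul_left_cancel₀ hξ (h.trans (mul_one ξ).symm)))
  · rw [mul_div_cancel_left₀ v hξ]
    by_contra! hle
    have h3 := Real.cos_le_cos_of_nonneg_of_le_pi (abs_nonneg (Complex.arg (v - 1)))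
      (by linarith [hφ.2, Real.pi_pos]) hle
    rw [Real.cos_abs, Complex.cos_arg hv0, norm_sub_rev, le_div_iff₀ hv1] at h3
    nlinarith

theorem isBounded_indentedDisk (ξ : ℂ) (φ h : ℝ) : Bornology.IsBounded (indentedDisk ξ φ h) :=
  isBounded_ball.subset (t := ball 0 (‖ξ‖ + h)) fun z hz => by simpa using hz.1

theorem norm_cpow_three_half (x : ℂ) : ‖x ^ (3 / 2 : ℂ)‖ = ‖x‖ * Real.sqrt ‖x‖ := by
  have h := Complex.norm_cpow_real x (3 / 2)
  rw [show (3 / 2 : ℂ) = ((3 / 2 : ℝ) : ℂ) by push_cast; rfl, h, Real.sqrt_eq_rpow]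
  rcases (norm_nonneg x).eq_or_lt with h0 | h0
  · rw [← h0, Real.zero_rpow (by norm_num), zero_mul]
  · nth_rewrite 2 [← Real.rpow_one ‖x‖]
    rw [← Real.rpow_add h0]
    norm_num

/-- A Puiseux expansion near the singularity and global boundedness give a global square-root
expansion. -/
theorem norm_sub_sqrt_le {y lam kap c d v : ℂ} {M C₀ η₀ : ℝ} (hη : 0 < η₀) (hC₀ : 0 ≤ C₀)
    (hM : 0 ≤ M) (hv : ‖1 - v‖ ≤ 4) (hy : ‖y‖ ≤ M) (hlam : ‖lam‖ ≤ C₀) (hkap : ‖kap‖ ≤ C₀)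
    (hc : ‖c‖ ≤ C₀) (hd : ‖d‖ ≤ C₀)
    (h : ‖1 - v‖ < η₀ → ‖y - (lam + kap * (1 - v) ^ (1 / 2 : ℂ) + c * (1 - v) +
      d * (1 - v) ^ (3 / 2 : ℂ))‖ ≤ C₀ * ‖1 - v‖ ^ 2) :
    ‖y - lam - kap * (1 - v) ^ (1 / 2 : ℂ)‖ ≤ (7 * C₀ + (M + 3 * C₀) / η₀) * ‖1 - v‖ := by
  set x := ‖1 - v‖ with hx
  have hx0 : 0 ≤ x := norm_nonneg _
  have hs : Real.sqrt x ≤ 2 := by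
    rw [show (2 : ℝ) = Real.sqrt (2 ^ 2) by rw [Real.sqrt_sq (by norm_num)]]
    exact Real.sqrt_le_sqrt (by linarith)
  have hk : ‖kap * (1 - v) ^ (1 / 2 : ℂ)‖ ≤ C₀ * 2 := by
    rw [norm_mul, norm_cpow_half]
    exact mul_le_mul hkap hs (Real.sqrt_nonneg _) hC₀
  have hq : 0 ≤ (M + 3 * C₀) / η₀ := by positivity
  -- Near the singularity `x² ≤ 4x` and `√x ≤ 2` give the constant `4 + 1 + 2 = 7`; farther out
  -- every term is bounded and `x / η₀ ≥ 1`.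
  rcases lt_or_ge x η₀ with hlt | hge
  · have e : y - lam - kap * (1 - v) ^ (1 / 2 : ℂ) =
        (y - (lam + kap * (1 - v) ^ (1 / 2 : ℂ) + c * (1 - v) + d * (1 - v) ^ (3 / 2 : ℂ))) +
        c * (1 - v) + d * (1 - v) ^ (3 / 2 : ℂ) := by ring
    have h1 : ‖c * (1 - v)‖ ≤ C₀ * x := by
      rw [norm_mul]; exact mul_le_mul_of_nonneg_right hc hx0
    have h2 : ‖d * (1 - v) ^ (3 / 2 : ℂ)‖ ≤ C₀ * (x * 2) := by
      rw [norm_mul, norm_cpow_three_half]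
      exact mul_le_mul hd (mul_le_mul_of_nonneg_left hs hx0) (by positivity) hC₀
    have h3 : C₀ * x ^ 2 ≤ C₀ * (4 * x) := mul_le_mul_of_nonneg_left (by nlinarith) hC₀
    rw [e]
    refine (norm_add₃_le).trans ?_
    have := h hlt
    nlinarith [mul_nonneg hq hx0]
  · have h1 : ‖y - lam - kap * (1 - v) ^ (1 / 2 : ℂ)‖ ≤ M + C₀ + C₀ * 2 := by
      refine (norm_sub_le _ _).trans (add_le_add ((norm_sub_le _ _).trans ?_) hk)
      exact add_le_add hy hlam
    have h2 : M + 3 * C₀ ≤ (M + 3 * C₀) / η₀ * x := by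
      rw [div_mul_eq_mul_div, le_div_iff₀ hη]
      exact mul_le_mul_of_nonneg_left hge (by positivity)
    nlinarith [mul_nonneg hC₀ hx0]

/-- Coefficients of powers of the branch are those of the rescaled sheet in the variable `x ^ s`. -/
theorem powCoeff_mul_pow_eq {N : ℕ} {e : Fin N → ℕ} {ζ : Fin N → ℂ} {F : ℂ → ℂ} {ξ : ℂ}
    (hs : 0 < symIndex e) (hξ : ξ ≠ 0) (hF : AnalyticAt ℂ (fun w => F (ξ * w)) 0)
    (hU : ∀ᶠ x in 𝓝 (0 : ℂ), F (x ^ symIndex e) = taylorBranch e ζ x) (p m : ℕ) :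
    powCoeff e ζ p m * ξ ^ m = taylorCoeff (fun w => F (ξ * w) ^ p) m := by
  have hFa : AnalyticAt ℂ F 0 := by
    have h1 : AnalyticAt ℂ (fun z : ℂ => ξ⁻¹ * z) 0 := analyticAt_const.mul analyticAt_id
    have h2 := AnalyticAt.fun_comp (g := fun w => F (ξ * w)) (f := fun z : ℂ => ξ⁻¹ * z) (x := 0)
      (by simpa using hF) h1
    simpa [mul_inv_cancel_left₀ hξ] using h2
  have h1 : powCoeff e ζ p m = taylorCoeff (fun x => taylorBranch e ζ x ^ p) (m * symIndex e) := rfl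
  have h2 : (fun x => taylorBranch e ζ x ^ p) =ᶠ[𝓝 0] fun x => F (x ^ symIndex e) ^ p := by
    filter_upwards [hU] with x hx
    rw [hx]
  rw [h1, taylorCoeff_congr h2, taylorCoeff_comp_pow (f := fun z => F z ^ p) (hFa.fun_pow p) hs,
    ← taylorCoeff_comp_mul (f := fun z => F z ^ p) (hFa.fun_pow p)]

/-- The bound on the midpoint circle controls the sheet inside. -/
theorem norm_sheet_le_of_branch {N : ℕ} {e : Fin N → ℕ} {ζ : Fin N → ℂ} {F V : ℂ → ℂ} {ξ : ℂ}
    {r r' M₀ : ℝ} (hs : 0 < symIndex e) (hr : 0 < r) (hrr : r < r') (hξ : ‖ξ‖ = r' ^ symIndex e)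
    (hF : DifferentiableOn ℂ (fun w => F (ξ * w)) (ball 0 1))
    (hU : ∀ᶠ x in 𝓝 (0 : ℂ), F (x ^ symIndex e) = taylorBranch e ζ x)
    (hV : IsBranchOn e ζ (ball 0 r') V) (hM : ∀ x : ℂ, ‖x‖ = r → ‖V x‖ ≤ M₀) {w : ℂ}
    (hw : ‖w‖ ≤ (r / r') ^ symIndex e) : ‖F (ξ * w)‖ ≤ M₀ := by
  have hr' : 0 < r' := hr.trans hrr
  have hξ0 : ξ ≠ 0 := norm_pos_iff.1 (by rw [hξ]; positivity)
  have hmaps : MapsTo (fun x : ℂ => ξ⁻¹ * x ^ symIndex e) (ball 0 r') (ball 0 1) := by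
    intro x hx
    rw [mem_ball_zero_iff] at hx ⊢
    rw [norm_mul, norm_inv, norm_pow, hξ, inv_mul_lt_iff₀ (by positivity), mul_one]
    exact pow_lt_pow_left₀ hx (norm_nonneg _) hs.ne'
  have hG : DifferentiableOn ℂ (fun x : ℂ => F (x ^ symIndex e)) (ball 0 r') := by
    have hd : DifferentiableOn ℂ (fun x : ℂ => ξ⁻¹ * x ^ symIndex e) (ball 0 r') := by fun_prop
    have := hF.comp hd hmaps
    simpa [Function.comp_def, mul_inv_cancel_left₀ hξ0] using this
  -- Identity theorem: both sides continue the germ at 0 over the disk of radius `r'`.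
  have heq : EqOn V (fun x : ℂ => F (x ^ symIndex e)) (ball 0 r') := by
    refine (hV.1.analyticOnNhd isOpen_ball).eqOn_of_preconnected_of_eventuallyEq
      (hG.analyticOnNhd isOpen_ball) (convex_ball _ _).isPreconnected (mem_ball_self hr') ?_
    filter_upwards [hV.2, hU] with x h1 h2
    rw [h1, h2]
  obtain ⟨x, hx⟩ := IsAlgClosed.exists_pow_nat_eq (ξ * w) hs
  have hxr : ‖x‖ ≤ r := by
    refine le_of_pow_le_pow_left₀ hs.ne' hr.le ?_
    rw [← norm_pow, hx, norm_mul, hξ]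
    calc r' ^ symIndex e * ‖w‖ ≤ r' ^ symIndex e * (r / r') ^ symIndex e := by gcongr
      _ = r ^ symIndex e := by rw [← mul_pow, mul_div_cancel₀ _ hr'.ne']
  have hsub : closedBall (0 : ℂ) r ⊆ ball 0 r' := closedBall_subset_ball hrr
  have h1 := Complex.norm_le_of_forall_mem_frontier_norm_le (f := V) (U := ball (0 : ℂ) r) (C := M₀)
    isBounded_ball ((hV.1.mono (closure_ball_subset_closedBall.trans hsub)).diffContOnCl)
    (fun z hz => by
      rw [frontier_ball _ hr.ne'] at hz
      exact hM z (by simpa using hz)) (z := x)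
    (by rw [closure_ball _ hr.ne']; simpa using hxr)
  have h2 := heq (hsub (by simpa using hxr))
  simp only [hx] at h2
  rwa [← h2]

/-- After rescaling by `ξ = x_*^s` the singularity sits at 1 for every `ε`, so the uniform transfer
applies to a single fan. -/
theorem exists_powCoeff_asymptotic {N : ℕ} {e : Fin N → ℕ} {ζ : ℝ → Fin N → ℂ}
    {xs lam kap : ℝ → ℂ} {α : ℝ} (h : StandingHypotheses e ζ xs lam kap)
    (hα : AdmissibleWeight e ζ lam α) (hs : 1 ≤ symIndex e) :
    ∃ A > 0, A < α ∧ ∃ K ≥ 0, ∃ c₀ > 0, ∀ᶠ ε in 𝓝[>] (0 : ℝ),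
      (radius e (ζ ε)).toReal = 1 + ε ∧ ‖xs ε ^ symIndex e‖ = (1 + ε) ^ symIndex e ∧
      c₀ ≤ ‖lam ε‖ ∧ ‖lam ε‖ ≤ A ∧ c₀ ≤ ‖kap ε‖ ∧ ‖kap ε‖ ≤ K ∧
      ∀ p m : ℕ, 1 ≤ p → ‖powCoeff e (ζ ε) p m * (xs ε ^ symIndex e) ^ m -
        amplitude e (lam ε) (kap ε) p * ((Real.sqrt ((m : ℝ) + 1))⁻¹ / ((m : ℝ) + 1) : ℝ)‖ ≤
          K * ((p : ℝ) ^ 2 * A ^ p) / ((m : ℝ) + 1) ^ 2 := by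
  obtain ⟨ε₀, hε₀, φ, hφ, η₀, hη₀, C₀, hC₀, c₀, hc₀, M, Uh, c, d, hU⟩ := h.uniform
  obtain ⟨M₀, L₀, hML, hev⟩ := hα
  obtain ⟨r, hr, hr1, hfan⟩ := exists_fan_mapsTo_indentedDisk hφ (half_pos hη₀)
  have hL₀ : 0 ≤ L₀ := by
    obtain ⟨ε, h1⟩ := hev.exists
    exact (norm_nonneg _).trans h1.2
  set M' := max M 0 with hM'
  have hM'0 : 0 ≤ M' := le_max_right _ _
  set C₁ := 7 * C₀ + (M' + 3 * C₀) / η₀ with hC₁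
  have hq : 0 ≤ (M' + 3 * C₀) / η₀ := by positivity
  obtain ⟨τ, hτ, A, hA, hAα, K, hK, hmain⟩ :=
    exists_taylorCoeff_pow_asymptotic hr hr1 hM'0 (by positivity : 0 ≤ C₁) hL₀ hML
  refine ⟨A, hA, hAα, K + C₀, by positivity, c₀, hc₀, ?_⟩
  have hid : Tendsto (fun ε : ℝ => ε) (𝓝[>] 0) (𝓝 0) := nhdsWithin_le_nhds
  -- In the rescaled variable `w` the midpoint circle has this radius, which tends to 1.
  have ht : ∀ᶠ ε in 𝓝[>] (0 : ℝ), 1 - τ ≤ ((1 + ε / 2) / (1 + ε)) ^ symIndex e := by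
    have h1 := ((((hid.div_const 2).const_add 1).div (hid.const_add 1) (by norm_num)).pow
      (symIndex e))
    refine h1.eventually_const_le ?_
    norm_num
    exact hτ
  have h2 : ∀ᶠ ε in 𝓝[>] (0 : ℝ), (1 + ε) ^ symIndex e ≤ 2 := by
    have h1 := (hid.const_add 1).pow (symIndex e)
    exact h1.eventually_le_const (by norm_num)
  filter_upwards [hev, h.param, h.dominant, ht, h2, Ioo_mem_nhdsGT hε₀]
    with ε h1 hpar hdom ht h2 hε
  have hε0 : 0 < ε := hε.1
  obtain ⟨⟨V, hV, hVM⟩, hlL⟩ := h1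
  obtain ⟨hD, hgerm, hfr, hlc, hkc, hsum, hpui⟩ := hU ε hε
  have hrad : (radius e (ζ ε)).toReal = 1 + ε := by
    rw [hpar, ENNReal.toReal_ofReal (by linarith)]
  have hxs : ‖xs ε‖ = 1 + ε := by
    have := hdom.dominant.radius_eq
    rw [← ENNReal.toReal_ofReal (norm_nonneg (xs ε)), ← this, hrad]
  set ξ := xs ε ^ symIndex e with hξ
  have hξn : ‖ξ‖ = (1 + ε) ^ symIndex e := by rw [hξ, norm_pow, hxs]
  have hξ1 : 1 ≤ ‖ξ‖ := by rw [hξn]; exact one_le_pow₀ (by linarith)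
  have hξ2 : ‖ξ‖ ≤ 2 := by rwa [hξn]
  have hξ0 : ξ ≠ 0 := norm_pos_iff.1 (by linarith)
  have hn1 := norm_nonneg (lam ε)
  have hn2 := norm_nonneg (kap ε)
  have hn3 := norm_nonneg (c ε)
  have hn4 := norm_nonneg (d ε)
  have hmaps := hfan ξ hξ1 hξ2
  set f : ℂ → ℂ := fun w => Uh ε (ξ * w) with hf
  have hfd : DifferentiableOn ℂ f (fan r) :=
    hD.differentiableOn.comp (differentiableOn_id.const_mul ξ) hmaps
  -- Maximum principle on the bounded domain `Ω`.
  have hfM : ∀ v ∈ fan r, ‖f v‖ ≤ M' := fun v hv =>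
    (Complex.norm_le_of_forall_mem_frontier_norm_le (isBounded_indentedDisk _ _ _) hD hfr
      (subset_closure (hmaps v hv))).trans (le_max_left _ _)
  have hsq : (Real.sqrt (symIndex e))⁻¹ ≤ 1 :=
    inv_le_one_of_one_le₀ (Real.one_le_sqrt.2 (by exact_mod_cast hs))
  set kap' : ℂ := ((Real.sqrt (symIndex e))⁻¹ : ℝ) * kap ε with hkap'
  have hk' : ‖kap'‖ ≤ C₀ := by
    rw [hkap', norm_mul, Complex.norm_real, Real.norm_of_nonneg (by positivity)]
    exact (mul_le_of_le_one_left hn2 hsq).trans (by linarith)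
  have hexp : ∀ v ∈ fan r, ‖f v - lam ε - kap' * (1 - v) ^ (1 / 2 : ℂ)‖ ≤ C₁ * ‖1 - v‖ := by
    intro v hv
    have hb := fan_bounds hr hr1 hv
    have hv4 : ‖1 - v‖ ≤ 4 := by
      have := norm_sub_le (1 : ℂ) v
      rw [norm_one] at this
      linarith
    refine norm_sub_sqrt_le (c := c ε) (d := d ε) hη₀ hC₀.le hM'0 hv4 (hfM v hv) (by linarith) hk'
      (by linarith) (by linarith) fun hlt => ?_
    have := hpui (ξ * v) (hmaps v hv)
    rw [mul_div_cancel_left₀ v hξ0] at this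
    exact this hlt
  have hball : DifferentiableOn ℂ f (ball 0 1) := hfd.mono (ball_subset_fan hr)
  have hmid : midRadius e (ζ ε) = 1 + ε / 2 := by rw [midRadius, hrad]; ring
  have hM₀ : ∀ w : ℂ, ‖w‖ ≤ ((1 + ε / 2) / (1 + ε)) ^ symIndex e → ‖f w‖ ≤ M₀ := fun w hw =>
    norm_sheet_le_of_branch (F := Uh ε) (r := 1 + ε / 2) (r' := 1 + ε) hs (by linarith)
      (by linarith) hξn hball hgerm (by rwa [hrad] at hV) (fun x hx => hVM x (by rw [hx, hmid])) hw
  have ht1 : ((1 + ε / 2) / (1 + ε)) ^ symIndex e < 1 :=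
    pow_lt_one₀ (by positivity) (by rw [div_lt_one (by linarith)]; linarith) (by omega)
  have hC₀₁ : C₀ ≤ C₁ := by linarith
  obtain ⟨hlA, hasym⟩ := hmain f (lam ε) kap' _ hfd hfM hexp (hk'.trans hC₀₁) hlL ht ht1 hM₀
  refine ⟨hrad, hξn, hlc, hlA, hkc, by linarith, fun p m hp => ?_⟩
  rw [powCoeff_mul_pow_eq hs hξ0 (hball.analyticAt (ball_mem_nhds _ one_pos)) hgerm]
  have e1 : amplitude e (lam ε) (kap ε) p *
      ((Real.sqrt ((m : ℝ) + 1))⁻¹ / ((m : ℝ) + 1) : ℝ) =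
      -(p * lam ε ^ (p - 1) * kap' * sqrtAmp m) := by
    rw [amplitude, hkap', sqrtAmp]
    push_cast
    ring
  rw [e1, sub_neg_eq_add]
  refine (hasym p m hp).trans ?_
  gcongr
  linarith

/-! ## The weighted columns -/

theorem inv_sqrt_sub_inv_sqrt_le (m k : ℕ) :
    |(Real.sqrt ((m : ℝ) + 1))⁻¹ - (Real.sqrt (((k + m : ℕ) : ℝ) + 1))⁻¹| ≤
      k / (((k + m : ℕ) : ℝ) + 1) := by
  have hm : (0 : ℝ) ≤ m := Nat.cast_nonneg m
  have hk : (0 : ℝ) ≤ k := Nat.cast_nonneg k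
  set a := Real.sqrt ((m : ℝ) + 1) with ha
  set b := Real.sqrt (((k + m : ℕ) : ℝ) + 1) with hb
  have ha1 : 1 ≤ a := Real.one_le_sqrt.2 (by linarith)
  have hab : a ≤ b := Real.sqrt_le_sqrt (by push_cast; linarith)
  have ha2 : a ^ 2 = (m : ℝ) + 1 := Real.sq_sqrt (by positivity)
  have hb2 : b ^ 2 = ((k + m : ℕ) : ℝ) + 1 := Real.sq_sqrt (by positivity)
  have hkab : (k : ℝ) = b ^ 2 - a ^ 2 := by rw [ha2, hb2]; push_cast; ring
  have ha0 : 0 < a := by linarith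
  have hb0 : 0 < b := by linarith
  rw [abs_of_nonneg (sub_nonneg.2 (inv_anti₀ ha0 hab)), ← hb2, hkab,
    inv_sub_inv ha0.ne' hb0.ne', div_le_div_iff₀ (by positivity) (by positivity)]
  have h1 : b ≤ a * (a + b) := by nlinarith
  nlinarith [mul_le_mul_of_nonneg_left h1 (mul_nonneg (sub_nonneg.2 hab) hb0.le)]

/-- Split `P + m s = (P - s) + s (m + 1)`: the second part is the leading term with `m` in place of
`k + m`. The index shift is absorbed through `k + m + 1 ≤ P (m + 1)`. -/
theorem abs_shifted_sub_le {P s : ℝ} {k m : ℕ} (hs : 1 ≤ s) (hP : (k : ℝ) + 1 ≤ P) :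
    |(P + m * s) * ((Real.sqrt ((m : ℝ) + 1))⁻¹ / ((m : ℝ) + 1)) -
      s * (Real.sqrt (((k + m : ℕ) : ℝ) + 1))⁻¹| ≤ 3 * s * P ^ 2 / (((k + m : ℕ) : ℝ) + 1) := by
  have hm : (0 : ℝ) ≤ m := Nat.cast_nonneg m
  have hk : (0 : ℝ) ≤ k := Nat.cast_nonneg k
  have h1 := inv_sqrt_sub_inv_sqrt_le m k
  have h2 := inv_sqrt_succ_le_one m
  set a := (Real.sqrt ((m : ℝ) + 1))⁻¹ with ha
  set b := (Real.sqrt (((k + m : ℕ) : ℝ) + 1))⁻¹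
  have ha0 : 0 ≤ a := by positivity
  have hn : (0 : ℝ) < ((k + m : ℕ) : ℝ) + 1 := by positivity
  have e : (P + m * s) * (a / ((m : ℝ) + 1)) - s * b =
      (P - s) * (a / ((m : ℝ) + 1)) + s * (a - b) := by
    field_simp
    ring
  have h3 : a / ((m : ℝ) + 1) ≤ P / (((k + m : ℕ) : ℝ) + 1) := by
    rw [div_le_div_iff₀ (by positivity) hn]
    push_cast
    have : (k : ℝ) + m + 1 ≤ P * (m + 1) := by nlinarith
    nlinarith
  have h4 : |P - s| ≤ P * s := by
    rw [abs_le]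
    constructor <;> nlinarith
  rw [e]
  refine (abs_add_le _ _).trans ?_
  rw [abs_mul, abs_mul, abs_of_nonneg (by positivity : 0 ≤ a / ((m : ℝ) + 1)),
    abs_of_nonneg (by linarith : 0 ≤ s)]
  have hP0 : 0 ≤ P := by linarith
  calc |P - s| * (a / ((m : ℝ) + 1)) + s * |a - b|
      ≤ P * s * (P / (((k + m : ℕ) : ℝ) + 1)) + s * (k / (((k + m : ℕ) : ℝ) + 1)) := by gcongr
    _ = (s * P ^ 2 + s * k) / (((k + m : ℕ) : ℝ) + 1) := by ring
    _ ≤ 3 * s * P ^ 2 / (((k + m : ℕ) : ℝ) + 1) := by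
      refine div_le_div_of_nonneg_right ?_ hn.le
      have : (k : ℝ) ≤ P ^ 2 := by nlinarith
      nlinarith

/-- The phase of the spike is chosen so that `‖z‖ ^ k` recombines with it into `z ^ k`, the factor
left over from `z ^ j = z ^ k * z ^ (j - k)`. -/
theorem norm_pow_mul_conj_spike {N : ℕ} (e : Fin N → ℕ) (q : ℕ) (α β : ℝ) (x lam kap : ℂ) (k : ℕ) :
    ((‖x ^ symIndex e‖ ^ k : ℝ) : ℂ) * (starRingEnd ℂ) (spike e q α β x lam kap k) =
      (x ^ symIndex e) ^ k * (((symIndex e : ℝ) / Real.sqrt (pIdx e q k) : ℝ) : ℂ) *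
        amplitude e lam kap (pIdx e q k) / (weight e q α β k : ℂ) := by
  have h1 : (starRingEnd ℂ) (Complex.exp (-Complex.I * k * Complex.arg (x ^ symIndex e))) =
      Complex.exp (Complex.arg (x ^ symIndex e) * Complex.I) ^ k := by
    rw [← Complex.exp_conj, ← Complex.exp_nat_mul]
    congr 1
    simp only [map_mul, map_neg, Complex.conj_I, Complex.conj_ofReal, Complex.conj_natCast, neg_neg]
    ring
  conv_rhs => rw [← Complex.norm_mul_exp_arg_mul_I (x ^ symIndex e)]
  simp only [spike, map_div₀, map_mul, h1, Complex.conj_ofReal, Complex.conj_conj]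
  push_cast
  ring

theorem norm_amplitude_le {N : ℕ} {e : Fin N → ℕ} {lam kap : ℂ} {A K : ℝ} (hs : 1 ≤ symIndex e)
    (hA : 0 < A) (hl : ‖lam‖ ≤ A) (hk : ‖kap‖ ≤ K) {p : ℕ} (hp : 1 ≤ p) :
    ‖amplitude e lam kap p‖ ≤ K / A * (p * A ^ p) := by
  have hAp : A ^ p = A ^ (p - 1) * A := by rw [← pow_succ, Nat.sub_add_cancel hp]
  have h1 : (Real.sqrt (symIndex e))⁻¹ / (2 * Real.sqrt Real.pi) ≤ 1 := by
    have h2 : (Real.sqrt (symIndex e))⁻¹ ≤ 1 :=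
      inv_le_one_of_one_le₀ (Real.one_le_sqrt.2 (by exact_mod_cast hs))
    have h3 : (1 : ℝ) ≤ Real.sqrt Real.pi := Real.one_le_sqrt.2 (by linarith [Real.pi_gt_three])
    rw [div_le_one (by positivity)]
    linarith
  have hK : 0 ≤ K := (norm_nonneg _).trans hk
  rw [amplitude, norm_mul, norm_mul, norm_mul, norm_neg, norm_pow, Complex.norm_real,
    Complex.norm_natCast, Real.norm_of_nonneg (by positivity)]
  calc _ ≤ 1 * (p : ℝ) * K * A ^ (p - 1) := by gcongr
    _ = _ := by rw [hAp]; field_simp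

theorem succ_le_pIdx {N : ℕ} (e : Fin N → ℕ) {q : ℕ} (hs : 1 ≤ symIndex e) (hq : 1 ≤ q) (k : ℕ) :
    k + 1 ≤ pIdx e q k := by
  have : k * 1 ≤ k * symIndex e := Nat.mul_le_mul_left k hs
  unfold pIdx
  omega

theorem pow_le_weight {N : ℕ} (e : Fin N → ℕ) {q : ℕ} (hs : 1 ≤ symIndex e) (hq : 1 ≤ q) {α β : ℝ}
    (hα : 0 < α) (hβ : 0 < β) (k : ℕ) : α ^ pIdx e q k ≤ weight e q α β k := by
  have h1 : (1 : ℝ) ≤ pIdx e q k := by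
    exact_mod_cast (Nat.le_add_left 1 k).trans (succ_le_pIdx e hs hq k)
  exact le_mul_of_one_le_left (by positivity) (Real.one_le_rpow h1 (by positivity))

/-- The summable majorant of the weighted columns. -/
noncomputable def columnBound {N : ℕ} (e : Fin N → ℕ) (q : ℕ) (A K α γ : ℝ) (k : ℕ) : ℝ :=
  (symIndex e : ℝ) * (K + 3 * (K / A)) * ((pIdx e q k : ℝ) ^ 4 * (γ * A / α) ^ pIdx e q k)

theorem summable_columnBound {N : ℕ} (e : Fin N → ℕ) {q : ℕ} (hs : 1 ≤ symIndex e) {A K α γ : ℝ}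
    (h0 : 0 ≤ γ * A / α) (h1 : γ * A / α < 1) : Summable (columnBound e q A K α γ) := by
  refine Summable.mul_left _ ?_
  have h := summable_pow_mul_geometric_of_norm_lt_one 4
    (by rwa [Real.norm_of_nonneg h0] : ‖γ * A / α‖ < 1)
  refine h.comp_injective fun a b hab => ?_
  simp only [pIdx] at hab
  exact Nat.eq_of_mul_eq_mul_right hs (by omega)

/-- The growth of `‖z‖ ^ k` is absorbed into the weight: `k s ≤ p_k` turns it into at most `γ ^
p_k`, with `γ` slightly above 1. -/
theorem norm_pow_mul_le {N : ℕ} {e : Fin N → ℕ} {q : ℕ} {z : ℂ} {A α β γ : ℝ}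
    (hs : 1 ≤ symIndex e) (hq : 1 ≤ q) (hA : 0 < A) (hα : 0 < α) (hβ : 0 < β) (hγ : 1 ≤ γ)
    (hz : ‖z‖ ≤ γ ^ symIndex e) (k : ℕ) :
    ‖z‖ ^ k * A ^ pIdx e q k / (Real.sqrt (pIdx e q k) * weight e q α β k) ≤
      (γ * A / α) ^ pIdx e q k := by
  have h1 : ‖z‖ ^ k ≤ γ ^ pIdx e q k := by
    calc ‖z‖ ^ k ≤ (γ ^ symIndex e) ^ k := by gcongr
      _ = γ ^ (k * symIndex e) := by rw [← pow_mul, mul_comm]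
      _ ≤ γ ^ pIdx e q k := pow_le_pow_right₀ hγ (by unfold pIdx; omega)
  have h2 : (1 : ℝ) ≤ Real.sqrt (pIdx e q k) := Real.one_le_sqrt.2 (by
    exact_mod_cast (Nat.le_add_left 1 k).trans (succ_le_pIdx e hs hq k))
  have h3 := pow_le_weight e hs hq hα hβ k
  have h4 : α ^ pIdx e q k ≤ Real.sqrt (pIdx e q k) * weight e q α β k := by
    have : 0 < α ^ pIdx e q k := by positivity
    nlinarith
  rw [div_pow, mul_pow]
  gcongr

/-- The extra factor `p_k` serves twice: it dominates `k + 1` in the Gram estimate, and `j + 1` for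
the entries above the diagonal. -/
theorem norm_spike_column_le {N : ℕ} {e : Fin N → ℕ} {q : ℕ} {x lam kap : ℂ} {A K α β γ : ℝ}
    (hs : 1 ≤ symIndex e) (hq : 1 ≤ q) (hA : 0 < A) (hα : 0 < α) (hβ : 0 < β) (hγ : 1 ≤ γ)
    (hz : ‖x ^ symIndex e‖ ≤ γ ^ symIndex e) (hl : ‖lam‖ ≤ A) (hk : ‖kap‖ ≤ K) (k : ℕ) :
    (pIdx e q k : ℝ) * (‖x ^ symIndex e‖ ^ k * ‖spike e q α β x lam kap k‖) ≤
      columnBound e q A K α γ k := by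
  have hP1 : (1 : ℝ) ≤ pIdx e q k := by
    exact_mod_cast (Nat.le_add_left 1 k).trans (succ_le_pIdx e hs hq k)
  have hK : 0 ≤ K := (norm_nonneg _).trans hk
  have hW : 0 < weight e q α β k := (pow_pos hα _).trans_le (pow_le_weight e hs hq hα hβ k)
  have hsp : 0 < Real.sqrt (pIdx e q k) := Real.sqrt_pos.2 (by linarith)
  have hamp := norm_amplitude_le hs hA hl hk (p := pIdx e q k) (by exact_mod_cast hP1)
  have hmul := norm_pow_mul_le (q := q) (β := β) (z := x ^ symIndex e) hs hq hA hα hβ hγ hz k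
  have e1 : ‖x ^ symIndex e‖ ^ k * ‖spike e q α β x lam kap k‖ =
      ‖x ^ symIndex e‖ ^ k * ((symIndex e : ℝ) / Real.sqrt (pIdx e q k)) *
        ‖amplitude e lam kap (pIdx e q k)‖ / weight e q α β k := by
    have := congrArg norm (norm_pow_mul_conj_spike e q α β x lam kap k)
    rwa [norm_mul, norm_div, norm_mul, norm_mul, RCLike.norm_conj, Complex.norm_real,
      Complex.norm_real, Complex.norm_real, norm_pow (x ^ symIndex e) k, Real.norm_of_nonneg (by positivity),
      Real.norm_of_nonneg (by positivity), Real.norm_of_nonneg hW.le] at this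
  rw [e1, columnBound]
  set P : ℝ := (pIdx e q k : ℝ)
  set S : ℝ := (symIndex e : ℝ)
  set W := weight e q α β k
  have hS : 0 ≤ S := Nat.cast_nonneg _
  calc P * (‖x ^ symIndex e‖ ^ k * (S / Real.sqrt P) * ‖amplitude e lam kap (pIdx e q k)‖ / W)
      ≤ P * (‖x ^ symIndex e‖ ^ k * (S / Real.sqrt P) * (K / A * (P * A ^ pIdx e q k)) / W) := by
        gcongr
    _ = S * (K / A) * P ^ 2 * (‖x ^ symIndex e‖ ^ k * A ^ pIdx e q k / (Real.sqrt P * W)) := by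
        field_simp
    _ ≤ S * (K / A) * P ^ 2 * (γ * A / α) ^ pIdx e q k := by gcongr
    _ ≤ S * (K + 3 * (K / A)) * P ^ 4 * (γ * A / α) ^ pIdx e q k := by
        have h1 : 0 ≤ K / A := by positivity
        have h0 : 0 ≤ γ * A / α := by positivity
        gcongr
        · linarith
        · norm_num
    _ = _ := by ring

theorem norm_synthesis_sub_spike_le {N : ℕ} {e : Fin N → ℕ} {ζ : Fin N → ℂ} {q : ℕ}
    {x lam kap : ℂ} {A K α β γ : ℝ}
    (hs : 1 ≤ symIndex e) (hq : 1 ≤ q) (hA : 0 < A) (hα : 0 < α) (hβ : 0 < β) (hγ : 1 ≤ γ)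
    (hz : ‖x ^ symIndex e‖ ≤ γ ^ symIndex e) (hl : ‖lam‖ ≤ A) (hk : ‖kap‖ ≤ K)
    (hR : ∀ p m : ℕ, 1 ≤ p → ‖powCoeff e ζ p m * (x ^ symIndex e) ^ m -
        amplitude e lam kap p * ((Real.sqrt ((m : ℝ) + 1))⁻¹ / ((m : ℝ) + 1) : ℝ)‖ ≤
          K * ((p : ℝ) ^ 2 * A ^ p) / ((m : ℝ) + 1) ^ 2) (j k : ℕ) :
    ‖(x ^ symIndex e) ^ j * synthesisMatrix e ζ q α β j k -
      ((‖x ^ symIndex e‖ ^ k : ℝ) * (starRingEnd ℂ) (spike e q α β x lam kap k)) *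
        ((Real.sqrt ((j : ℝ) + 1))⁻¹ : ℝ)‖ ≤ columnBound e q A K α γ k / ((j : ℝ) + 1) := by
  have hkP : (k : ℝ) + 1 ≤ pIdx e q k := by exact_mod_cast succ_le_pIdx e hs hq k
  have hk0 : (0 : ℝ) ≤ k := Nat.cast_nonneg k
  rcases lt_or_ge j k with hjk | hjk
  -- Here the entry vanishes while the leading term does not; since `j + 1 ≤ p_k`, that term is
  -- itself an admissible error.
  · have h1 := norm_spike_column_le (β := β) (q := q) hs hq hA hα hβ hγ hz hl hk k
    rw [synthesisMatrix, gramVec, if_neg (not_le.2 hjk), zero_div, mul_zero, zero_sub, norm_neg,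
      norm_mul, norm_mul, RCLike.norm_conj, Complex.norm_real, Complex.norm_real,
      Real.norm_of_nonneg (by positivity), Real.norm_of_nonneg (by positivity),
      le_div_iff₀ (by positivity)]
    refine le_trans ?_ h1
    have h2 := inv_sqrt_succ_le_one j
    have h3 : (j : ℝ) + 1 ≤ pIdx e q k := by
      have : (j : ℝ) + 1 ≤ k := by exact_mod_cast hjk
      linarith
    set D := ‖x ^ symIndex e‖ ^ k * ‖spike e q α β x lam kap k‖
    have hD : 0 ≤ D := by positivity
    calc D * (Real.sqrt ((j : ℝ) + 1))⁻¹ * ((j : ℝ) + 1) ≤ D * 1 * pIdx e q k := by gcongr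
      _ = _ := by ring
  · obtain ⟨m, rfl⟩ := Nat.exists_eq_add_of_le hjk
    have hK : 0 ≤ K := (norm_nonneg _).trans hk
    have hp1 : 1 ≤ pIdx e q k := (Nat.le_add_left 1 k).trans (succ_le_pIdx e hs hq k)
    have hW : 0 < weight e q α β k := (pow_pos hα _).trans_le (pow_le_weight e hs hq hα hβ k)
    have hmul := norm_pow_mul_le (q := q) (β := β) (z := x ^ symIndex e) hs hq hA hα hβ hγ hz k
    have hamp := norm_amplitude_le hs hA hl hk hp1
    have hRm := hR (pIdx e q k) m hp1
    have hpj : (pIdx e q (k + m) : ℝ) = pIdx e q k + m * symIndex e := by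
      simp only [pIdx]; push_cast; ring
    have hs' : (1 : ℝ) ≤ symIndex e := by exact_mod_cast hs
    have habs := abs_shifted_sub_le (m := m) hs' hkP
    rw [norm_pow_mul_conj_spike, synthesisMatrix, gramVec, if_pos hjk, Nat.add_sub_cancel_left, hpj,
      columnBound]
    set P : ℝ := (pIdx e q k : ℝ) with hP
    set S : ℝ := (symIndex e : ℝ) with hS
    set W := weight e q α β k with hWdef
    set a := amplitude e lam kap (pIdx e q k) with ha
    set R := powCoeff e ζ (pIdx e q k) m with hRdef
    set z := x ^ symIndex e with hzdef
    set g := (Real.sqrt ((m : ℝ) + 1))⁻¹ / ((m : ℝ) + 1) with hg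
    set u := (Real.sqrt (((k + m : ℕ) : ℝ) + 1))⁻¹ with hu
    have hP1 : 1 ≤ P := by linarith
    have hsp : 0 < Real.sqrt P := Real.sqrt_pos.2 (by linarith)
    have hspc : ((Real.sqrt P : ℝ) : ℂ) ≠ 0 := by exact_mod_cast hsp.ne'
    have hWc : (W : ℂ) ≠ 0 := by exact_mod_cast hW.ne'
    have hm : (0 : ℝ) ≤ m := Nat.cast_nonneg m
    -- Two errors: that of the coefficient asymptotics, and that of replacing `p_j (m+1)^(-3/2)` by
    -- `s (j+1)^(-1/2)`.
    have e1 : z ^ (k + m) * ((((P + m * S) / Real.sqrt P : ℝ) : ℂ) * R / W) -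
        z ^ k * ((S / Real.sqrt P : ℝ) : ℂ) * a / W * (u : ℂ) =
        z ^ k / ((Real.sqrt P * W : ℝ) : ℂ) * (((P + m * S : ℝ) : ℂ) * (R * z ^ m - a * (g : ℝ)) +
          a * (((P + m * S) * g - S * u : ℝ) : ℂ)) := by
      push_cast
      field_simp
      ring
    have hn : (0 : ℝ) < ((k + m : ℕ) : ℝ) + 1 := by positivity
    have h1 : ‖((P + m * S : ℝ) : ℂ) * (R * z ^ m - a * (g : ℝ))‖ ≤
        S * K * P ^ 4 * A ^ pIdx e q k / (((k + m : ℕ) : ℝ) + 1) := by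
      rw [norm_mul, Complex.norm_real, Real.norm_of_nonneg (by positivity)]
      have h2 : P + m * S ≤ P * S * (m + 1) := by
        nlinarith [mul_nonneg (by linarith : (0 : ℝ) ≤ P) (by linarith : (0 : ℝ) ≤ S - 1),
          mul_nonneg (mul_nonneg hm (by linarith : (0 : ℝ) ≤ S)) (by linarith : (0 : ℝ) ≤ P - 1)]
      have h3 : (((k + m : ℕ) : ℝ) + 1) ≤ P * (m + 1) := by push_cast; nlinarith
      calc (P + m * S) * ‖R * z ^ m - a * (g : ℝ)‖
          ≤ (P * S * (m + 1)) * (K * (P ^ 2 * A ^ pIdx e q k) / ((m : ℝ) + 1) ^ 2) := by gcongr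
        -- The fourth power: two factors from the transfer error, one from `p_j ≤ P S (m+1)`, one
        -- from exchanging `m + 1` for `k + m + 1`.
        _ = S * K * P ^ 4 * A ^ pIdx e q k / (P * (m + 1)) := by field_simp
        _ ≤ _ := by gcongr
    have h2 : ‖a * (((P + m * S) * g - S * u : ℝ) : ℂ)‖ ≤
        S * (3 * (K / A)) * P ^ 4 * A ^ pIdx e q k / (((k + m : ℕ) : ℝ) + 1) := by
      rw [norm_mul, Complex.norm_real, Real.norm_eq_abs]
      calc ‖a‖ * |(P + m * S) * g - S * u|
          ≤ (K / A * (P * A ^ pIdx e q k)) * (3 * S * P ^ 2 / (((k + m : ℕ) : ℝ) + 1)) := by gcongr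
        _ = S * (3 * (K / A)) * P ^ 3 * A ^ pIdx e q k / (((k + m : ℕ) : ℝ) + 1) := by ring
        _ ≤ _ := by
          have : P ^ 3 ≤ P ^ 4 := pow_le_pow_right₀ hP1 (by norm_num)
          gcongr
    rw [e1, norm_mul, norm_div, norm_pow, Complex.norm_real,
      Real.norm_of_nonneg (by positivity : 0 ≤ Real.sqrt P * W)]
    calc ‖z‖ ^ k / (Real.sqrt P * W) * ‖((P + m * S : ℝ) : ℂ) * (R * z ^ m - a * (g : ℝ)) +
          a * (((P + m * S) * g - S * u : ℝ) : ℂ)‖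
        ≤ ‖z‖ ^ k / (Real.sqrt P * W) *
          (S * K * P ^ 4 * A ^ pIdx e q k / (((k + m : ℕ) : ℝ) + 1) +
            S * (3 * (K / A)) * P ^ 4 * A ^ pIdx e q k / (((k + m : ℕ) : ℝ) + 1)) := by
          refine mul_le_mul_of_nonneg_left ((norm_add_le _ _).trans (add_le_add h1 h2)) ?_
          positivity
      _ = S * (K + 3 * (K / A)) * P ^ 4 * (‖z‖ ^ k * A ^ pIdx e q k / (Real.sqrt P * W)) /
          (((k + m : ℕ) : ℝ) + 1) := by ring
      _ ≤ S * (K + 3 * (K / A)) * P ^ 4 * (γ * A / α) ^ pIdx e q k /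
          (((k + m : ℕ) : ℝ) + 1) := by gcongr
      _ = _ := by rw [mul_assoc _ (P ^ 4)]

/-- The left side does not involve `ε` along the path; it is the nondegeneracy of column 0 from
which the limit of `z_*(ε)` is extracted. -/
theorem norm_spike_zero_ge {N : ℕ} {e : Fin N → ℕ} {q : ℕ} {x lam kap : ℂ} {α β c₀ : ℝ}
    (hs : 1 ≤ symIndex e) (hq : 1 ≤ q) (hα : 0 < α) (hβ : 0 < β) (hc : 0 < c₀)
    (hl : c₀ ≤ ‖lam‖) (hk : c₀ ≤ ‖kap‖) :
    (symIndex e : ℝ) / Real.sqrt (pIdx e q 0) * ((Real.sqrt (symIndex e))⁻¹ /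
      (2 * Real.sqrt Real.pi) * (pIdx e q 0 : ℝ) * c₀ * c₀ ^ (pIdx e q 0 - 1)) /
      weight e q α β 0 ≤ ‖spike e q α β x lam kap 0‖ := by
  have hW : 0 < weight e q α β 0 := (pow_pos hα _).trans_le (pow_le_weight e hs hq hα hβ 0)
  have h := congrArg norm (norm_pow_mul_conj_spike e q α β x lam kap 0)
  rw [pow_zero, pow_zero, Complex.ofReal_one, one_mul, one_mul, RCLike.norm_conj, norm_div,
    norm_mul, Complex.norm_real, Complex.norm_real, Real.norm_of_nonneg (by positivity),
    Real.norm_of_nonneg hW.le, amplitude, norm_mul, norm_mul, norm_mul, norm_neg, norm_pow,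
    Complex.norm_real, Complex.norm_natCast, Real.norm_of_nonneg (by positivity)] at h
  rw [h]
  gcongr

end TodaHessian

/-! ### Assembly along the critical path. -/

theorem mainTheorem4 {N : ℕ} (e : Fin N → ℕ) (he : StrictMono e) (he2 : ∀ n, 2 ≤ e n)
    (ζ : ℝ → Fin N → ℂ) (xs lam kap : ℝ → ℂ)
    (h : StandingHypotheses e ζ xs lam kap)
    (α β : ℝ) (hβ : 0 < β) (hα : AdmissibleWeight e ζ lam α)
    (q : ℕ) (hq1 : 1 ≤ q) (hqs : q ≤ symIndex e) :
    ∃ (V C : ℝ → EllTwo →L[ℂ] EllTwo) (d : ℝ → EllTwo) (Cs : EllTwo →L[ℂ] EllTwo),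
      (∀ᶠ ε in 𝓝[>] (0 : ℝ),
        HasMatrix (V ε) (synthesisMatrix e (ζ ε) q α β) ∧
        (∀ j, (d ε : ℕ → ℂ) j = spike e q α β (xs ε) (lam ε) (kap ε) j) ∧
        (V ε).adjoint ∘L V ε =
          (logScale e (ζ ε) : ℂ) • InnerProductSpace.rankOne ℂ (d ε) (d ε) + C ε ∧
        IsHilbertSchmidt (C ε) ∧ IsCompactOperator (C ε)) ∧
      IsHilbertSchmidt Cs ∧ IsCompactOperator Cs ∧
      Tendsto (fun ε => ‖C ε - Cs‖) (𝓝[>] 0) (𝓝 0) ∧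
      Tendsto (fun ε => hsNorm (C ε - Cs)) (𝓝[>] 0) (𝓝 0) := by
  have hs : 1 ≤ symIndex e := hq1.trans hqs
  obtain ⟨A, hA, hAα, K, hK, c₀, hc₀, hev⟩ := exists_powCoeff_asymptotic h hα hs
  have hα0 : 0 < α := hA.trans hAα
  -- Part of the margin between `A` and `α` is set aside for the growth of `‖z_*(ε)‖ ^ k`.
  obtain ⟨γ, hγ1, hγ⟩ := exists_between (show 1 < α / A by rwa [lt_div_iff₀ hA, one_mul])
  have hγα : γ * A / α < 1 := by
    rw [div_lt_one hα0]
    exact (lt_div_iff₀ hA).1 hγ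
  have hγ0 : 0 ≤ γ * A / α := div_nonneg (mul_nonneg (by linarith) hA.le) hα0.le
  have hid : Tendsto (fun ε : ℝ => ε) (𝓝[>] 0) (𝓝 0) := nhdsWithin_le_nhds
  have hε0 : ∀ᶠ ε in 𝓝[>] (0 : ℝ), 0 < ε := self_mem_nhdsWithin
  have hzγ : ∀ᶠ ε in 𝓝[>] (0 : ℝ), ‖xs ε ^ symIndex e‖ ≤ γ ^ symIndex e := by
    filter_upwards [hev, hε0, (hid.const_add 1).eventually_le_const (by linarith : 1 + 0 < γ)]
      with ε h1 h2 h3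
    rw [h1.2.1]
    exact pow_le_pow_left₀ (by linarith) h3 _
  have hz1 : Tendsto (fun ε => ‖xs ε ^ symIndex e‖) (𝓝[>] 0) (𝓝 1) := by
    have h1 := (hid.const_add 1).pow (symIndex e)
    rw [add_zero, one_pow] at h1
    exact h1.congr' (hev.mono fun ε h => h.2.1.symm)
  have hzgt : ∀ᶠ ε in 𝓝[>] (0 : ℝ), 1 < ‖xs ε ^ symIndex e‖ := by
    filter_upwards [hev, hε0] with ε h1 h2
    rw [h1.2.1]
    exact one_lt_pow₀ (by linarith) (by omega)
  have hζ : Tendsto ζ (𝓝[>] 0) (𝓝 (ζ 0)) := by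
    obtain ⟨ε₁, hε₁, hζ⟩ := h.path
    exact (hζ.continuousOn 0 (left_mem_Icc.2 hε₁.le)).tendsto.mono_left
      (nhdsWithin_le_of_mem (mem_of_superset (Ioo_mem_nhdsGT hε₁) Ioo_subset_Icc_self))
  -- Each entry involves a single Taylor coefficient of a power of the branch, so it has a limit at
  -- the critical point, where the columns need not be square summable.
  have hv : ∀ j k, Tendsto (fun ε => synthesisMatrix e (ζ ε) q α β j k) (𝓝[>] 0)
      (𝓝 (synthesisMatrix e (ζ 0) q α β j k)) := by
    intro j k
    simp only [synthesisMatrix, gramVec]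
    split_ifs
    · exact ((((continuous_powCoeff e he2 _ _).tendsto _).comp hζ).const_mul _).div_const _
    · exact tendsto_const_nhds
  refine exists_gram_remainder_limit (z := fun ε => xs ε ^ symIndex e)
    (B := columnBound e q A K α γ) (v0 := synthesisMatrix e (ζ 0) q α β)
    (a := fun ε => spike e q α β (xs ε) (lam ε) (kap ε)) ?_
    (summable_columnBound e hs hγ0 hγα) hzgt hz1 hv ?_ ?_
    (hev.mono fun ε h1 => norm_spike_zero_ge hs hq1 hα0 hβ hc₀ h1.2.2.1 h1.2.2.2.2.1)
    (tendsto_logScale_sub_logSeries hs (hev.mono fun ε h => h.1) (hev.mono fun ε h => h.2.1))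
    (tendsto_norm_sub_one_mul_logSeries hzgt hz1)
  · have hW := (pow_pos hα0 _).trans_le (pow_le_weight e hs hq1 hα0 hβ 0)
    have hp : 0 < (pIdx e q 0 : ℝ) := by
      exact_mod_cast (Nat.succ_pos 0).trans_le (succ_le_pIdx e hs hq1 0)
    have hs' : 0 < (symIndex e : ℝ) := by exact_mod_cast hs
    have hpi := Real.pi_pos
    positivity
  · filter_upwards [hev, hzγ] with ε h1 h2
    exact norm_synthesis_sub_spike_le hs hq1 hA hα0 hβ hγ1.le h2 h1.2.2.2.1 h1.2.2.2.2.2.1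
      h1.2.2.2.2.2.2
  · filter_upwards [hev, hzγ] with ε h1 h2 k
    have h3 := norm_spike_column_le (β := β) (q := q) hs hq1 hA hα0 hβ hγ1.le h2 h1.2.2.2.1
      h1.2.2.2.2.2.1 k
    refine le_trans ?_ h3
    rw [mul_assoc]
    refine mul_le_mul_of_nonneg_right ?_ (by positivity)
    exact_mod_cast succ_le_pIdx e hs hq1 k
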